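/- Let $m\ge 1$ be squarefree, $K=\mathbb{Q}(\sqrt{-m})\subset\mathbb{C}$ with ring of integers $\mathcal{O}$, and let $h(x,y)=\overline{x}^{\,tr}y$ be the standard Hermitian form on $\mathbb{C}^r$. A theta lattice of rank $r$ is an $\mathcal{O}$-submodule $\Lambda\subset\mathbb{C}^r$ which is a $\mathbb{Z}$-lattice of rank $2r$ and which is even and unimodular with respect to $\operatorname{Re} h$. It is called strongly modular if for every nonzero ideal $I$ of $\mathcal{O}$ the lattices $\Lambda$ and $N(I)^{-1/2}\,I\Lambda$ are isometric (via an $\mathcal{O}$-linear bijection preserving $h$). For $n\ge 1$ let $\mathbb{H}_n=\{Z\in\mathbb{C}^{n\times n} : \frac{1}{2i}(Z-\overline{Z}^{\,tr})>0\}$, and let $SU(n,n;\mathbb{C})$ be the group of all $M=\begin{pmatrix}A&B\\C&D\end{pmatrix}\in SL_{2n}(\mathbb{C})$ with $\overline{M}^{\,tr}JM=J$, where $J=\begin{pmatrix}0&-I\\I&0\end{pmatrix}$; it acts on $\mathbb{H}_n$ by $M\langle Z\rangle=(AZ+B)(CZ+D)^{-1}$. Let $\Gamma_n(\mathcal{O})=SU(n,n;\mathbb{C})\cap\mathcal{O}^{2n\times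 2n}$ be the Hermitian modular group, and let $$\Delta^*_{n,K}=\bigcup_{A\in\mathcal{A}}\begin{pmatrix}A&0\\0&\overline{A}^{\,-tr}\end{pmatrix}\Gamma_n(\mathcal{O}),\qquad \mathcal{A}=\Big\{A=\tfrac1u L\in SL_n(\mathbb{C}) : u\in\mathbb{C},\ L\in\mathcal{O}^{n\times n},\ \mathcal{I}(L)^n=\mathcal{O}\det L\Big\},$$ where $\mathcal{I}(L)$ is the ideal generated by the entries of $L$, be the extended Hermitian modular group (its maximal discrete extension in $SU(n,n;\mathbb{C})$). Theorem. If $\Lambda$ is a strongly modular theta lattice of rank $r$, then for every $n\ge1$ the theta series $$\Theta(Z,\Lambda)^{(n)}=\sum_{T\ge 0}\#\{\lambda\in\Lambda^n : \overline{\lambda}^{\,tr}\lambda=T\}\;e^{i\pi\,\mathrm{tr}(TZ)}$$ (a sum over all positive semidefinite Hermitian matrices $T$, with finite coefficients, absolutely convergent for every $Z\in\mathbb{H}_n$) is a modular form of weight $r$ with respect to $\Delta^*_{n,K}$: it is holomorphic on $\mathbb{H}_n$, it satisfies $\Theta(M\langle Z\rangle,\Lambda)^{(n)}=\det(CZ+D)^{r}\,\Theta(Z,\Lambda)^{(n)}$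 for all $M=\begin{pmatrix}A&B\\C&D\end{pmatrix}\in\Delta^*_{n,K}$ and all $Z\in\mathbb{H}_n$, and, if $n=1$, it is bounded on $\{Z\in\mathbb{H}_1 : \operatorname{Im} Z\ge 1\}$. -/

import Mathlib

open scoped NumberField ComplexOrder Pointwise Matrix

noncomputable section

namespace HermitianTheta

/-! ## The imaginary quadratic field -/

/-- The imaginary quadratic number field `ℚ(√-m)`, as a subfield of `ℂ`. -/
abbrev imQuadField (m : ℕ) : IntermediateField ℚ ℂ :=
  IntermediateField.adjoin ℚ {(Real.sqrt m : ℂ) * Complex.I}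

theorem isIntegral_gen (m : ℕ) : IsIntegral ℚ ((Real.sqrt m : ℂ) * Complex.I) := by
  refine IsIntegral.of_pow (n := 2) (by norm_num) ?_
  have h : ((Real.sqrt m : ℂ) * Complex.I) ^ 2 = algebraMap ℚ ℂ (-(m : ℚ)) := by
    rw [mul_pow, Complex.I_sq, ← Complex.ofReal_pow, Real.sq_sqrt (Nat.cast_nonneg m)]
    simp
  rw [h]
  exact isIntegral_algebraMap

instance (m : ℕ) : FiniteDimensional ℚ (imQuadField m) :=
  IntermediateField.adjoin.finiteDimensional (isIntegral_gen m)

instance (m : ℕ) : NumberField (imQuadField m) where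

/-! ## The special unitary group, the Hermitian half space, and the groups acting on it -/

/-- `SU(n,n;ℂ)`: determinant one and `conj(M)ᵗ J M = J`, where `J = (0, -1; 1, 0)`. -/
def SU (n : ℕ) : Set (Matrix (Fin n ⊕ Fin n) (Fin n ⊕ Fin n) ℂ) :=
  {M | M.det = 1 ∧ Mᴴ * Matrix.J (Fin n) ℂ * M = Matrix.J (Fin n) ℂ}

/-- The Hermitian half space of degree `n`. -/
def halfSpace (n : ℕ) : Set (Matrix (Fin n) (Fin n) ℂ) :=
  {Z | ((1 / (2 * Complex.I)) • (Z - Zᴴ)).PosDef}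

/-- The automorphy factor matrix `C Z + D` of `M = (A, B; C, D)`. -/
def denom {n : ℕ} (M : Matrix (Fin n ⊕ Fin n) (Fin n ⊕ Fin n) ℂ) (Z : Matrix (Fin n) (Fin n) ℂ) :
    Matrix (Fin n) (Fin n) ℂ :=
  M.toBlocks₂₁ * Z + M.toBlocks₂₂

/-- The action `M⟨Z⟩ = (A Z + B) (C Z + D)⁻¹` of `M = (A, B; C, D)`. -/
def moebius {n : ℕ} (M : Matrix (Fin n ⊕ Fin n) (Fin n ⊕ Fin n) ℂ)
    (Z : Matrix (Fin n) (Fin n) ℂ) : Matrix (Fin n) (Fin n) ℂ :=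
  (M.toBlocks₁₁ * Z + M.toBlocks₁₂) * (denom M Z)⁻¹

variable (K : IntermediateField ℚ ℂ)

/-- The Hermitian modular group `SU(n,n;ℂ) ∩ 𝓞^{2n×2n}`. -/
def modularGroup (n : ℕ) : Set (Matrix (Fin n ⊕ Fin n) (Fin n ⊕ Fin n) ℂ) :=
  {M | M ∈ SU n ∧ ∀ i j, M i j ∈ Set.range (algebraMap (𝓞 K) ℂ)}

/-- The ideal generated by the entries of `L`. -/
def entryIdeal {n : ℕ} (L : Matrix (Fin n) (Fin n) (𝓞 K)) : Ideal (𝓞 K) :=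
  Ideal.span {a | ∃ i j, L i j = a}

/-- The matrices `A = u⁻¹ L ∈ SL_n(ℂ)`, where `u ∈ ℂ` and `L` is an integral matrix such that the
`n`-th power of the ideal generated by its entries is the principal ideal of its determinant. -/
def extensionMatrices (n : ℕ) : Set (Matrix (Fin n) (Fin n) ℂ) :=
  {A | A.det = 1 ∧ ∃ (u : ℂ) (L : Matrix (Fin n) (Fin n) (𝓞 K)),
    A = u⁻¹ • L.map (algebraMap (𝓞 K) ℂ) ∧ entryIdeal K L ^ n = Ideal.span {L.det}}

/-- The block diagonal matrix with blocks `A` and `conj(A)⁻ᵗ`. -/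
def blockMatrix {n : ℕ} (A : Matrix (Fin n) (Fin n) ℂ) :
    Matrix (Fin n ⊕ Fin n) (Fin n ⊕ Fin n) ℂ :=
  Matrix.fromBlocks A 0 0 (Aᴴ)⁻¹

/-- The maximal discrete extension of the Hermitian modular group in `SU(n,n;ℂ)` (extended
Hermitian modular group): the union of the cosets `M_A Γ_n`. -/
def extendedModularGroup (n : ℕ) : Set (Matrix (Fin n ⊕ Fin n) (Fin n ⊕ Fin n) ℂ) :=
  {M | ∃ A ∈ extensionMatrices K n, ∃ γ ∈ modularGroup K n, M = blockMatrix A * γ}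

/-- `f` is a modular form of degree `n` and weight `k` with respect to `G`: it is holomorphic on the
half space, it transforms with the factor `det (C Z + D) ^ k`, and in degree one it is bounded on
`Im Z ≥ 1`. Only the values of `f` on the half space matter. -/
structure IsModularForm {n : ℕ} (G : Set (Matrix (Fin n ⊕ Fin n) (Fin n ⊕ Fin n) ℂ)) (k : ℤ)
    (f : Matrix (Fin n) (Fin n) ℂ → ℂ) : Prop where
  holomorphic : DifferentiableOn ℂ f (halfSpace n)
  transform : ∀ M ∈ G, ∀ Z ∈ halfSpace n, f (moebius M Z) = (denom M Z).det ^ k * f Z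
  bounded : n = 1 →
    ∃ C : ℝ, ∀ Z ∈ halfSpace n, (∀ i, 1 ≤ (Z i i).im) → ‖f Z‖ ≤ C

/-! ## Theta lattices -/

/-- The standard Hermitian form `h(x, y) = conj(x)ᵗ y` on `ℂ^r`. -/
def herm {r : ℕ} (x y : Fin r → ℂ) : ℂ := star x ⬝ᵥ y

variable {K} {r : ℕ}

/-- A theta lattice of rank `r`: an `𝓞`-submodule of `ℂ^r` that is a `ℤ`-lattice of rank `2r`
(discrete and of full real rank; its `K`-span is then automatically `r`-dimensional over `K`), and
that is even and unimodular for the real bilinear form `Re h`. -/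
structure IsThetaLattice (Λ : Submodule (𝓞 K) (Fin r → ℂ)) : Prop where
  discrete : DiscreteTopology Λ
  span_eq_top : Submodule.span ℝ (Λ : Set (Fin r → ℂ)) = ⊤
  even : ∀ x ∈ Λ, ∃ k : ℤ, (herm x x).re = 2 * k
  unimodular : ∀ y : Fin r → ℂ, (∀ x ∈ Λ, ∃ k : ℤ, (herm x y).re = k) ↔ y ∈ Λ

/-- Two Hermitian lattices are isometric. -/
def Isometric (Λ Λ' : Submodule (𝓞 K) (Fin r → ℂ)) : Prop :=
  ∃ φ : Λ ≃ₗ[𝓞 K] Λ', ∀ x y : Λ, herm (φ x : Fin r → ℂ) (φ y) = herm (x : Fin r → ℂ) y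

/-- The lattice `N(I)^{-1/2} I Λ`. -/
def scaledLattice [NumberField K] (I : Ideal (𝓞 K)) (Λ : Submodule (𝓞 K) (Fin r → ℂ)) :
    Submodule (𝓞 K) (Fin r → ℂ) :=
  (((Real.sqrt (Ideal.absNorm I))⁻¹ : ℝ) : ℂ) • (I • Λ)

/-- `Λ ≅ N(I)^{-1/2} I Λ` for all (nonzero) integral ideals `I`. -/
def IsStronglyModular [NumberField K] (Λ : Submodule (𝓞 K) (Fin r → ℂ)) : Prop :=
  ∀ I : Ideal (𝓞 K), I ≠ ⊥ → Isometric Λ (scaledLattice I Λ)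

/-! ## Theta series -/

/-- The tuples `λ = (λ_1, …, λ_n) ∈ Λ^n` with `conj(λ)ᵗ λ = T`. -/
def representations {n : ℕ} (Λ : Submodule (𝓞 K) (Fin r → ℂ)) (T : Matrix (Fin n) (Fin n) ℂ) :
    Set (Fin n → (Fin r → ℂ)) :=
  {v | (∀ i, v i ∈ Λ) ∧ ∀ i j, herm (v i) (v j) = T i j}

/-- The term `#(Λ,T) exp(iπ tr(T Z))` of the theta series. -/
def thetaTerm {n : ℕ} (Λ : Submodule (𝓞 K) (Fin r → ℂ)) (Z T : Matrix (Fin n) (Fin n) ℂ) : ℂ :=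
  ((representations Λ T).ncard : ℂ) * Complex.exp (Complex.I * Real.pi * (T * Z).trace)

/-- The theta series of degree `n`, a sum over all positive semidefinite Hermitian `T`. -/
def thetaSeries (n : ℕ) (Λ : Submodule (𝓞 K) (Fin r → ℂ)) (Z : Matrix (Fin n) (Fin n) ℂ) : ℂ :=
  ∑' T : {T : Matrix (Fin n) (Fin n) ℂ // T.PosSemidef}, thetaTerm Λ Z T

end HermitianTheta

end

open scoped NumberField ComplexOrder Pointwise Matrix

noncomputable section

namespace HermitianTheta

/-! ## Arithmetic of the imaginary quadratic field -/

/-! Grouping tuples by Gram matrix turns the series into `theta`, the sum of `exp(iπ tr(wᴴ w Z))`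
over the lattice `L = Λⁿ` of `r × n` matrices, which is self-dual for `Re tr(xᴴ y)`. Poisson
summation on `L`, continued analytically from `iY` to `Z`, gives the inversion formula
`theta_inversion`, with a translation on one side and a character on the other.

Let `M = (A, B; C, D)` lie in the Hermitian modular group with `det D ≠ 0`. Splitting `L` into
cosets of `L Dᴴ` and inverting twice expresses `theta (M⟨Z⟩)` as `det (C Z + D)^r theta (Z)` times a
Gauss sum of `S = B D⁻¹` divided by `(det D)^r` (`theta_moebius`). The Gauss sum has absolute value
`|det D|^r` (`gauss_sum_mul_star`), and `det D` is a rational integer. So for even `r` the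
multiplier is trivial as soon as the Gauss sum is positive.

Positivity starts in degree one. The transformation `τ ↦ -1/(τ + 1)` has order three, and following
it from `i` back to `i` gives `(-i)^r = 1`. Hence `r` is even, the degree one series has trivial
multiplier on `SL₂(ℤ)`, and the Gauss sums of rational numbers are positive (`exists_hasMean_one`).
In degree `n`, a Hermitian `S` with denominator prime to the ramified primes is split by coprime
factorisation of the denominator and then by diagonalisation modulo integral matrices, which reduces
it to rational numbers (`gaussPos_of_unramified`). At a ramified prime diagonalisation may fail,
because traces of integers can all vanish modulo `p`.

The ramified primes are avoided by moving `M`. Modulo a prime above a ramified `p` conjugation is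
trivial, so `(C, D)` reduces to a symmetric pair over `𝔽_p` and `det (C S + D) ≠ 0` there for some
symmetric `S` (`exists_isSymm_det_add_ne_zero`). The Chinese remainder theorem provides one integral
symmetric `S` for all ramified primes. At least one such prime exists, so `det (C S + D)` is also
nonzero. Translation by `S` does not change `theta`, which settles the Hermitian modular group
(`theta_modularGroup`).

For `A = u⁻¹ L` in the extension (here `L` is the integral matrix), with `I` the ideal of the
entries of `L`, the condition `Iⁿ = (det L)` and Cramer's rule give `Λⁿ L = (IΛ)ⁿ`, while `|u|² =
N(I)`. Up to a phase, `Λⁿ A` therefore consists of the tuples from `N(I)^{-1/2} IΛ`. Strong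
modularity identifies these with `Λⁿ` and keeps all Gram matrices, so `theta (A Z Aᴴ) = theta (Z)`.
-/

/-- The ring of integers, as a subring of `ℂ`. -/
def intRing (K : IntermediateField ℚ ℂ) : Subring ℂ := (algebraMap (𝓞 K) ℂ).range

theorem mem_intRing_iff {K : IntermediateField ℚ ℂ} {z : ℂ} :
    z ∈ intRing K ↔ z ∈ K ∧ IsIntegral ℤ z := by
  constructor
  · rintro ⟨x, rfl⟩
    exact ⟨(x : K).2, (NumberField.RingOfIntegers.isIntegral_coe x).map (IsScalarTower.toAlgHom ℤ K ℂ)⟩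
  · rintro ⟨h, h'⟩
    have : IsIntegral ℤ (⟨z, h⟩ : K) := by
      rw [← isIntegral_algebraMap_iff (B := ℂ) (algebraMap K ℂ).injective]
      exact h'
    exact ⟨⟨⟨z, h⟩, this⟩, rfl⟩

theorem intCast_mem_intRing {K : IntermediateField ℚ ℂ} (k : ℤ) : (k : ℂ) ∈ intRing K :=
  intCast_mem _ k

theorem gen_sq (m : ℕ) : ((Real.sqrt m : ℂ) * Complex.I) ^ 2 = -(m : ℂ) := by
  rw [mul_pow, Complex.I_sq, ← Complex.ofReal_pow, Real.sq_sqrt (Nat.cast_nonneg m)]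
  simp

theorem gen_mem_imQuadField (m : ℕ) : (Real.sqrt m : ℂ) * Complex.I ∈ imQuadField m :=
  IntermediateField.subset_adjoin ℚ _ rfl

theorem gen_mem_intRing (m : ℕ) : (Real.sqrt m : ℂ) * Complex.I ∈ intRing (imQuadField m) := by
  refine mem_intRing_iff.2 ⟨gen_mem_imQuadField m, IsIntegral.of_pow (n := 2) (by norm_num) ?_⟩
  rw [gen_sq]
  exact_mod_cast isIntegral_algebraMap (R := ℤ) (A := ℂ) (x := -(m : ℤ))

theorem conj_gen (m : ℕ) :
    star ((Real.sqrt m : ℂ) * Complex.I) = -((Real.sqrt m : ℂ) * Complex.I) := by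
  simp

theorem exists_rat_of_mem_imQuadField {m : ℕ} {z : ℂ} (hz : z ∈ imQuadField m) :
    ∃ a b : ℚ, z = a + b * ((Real.sqrt m : ℂ) * Complex.I) := by
  have hs := gen_sq m
  induction hz using IntermediateField.adjoin_induction with
  | mem x hx => exact ⟨0, 1, by simpa using hx⟩
  | algebraMap q => exact ⟨q, 0, by simp⟩
  | add x y _ _ hx hy =>
    obtain ⟨a, b, rfl⟩ := hx
    obtain ⟨c, d, rfl⟩ := hy
    exact ⟨a + c, b + d, by push_cast; ring⟩
  | mul x y _ _ hx hy =>
    obtain ⟨a, b, rfl⟩ := hx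
    obtain ⟨c, d, rfl⟩ := hy
    exact ⟨a * c - m * b * d, a * d + b * c, by push_cast; linear_combination (b * d : ℂ) * hs⟩
  | inv x _ hx =>
    obtain ⟨a, b, rfl⟩ := hx
    set δ := (Real.sqrt m : ℂ) * Complex.I
    by_cases h : (a : ℂ) + b * δ = 0
    · exact ⟨0, 0, by simp [h]⟩
    have h2 : (a : ℂ) - b * δ ≠ 0 := by
      intro h3
      apply h
      have := congrArg star h3
      simpa [δ] using this
    have h4 : ((a : ℂ) ^ 2 + m * b ^ 2) ≠ 0 := by
      have : (a : ℂ) ^ 2 + m * b ^ 2 = (a + b * δ) * (a - b * δ) := by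
        linear_combination (b ^ 2 : ℂ) * hs
      rw [this]
      exact mul_ne_zero h h2
    refine ⟨a / (a ^ 2 + m * b ^ 2), -b / (a ^ 2 + m * b ^ 2), ?_⟩
    rw [inv_eq_iff_eq_inv, ← sub_eq_zero]
    push_cast
    have : (a : ℂ) / (a ^ 2 + m * b ^ 2) + -b / (a ^ 2 + m * b ^ 2) * δ =
      (a + b * δ)⁻¹ := by
      field_simp
      linear_combination (-b ^ 2 : ℂ) * hs
    rw [this, inv_inv, sub_self]

theorem star_mem_intRing {m : ℕ} {z : ℂ} (hz : z ∈ intRing (imQuadField m)) :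
    star z ∈ intRing (imQuadField m) := by
  rw [mem_intRing_iff] at hz ⊢
  refine ⟨?_, hz.2.map (Complex.conjAe.toAlgHom.restrictScalars ℤ)⟩
  obtain ⟨a, b, rfl⟩ := exists_rat_of_mem_imQuadField hz.1
  rw [star_add, star_mul', conj_gen]
  simp only [Complex.star_def, map_ratCast]
  refine add_mem (SubfieldClass.ratCast_mem _ a) (mul_mem (SubfieldClass.ratCast_mem _ b)
    (neg_mem (gen_mem_imQuadField m)))

/-- Invariance under conjugation kills the `√-m` component, which leaves a rational algebraic
integer. Traces, norms and `det D` become rational integers through this lemma. -/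
theorem exists_int_of_mem_intRing {m : ℕ} {z : ℂ}
    (hz : z ∈ intRing (imQuadField m)) (h : star z = z) : ∃ k : ℤ, z = k := by
  rw [mem_intRing_iff] at hz
  obtain ⟨a, b, rfl⟩ := exists_rat_of_mem_imQuadField hz.1
  have hb : (b : ℂ) * ((Real.sqrt m : ℂ) * Complex.I) = 0 := by
    have : (2 : ℂ) * (b * ((Real.sqrt m : ℂ) * Complex.I)) = 0 := by
      rw [star_add, star_mul', conj_gen] at h
      simp only [Complex.star_def, map_ratCast] at h
      linear_combination -h
    simpa using this
  rw [hb, add_zero] at hz ⊢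
  have : IsIntegral ℤ a := by
    rw [← isIntegral_algebraMap_iff (B := ℂ) (algebraMap ℚ ℂ).injective]
    exact hz.2
  obtain ⟨k, hk⟩ := IsIntegrallyClosed.isIntegral_iff.1 this
  exact ⟨k, by rw [← hk]; simp⟩

theorem exists_int_sub_star_sq {m : ℕ} {z : ℂ}
    (hz : z ∈ intRing (imQuadField m)) : ∃ k : ℤ, (z - star z) ^ 2 = k :=
  exists_int_of_mem_intRing (pow_mem (sub_mem hz (star_mem_intRing hz)) 2)
    (by rw [star_pow, star_sub, star_star]; ring)

/-- The prime numbers `p` which are ramified: `p` divides `(x - conj x)²` for all integers `x`. -/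
def IsRamified (m p : ℕ) : Prop :=
  ∀ x ∈ intRing (imQuadField m), ∃ k : ℤ, (x - star x) ^ 2 = p * k

/-- The test element `x = √-m` has `(x - conj x)² = -4m`. This bounds the ramified primes, so that
the Chinese remainder theorem can treat all of them together. -/
theorem IsRamified.dvd {m p : ℕ} (h : IsRamified m p) : p ∣ 4 * m := by
  obtain ⟨k, hk⟩ := h _ (gen_mem_intRing m)
  rw [conj_gen] at hk
  have : (4 * m : ℂ) = p * (-k : ℤ) := by
    push_cast
    linear_combination -hk + 4 * gen_sq m
  have h2 : ((4 * m : ℕ) : ℤ) = p * (-k) := by exact_mod_cast this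
  exact_mod_cast Dvd.intro _ h2.symm

/-- With `e = (x - conj x)√-m` and `f = (x - conj x)²` one has `m f = -e²`. A prime `p ∣ m` divides
`e`, so `p²` divides `m f`, and squarefreeness of `m` pushes a factor `p` into `f`. For `m = 1` the
prime is `2`: the relation `t² + e² = 4N` between trace and norm makes `e` even. -/
theorem exists_prime_isRamified {m : ℕ} (hm : Squarefree m) : ∃ p, p.Prime ∧ IsRamified m p := by
  have hm0 : m ≠ 0 := hm.ne_zero
  have hs := gen_sq m
  set δ := (Real.sqrt m : ℂ) * Complex.I with hδ
  have hδ0 : δ ≠ 0 := by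
    intro h
    rw [h] at hs
    norm_num at hs
    exact hm0 hs
  have key : ∀ x ∈ intRing (imQuadField m), ∃ e f : ℤ, (x - star x) * δ = e ∧
      (x - star x) ^ 2 = f ∧ m * f = -e ^ 2 := by
    intro x hx
    obtain ⟨f, hf⟩ := exists_int_sub_star_sq hx
    obtain ⟨e, he⟩ := exists_int_of_mem_intRing
      (mul_mem (sub_mem hx (star_mem_intRing hx)) (gen_mem_intRing m))
      (by rw [star_mul', conj_gen, star_sub, star_star]; ring)
    refine ⟨e, f, he, hf, ?_⟩
    have : (m * f : ℂ) = -e ^ 2 := by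
      rw [← he, ← hf, mul_pow, hs]; ring
    exact_mod_cast this
  by_cases h1 : m = 1
  · refine ⟨2, Nat.prime_two, fun x hx => ?_⟩
    obtain ⟨e, f, he, hf, hef⟩ := key x hx
    obtain ⟨t, ht⟩ := exists_int_of_mem_intRing (add_mem hx (star_mem_intRing hx))
      (by rw [star_add, star_star]; ring)
    obtain ⟨N, hN⟩ := exists_int_of_mem_intRing (mul_mem hx (star_mem_intRing hx))
      (by rw [star_mul', star_star]; ring)
    have h4 : t ^ 2 - f = 4 * N := by
      have : (t ^ 2 - f : ℂ) = 4 * N := by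
        rw [← ht, ← hf, ← hN]; ring
      exact_mod_cast this
    subst h1
    have h5 : t ^ 2 + e ^ 2 = 4 * N := by push_cast at hef; linarith
    have h6 : Even e := by
      rcases Int.even_or_odd' e with ⟨a, rfl | rfl⟩ <;> rcases Int.even_or_odd' t with ⟨b, rfl | rfl⟩
      · simp
      · simp
      · exfalso; ring_nf at h5; omega
      · exfalso; ring_nf at h5; omega
    obtain ⟨a, rfl⟩ := h6
    refine ⟨-2 * a ^ 2, ?_⟩
    rw [hf]
    have : f = 2 * (-2 * a ^ 2) := by push_cast at hef; linarith
    rw [this]; push_cast; ring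
  · obtain ⟨p, hp, hpm⟩ := Nat.exists_prime_and_dvd h1
    refine ⟨p, hp, fun x hx => ?_⟩
    obtain ⟨e, f, he, hf, hef⟩ := key x hx
    obtain ⟨q, rfl⟩ := hpm
    have hpI := Nat.prime_iff_prime_int.1 hp
    have hpe : (p : ℤ) ∣ e := by
      apply hpI.dvd_of_dvd_pow (n := 2)
      rw [← dvd_neg, ← hef]
      push_cast
      exact ⟨q * f, by ring⟩
    obtain ⟨a, rfl⟩ := hpe
    have h2 : (q : ℤ) * f = p * (-a ^ 2) := by
      have h3 : (p : ℤ) * (q * f) = p * (p * (-a ^ 2)) := by push_cast at hef; linarith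
      exact mul_left_cancel₀ hpI.ne_zero h3
    have hpf : (p : ℤ) ∣ f := by
      rcases hpI.dvd_or_dvd (Dvd.intro _ h2.symm) with h | h
      · exfalso
        obtain ⟨s, rfl⟩ := Int.natCast_dvd_natCast.1 h
        exact hp.not_isUnit (hm p ⟨s, by ring⟩)
      · exact h
    obtain ⟨k, rfl⟩ := hpf
    exact ⟨k, by rw [hf]; push_cast; ring⟩

/-- Nondegeneracy of the trace form modulo an unramified prime. The traces against `1` and `x` show
that `p` divides `s (x - conj x)`. Multiplying by `x - conj x` once more replaces that factor by an
integer prime to `p`, which Bézout removes. -/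
theorem exists_eq_mul_of_not_isRamified {m p : ℕ} (hp : p.Prime)
    (h : ¬ IsRamified m p) {s : ℂ} (hs : s ∈ intRing (imQuadField m))
    (htr : ∀ a ∈ intRing (imQuadField m), ∃ k : ℤ, a * s + star (a * s) = p * k) :
    ∃ t ∈ intRing (imQuadField m), s = p * t := by
  unfold IsRamified at h
  push Not at h
  obtain ⟨x, hx, hxk⟩ := h
  obtain ⟨f, hf⟩ := exists_int_sub_star_sq hx
  have hpf : ¬ (p : ℤ) ∣ f := by
    rintro ⟨k, rfl⟩
    exact hxk k (by rw [hf]; push_cast; ring)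
  obtain ⟨k, hk⟩ := htr 1 (one_mem _)
  obtain ⟨l, hl⟩ := htr x hx
  have h1 : s * (x - star x) = p * (l - star x * k) := by
    rw [star_mul'] at hl hk
    simp only [one_mul, star_one] at hk
    linear_combination hl - star x * hk
  have hco : IsCoprime (p : ℤ) f := (Nat.prime_iff_prime_int.1 hp).coprime_iff_not_dvd.2 hpf
  obtain ⟨u, v, huv⟩ := hco
  refine ⟨u * s + v * ((x - star x) * (l - star x * k)), ?_, ?_⟩
  · have hsx := star_mem_intRing hx
    exact add_mem (mul_mem (intCast_mem_intRing u) hs) (mul_mem (intCast_mem_intRing v)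
      (mul_mem (sub_mem hx hsx) (sub_mem (intCast_mem_intRing l)
        (mul_mem hsx (intCast_mem_intRing k)))))
  · have : (u * p + v * f : ℂ) = 1 := by exact_mod_cast huv
    rw [← hf] at this
    linear_combination (-s) * this + v * (x - star x) * h1

/-- In the residue field of a maximal ideal above `p`, the square of `x - conj x` vanishes, so
conjugation is trivial. Then `2x` is the trace and `x²` the norm of `x`. The first (odd `p`) or the
second (`p = 2`) shows that every class contains a rational integer. -/
theorem exists_residue_hom {m p : ℕ} (hp : p.Prime) (h : IsRamified m p) :
    ∃ (F : Type) (_ : Field F) (ρ : intRing (imQuadField m) →+* F),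
      (∀ x : intRing (imQuadField m), ∀ y : intRing (imQuadField m), (y : ℂ) = star (x : ℂ) →
        ρ y = ρ x) ∧
      (∀ x : F, ∃ k : ℤ, ρ k = x) ∧ ∀ k : ℤ, ρ k = 0 ↔ (p : ℤ) ∣ k := by
  set R := intRing (imQuadField m)
  have hne : Ideal.span {(p : R)} ≠ ⊤ := by
    rw [Ne, Ideal.span_singleton_eq_top, isUnit_iff_exists]
    rintro ⟨y, hy, -⟩
    have hy' : (p : ℂ) * (y : ℂ) = 1 := by exact_mod_cast congrArg (Subtype.val) hy
    have hp0 : (p : ℂ) ≠ 0 := by exact_mod_cast hp.ne_zero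
    obtain ⟨k, hk⟩ := exists_int_of_mem_intRing y.2 (by
      rw [eq_inv_of_mul_eq_one_right hy']; simp)
    rw [hk] at hy'
    have : (p : ℤ) * k = 1 := by exact_mod_cast hy'
    exact hp.not_isUnit (by exact_mod_cast (Int.ofNat_isUnit.1 (IsUnit.of_mul_eq_one _ this)))
  obtain ⟨P, hP, hle⟩ := Ideal.exists_le_maximal _ hne
  let _ : Field (R ⧸ P) := Ideal.Quotient.field P
  have hp0 : Ideal.Quotient.mk P (p : R) = 0 :=
    Ideal.Quotient.eq_zero_iff_mem.2 (hle (Ideal.mem_span_singleton_self _))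
  have hker : ∀ k : ℤ, Ideal.Quotient.mk P (k : R) = 0 ↔ (p : ℤ) ∣ k := by
    intro k
    constructor
    · intro hk
      by_contra hpk
      obtain ⟨u, v, huv⟩ := (Nat.prime_iff_prime_int.1 hp).coprime_iff_not_dvd.2 hpk
      have := congrArg (fun z : ℤ => Ideal.Quotient.mk P (z : R)) huv
      simp only [Int.cast_add, Int.cast_mul, map_add, map_mul, hk, Int.cast_natCast, hp0,
        mul_zero, add_zero, Int.cast_one, map_one] at this
      exact zero_ne_one this
    · rintro ⟨l, rfl⟩
      simp [-map_natCast, hp0]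
  have hconj : ∀ x y : R, (y : ℂ) = star (x : ℂ) →
      Ideal.Quotient.mk P y = Ideal.Quotient.mk P x := by
    intro x y hxy
    obtain ⟨k, hk⟩ := h x x.2
    have : (x - y) ^ 2 = (p : R) * (k : R) := by
      apply Subtype.ext
      push_cast
      rw [hxy]
      exact hk
    have h2 := congrArg (Ideal.Quotient.mk P) this
    rw [map_mul, hp0, zero_mul, map_pow] at h2
    have h3 := pow_eq_zero_iff (two_ne_zero) |>.1 h2
    rw [map_sub, sub_eq_zero] at h3
    exact h3.symm
  refine ⟨R ⧸ P, inferInstance, Ideal.Quotient.mk P, hconj, ?_, hker⟩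
  intro x
  obtain ⟨x, rfl⟩ := Ideal.Quotient.mk_surjective x
  set y : R := ⟨star (x : ℂ), star_mem_intRing x.2⟩ with hy
  have hyx := hconj x y rfl
  obtain ⟨t, ht⟩ := exists_int_of_mem_intRing (add_mem x.2 (star_mem_intRing x.2))
    (by rw [star_add, star_star]; ring)
  obtain ⟨N, hN⟩ := exists_int_of_mem_intRing (mul_mem x.2 (star_mem_intRing x.2))
    (by rw [star_mul', star_star]; ring)
  have ht' : x + y = (t : R) := Subtype.ext (by push_cast; exact ht)
  have hN' : x * y = (N : R) := Subtype.ext (by push_cast; exact hN)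
  have ht2 := congrArg (Ideal.Quotient.mk P) ht'
  have hN2 := congrArg (Ideal.Quotient.mk P) hN'
  rw [map_add, hyx] at ht2
  rw [map_mul, hyx] at hN2
  rcases hp.eq_two_or_odd' with rfl | hodd
  · refine ⟨N, ?_⟩
    -- In characteristic two, `x² = N` and `N² = N` give `(N - x)² = 0`.
    rw [← sub_eq_zero, ← pow_eq_zero_iff two_ne_zero, sub_sq]
    have e1 : Ideal.Quotient.mk P (N : R) ^ 2 - Ideal.Quotient.mk P (N : R) = 0 := by
      rw [← map_pow, ← map_sub]
      have := (hker (N ^ 2 - N)).2 (by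
        rcases Int.even_or_odd' N with ⟨a, rfl | rfl⟩
        · exact ⟨2 * a ^ 2 - a, by push_cast; ring⟩
        · exact ⟨2 * a ^ 2 + a, by push_cast; ring⟩)
      push_cast at this ⊢
      exact this
    have e2 : (2 : R ⧸ P) = 0 := by exact_mod_cast hp0
    linear_combination e1 + hN2 + (Ideal.Quotient.mk P (N : R) - Ideal.Quotient.mk P (N : R)
      * Ideal.Quotient.mk P x) * e2
  · obtain ⟨c, hc⟩ := hodd
    -- `c + 1` is the inverse of `2` modulo `p = 2c + 1`.
    refine ⟨t * (c + 1), ?_⟩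
    have e2 : (2 * c + 1 : R ⧸ P) = 0 := by
      rw [hc] at hp0
      exact_mod_cast hp0
    push_cast
    rw [map_mul, map_add, map_natCast, map_one, ← ht2]
    linear_combination (Ideal.Quotient.mk P x) * e2

/-- The embeddings of the field are the inclusion and its conjugate, distinct because `√-m ≠ 0`. So
the field norm of `x` is `x · conj x`. -/
theorem absNorm_span_singleton {m : ℕ} (hm : m ≠ 0) (x : 𝓞 (imQuadField m)) :
    (Ideal.absNorm (Ideal.span {x}) : ℝ) = ‖algebraMap (𝓞 (imQuadField m)) ℂ x‖ ^ 2 := by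
  classical
  have hs := gen_sq m
  have hδ0 : (Real.sqrt m : ℂ) * Complex.I ≠ 0 := by
    intro h
    rw [h] at hs
    norm_num at hs
    exact hm hs
  let v : imQuadField m →ₐ[ℚ] ℂ := (algebraMap (imQuadField m) ℂ).toRatAlgHom
  let c : imQuadField m →ₐ[ℚ] ℂ :=
    ((starRingEnd ℂ).comp (algebraMap (imQuadField m) ℂ)).toRatAlgHom
  have hne : v ≠ c := by
    intro h
    have h1 := DFunLike.congr_fun h ⟨_, gen_mem_imQuadField m⟩
    have h2 : (Real.sqrt m : ℂ) * Complex.I = star ((Real.sqrt m : ℂ) * Complex.I) := h1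
    rw [conj_gen] at h2
    exact hδ0 (self_eq_neg.1 h2)
  have huniv : (Finset.univ : Finset (imQuadField m →ₐ[ℚ] ℂ)) = {v, c} := by
    ext σ
    simp only [Finset.mem_univ, Finset.mem_insert, Finset.mem_singleton, true_iff]
    let g : imQuadField m := ⟨_, gen_mem_imQuadField m⟩
    have h1 : σ g ^ 2 = g.1 ^ 2 := by
      have : g ^ 2 = algebraMap ℚ (imQuadField m) (-m) := by
        apply Subtype.ext
        push_cast
        rw [hs]
      rw [← map_pow, this, AlgHom.commutes, hs]; simp
    have hext : ∀ τ : imQuadField m →ₐ[ℚ] ℂ, σ g = τ g → σ = τ := by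
      intro τ hτ
      ext z
      obtain ⟨a, b, hz⟩ := exists_rat_of_mem_imQuadField z.2
      have : z = algebraMap ℚ (imQuadField m) a + algebraMap ℚ (imQuadField m) b * g := by
        apply Subtype.ext
        push_cast
        rw [hz]; simp [g]
      rw [this]
      simp only [map_add, map_mul, AlgHom.commutes, hτ]
    rcases sq_eq_sq_iff_eq_or_eq_neg.1 h1 with h | h
    · exact Or.inl (hext _ h)
    · refine Or.inr (hext _ (h.trans ?_))
      exact (conj_gen m).symm
  rw [Ideal.absNorm_span_singleton, Nat.cast_natAbs, Int.cast_abs]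
  have h1 : ((Algebra.norm ℤ x : ℤ) : ℂ) = (‖algebraMap (𝓞 (imQuadField m)) ℂ x‖ ^ 2 : ℝ) := by
    have h2 := Algebra.norm_eq_prod_embeddings ℚ ℂ (x : imQuadField m)
    rw [huniv, Finset.prod_pair hne, ← Algebra.coe_norm_int] at h2
    have h3 : ((Algebra.norm ℤ x : ℤ) : ℂ) = v x * c x := by
      rw [← h2]; simp
    rw [h3]
    have h4 : v x * c x = algebraMap (𝓞 (imQuadField m)) ℂ x * star (algebraMap (𝓞 (imQuadField m)) ℂ x) := rfl
    rw [h4, Complex.star_def, Complex.mul_conj, Complex.normSq_eq_norm_sq]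
  have h5 : ((Algebra.norm ℤ x : ℤ) : ℝ) = ‖algebraMap (𝓞 (imQuadField m)) ℂ x‖ ^ 2 := by exact_mod_cast h1
  rw [h5, abs_of_nonneg (by positivity)]

/-! ## The half space and the special unitary group -/

section HalfSpace

variable {n : ℕ}

theorem mem_halfSpace_iff {Z : Matrix (Fin n) (Fin n) ℂ} :
    Z ∈ halfSpace n ↔ ((1 / (2 * Complex.I)) • (Z - Zᴴ)).PosDef := Iff.rfl

theorem smul_I_mem_halfSpace {Y : Matrix (Fin n) (Fin n) ℂ} (hY : Y.PosDef) :
    Complex.I • Y ∈ halfSpace n := by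
  rw [mem_halfSpace_iff]
  convert hY using 1
  rw [Matrix.conjTranspose_smul, hY.1.eq, ← sub_smul, smul_smul]
  convert one_smul ℂ Y using 2
  rw [Complex.star_def, Complex.conj_I]
  field_simp
  norm_num

theorem add_mem_halfSpace {Z S : Matrix (Fin n) (Fin n) ℂ} (hZ : Z ∈ halfSpace n)
    (hS : S.IsHermitian) : Z + S ∈ halfSpace n := by
  rw [mem_halfSpace_iff] at hZ ⊢
  convert hZ using 2
  rw [Matrix.conjTranspose_add, hS.eq]
  abel

theorem conj_mem_halfSpace {Z U : Matrix (Fin n) (Fin n) ℂ} (hZ : Z ∈ halfSpace n)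
    (hU : IsUnit U.det) : U * Z * Uᴴ ∈ halfSpace n := by
  rw [mem_halfSpace_iff] at hZ ⊢
  have hinj : Function.Injective U.vecMul := by
    apply Matrix.vecMul_injective_of_isUnit
    exact (Matrix.isUnit_iff_isUnit_det _).2 hU
  convert hZ.mul_mul_conjTranspose_same hinj using 1
  simp only [Matrix.conjTranspose_mul, Matrix.conjTranspose_conjTranspose, Matrix.mul_smul,
    Matrix.smul_mul, Matrix.mul_sub, Matrix.sub_mul, Matrix.mul_assoc]

/-- A kernel vector `v` of `Z` would give `vᴴ (Z - Zᴴ) v = 0`, against positivity. -/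
theorem isUnit_det_of_mem_halfSpace {Z : Matrix (Fin n) (Fin n) ℂ} (hZ : Z ∈ halfSpace n) :
    IsUnit Z.det := by
  rw [isUnit_iff_ne_zero]
  intro h0
  obtain ⟨v, hv, hZv⟩ := Matrix.exists_mulVec_eq_zero_iff.2 h0
  have hpos := (mem_halfSpace_iff.1 hZ).dotProduct_mulVec_pos hv
  have h2 : star v ᵥ* Zᴴ = 0 := by
    rw [← Matrix.star_mulVec, hZv, star_zero]
  rw [Matrix.smul_mulVec, dotProduct_smul, Matrix.sub_mulVec, hZv, zero_sub, dotProduct_neg,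
    Matrix.dotProduct_mulVec, h2, zero_dotProduct, neg_zero, smul_zero] at hpos
  exact lt_irrefl _ hpos

/-- Congruence by `Z⁻¹` carries `Z` to the inverse of `Zᴴ`, which has the same imaginary part as
`-Z⁻¹`. -/
theorem neg_inv_mem_halfSpace {Z : Matrix (Fin n) (Fin n) ℂ} (hZ : Z ∈ halfSpace n) :
    -Z⁻¹ ∈ halfSpace n := by
  have hu := isUnit_det_of_mem_halfSpace hZ
  have hu' : IsUnit (Z⁻¹).det := by
    rw [Matrix.det_nonsing_inv]; exact hu.ringInverse
  have h := conj_mem_halfSpace hZ hu'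
  rw [mem_halfSpace_iff] at hZ h ⊢
  convert h using 2
  have huH : IsUnit Zᴴ.det := by
    rw [Matrix.det_conjTranspose]; exact hu.star
  rw [Matrix.conjTranspose_mul, Matrix.conjTranspose_mul, Matrix.conjTranspose_conjTranspose,
    Matrix.conjTranspose_neg, Matrix.conjTranspose_nonsing_inv, Matrix.nonsing_inv_mul _ hu,
    Matrix.one_mul, ← Matrix.mul_assoc, Matrix.mul_assoc (Z⁻¹), Matrix.mul_nonsing_inv _ huH,
    Matrix.mul_one]
  abel

end HalfSpace

/-! ### Block relations in `SU(n,n)` and the action on the half space -/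

section Unitary

variable {n : ℕ} {A B C D : Matrix (Fin n) (Fin n) ℂ}

theorem mem_SU_fromBlocks (h : Matrix.fromBlocks A B C D ∈ SU n) :
    Aᴴ * D - Cᴴ * B = 1 ∧ Dᴴ * B = Bᴴ * D ∧ Cᴴ * A = Aᴴ * C := by
  have h2 := h.2
  rw [Matrix.J, Matrix.fromBlocks_conjTranspose, Matrix.fromBlocks_multiply,
    Matrix.fromBlocks_multiply, Matrix.fromBlocks_inj] at h2
  simp only [Matrix.mul_zero, Matrix.mul_one, Matrix.mul_neg, zero_add, add_zero,
    Matrix.neg_mul] at h2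
  obtain ⟨h1, h3, h4, h5⟩ := h2
  refine ⟨?_, ?_, ?_⟩
  · rw [← neg_inj, ← h3]; abel
  · rw [← sub_eq_zero, ← h5]; abel
  · rw [← sub_eq_zero, ← h1]; abel

/-- The column relations exhibit a left inverse of `M`. It is also a right inverse, and the product
in that order contains the relations between the rows. -/
theorem mem_SU_fromBlocks' (h : Matrix.fromBlocks A B C D ∈ SU n) :
    D * Aᴴ - C * Bᴴ = 1 ∧ C * Dᴴ = D * Cᴴ := by
  obtain ⟨h1, h2, h3⟩ := mem_SU_fromBlocks h
  have h1' : Dᴴ * A - Bᴴ * C = 1 := by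
    have := congrArg Matrix.conjTranspose h1
    simpa [Matrix.conjTranspose_sub, Matrix.conjTranspose_mul] using this
  have hl : Matrix.fromBlocks Dᴴ (-Bᴴ) (-Cᴴ) Aᴴ * Matrix.fromBlocks A B C D = 1 := by
    rw [Matrix.fromBlocks_multiply, ← Matrix.fromBlocks_one, Matrix.fromBlocks_inj]
    simp only [Matrix.neg_mul]
    refine ⟨?_, ?_, ?_, ?_⟩
    · rw [← h1']; abel
    · rw [h2]; abel
    · rw [h3]; abel
    · rw [← h1]; abel
  have hr := mul_eq_one_comm.1 hl
  rw [Matrix.fromBlocks_multiply, ← Matrix.fromBlocks_one, Matrix.fromBlocks_inj] at hr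
  simp only [Matrix.mul_neg] at hr
  refine ⟨?_, ?_⟩
  · rw [← hr.2.2.2]; abel
  · rw [← sub_eq_zero, ← hr.2.2.1]; abel

theorem isHermitian_mul_inv (h : Matrix.fromBlocks A B C D ∈ SU n) (hD : IsUnit D.det) :
    (B * D⁻¹).IsHermitian := by
  have h2 := (mem_SU_fromBlocks h).2.1
  have hDH : IsUnit Dᴴ.det := by rw [Matrix.det_conjTranspose]; exact hD.star
  rw [Matrix.IsHermitian, Matrix.conjTranspose_mul, Matrix.conjTranspose_nonsing_inv]
  calc Dᴴ⁻¹ * Bᴴ = Dᴴ⁻¹ * (Bᴴ * D) * D⁻¹ := by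
        rw [← Matrix.mul_assoc, Matrix.mul_nonsing_inv_cancel_right _ _ hD]
    _ = B * D⁻¹ := by rw [← h2, Matrix.nonsing_inv_mul_cancel_left _ _ hDH]

theorem isHermitian_inv_mul (h : Matrix.fromBlocks A B C D ∈ SU n) (hD : IsUnit D.det) :
    (D⁻¹ * C).IsHermitian := by
  have h2 := (mem_SU_fromBlocks' h).2
  have hDH : IsUnit Dᴴ.det := by rw [Matrix.det_conjTranspose]; exact hD.star
  rw [Matrix.IsHermitian, Matrix.conjTranspose_mul, Matrix.conjTranspose_nonsing_inv]
  calc Cᴴ * Dᴴ⁻¹ = D⁻¹ * (D * Cᴴ) * Dᴴ⁻¹ := by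
        rw [Matrix.nonsing_inv_mul_cancel_left _ _ hD]
    _ = D⁻¹ * C := by
        rw [← h2, ← Matrix.mul_assoc, Matrix.mul_nonsing_inv_cancel_right _ _ hDH]

/-- This is the missing entry of the factorisation `M = (1, BD⁻¹; 0, 1) (D⁻ᴴ, 0; 0, D) (1, 0; D⁻¹C,
1)`, which underlies `exists_moebius_eq`. -/
theorem upper_left_eq (h : Matrix.fromBlocks A B C D ∈ SU n) (hD : IsUnit D.det) :
    A = Dᴴ⁻¹ + B * D⁻¹ * C := by
  have h1 := (mem_SU_fromBlocks h).1
  have h3 : Aᴴ = D⁻¹ + Cᴴ * (B * D⁻¹) := by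
    rw [sub_eq_iff_eq_add] at h1
    calc Aᴴ = Aᴴ * D * D⁻¹ := by rw [Matrix.mul_nonsing_inv_cancel_right _ _ hD]
      _ = D⁻¹ + Cᴴ * (B * D⁻¹) := by
        rw [h1, Matrix.add_mul, Matrix.one_mul, Matrix.mul_assoc]
  have h4 := congrArg Matrix.conjTranspose h3
  rwa [Matrix.conjTranspose_conjTranspose, Matrix.conjTranspose_add, Matrix.conjTranspose_mul,
    (isHermitian_mul_inv h hD).eq, Matrix.conjTranspose_conjTranspose,
    Matrix.conjTranspose_nonsing_inv] at h4

/-- The Schur complement of `D` is the inverse of `Dᴴ`, so `det M = 1` says that `det D` equals its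
conjugate. -/
theorem star_det_eq (h : Matrix.fromBlocks A B C D ∈ SU n) : star D.det = D.det := by
  by_cases hD : D.det = 0
  · simp [hD]
  have hD' : IsUnit D.det := isUnit_iff_ne_zero.2 hD
  have h1 := h.1
  have := Matrix.invertibleOfIsUnitDet D hD'
  rw [Matrix.det_fromBlocks₂₂, Matrix.invOf_eq_nonsing_inv] at h1
  have h2 : A - B * D⁻¹ * C = Dᴴ⁻¹ := by
    nth_rewrite 1 [upper_left_eq h hD']
    abel
  rw [h2, Matrix.det_nonsing_inv, Ring.inverse_eq_inv', Matrix.det_conjTranspose] at h1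
  have h3 : star D.det ≠ 0 := by simpa using hD
  field_simp at h1
  exact h1.symm

/-- The matrix `(Z⁻¹ + D⁻¹ C)⁻¹`, in terms of which the action of `(A, B; C, D)` on `Z` is
`W ↦ D⁻ᴴ W D⁻¹ + B D⁻¹`. -/
theorem exists_moebius_eq (h : Matrix.fromBlocks A B C D ∈ SU n) (hD : IsUnit D.det)
    {Z : Matrix (Fin n) (Fin n) ℂ} (hZ : Z ∈ halfSpace n) :
    ∃ W ∈ halfSpace n, -W⁻¹ = -Z⁻¹ - D⁻¹ * C ∧
      denom (Matrix.fromBlocks A B C D) Z = D * W⁻¹ * Z ∧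
      moebius (Matrix.fromBlocks A B C D) Z = Dᴴ⁻¹ * W * D⁻¹ + B * D⁻¹ := by
  have hV : -Z⁻¹ - D⁻¹ * C ∈ halfSpace n := by
    rw [sub_eq_add_neg]
    exact add_mem_halfSpace (neg_inv_mem_halfSpace hZ) (isHermitian_inv_mul h hD).neg
  set V := -Z⁻¹ - D⁻¹ * C with hVdef
  have hZu := isUnit_det_of_mem_halfSpace hZ
  have hVu := isUnit_det_of_mem_halfSpace hV
  have hW : -V⁻¹ ∈ halfSpace n := neg_inv_mem_halfSpace hV
  have hWi : (-V⁻¹)⁻¹ = -V := by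
    apply Matrix.inv_eq_right_inv
    rw [Matrix.neg_mul, Matrix.mul_neg, neg_neg, Matrix.nonsing_inv_mul _ hVu]
  have hden : denom (Matrix.fromBlocks A B C D) Z = D * (-V) * Z := by
    simp only [denom, Matrix.toBlocks_fromBlocks₂₁, Matrix.toBlocks_fromBlocks₂₂, hVdef]
    rw [neg_sub, sub_neg_eq_add, Matrix.mul_add, Matrix.mul_nonsing_inv_cancel_left _ _ hD,
      Matrix.add_mul, Matrix.nonsing_inv_mul_cancel_right _ _ hZu]
  refine ⟨-V⁻¹, hW, by rw [hWi, neg_neg], by rw [hWi, hden], ?_⟩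
  have hnum : A * Z + B = Dᴴ⁻¹ * Z + B * D⁻¹ * (C * Z + D) := by
    nth_rewrite 1 [upper_left_eq h hD]
    rw [Matrix.add_mul, Matrix.mul_add, Matrix.nonsing_inv_mul_cancel_right _ _ hD,
      Matrix.mul_assoc (B * D⁻¹)]
    abel
  have hVn : (-V)⁻¹ = -V⁻¹ := by
    apply Matrix.inv_eq_right_inv
    rw [Matrix.neg_mul, Matrix.mul_neg, neg_neg, Matrix.mul_nonsing_inv _ hVu]
  have hdu : IsUnit (denom (Matrix.fromBlocks A B C D) Z).det := by
    rw [hden, Matrix.det_mul, Matrix.det_mul, Matrix.det_neg]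
    exact (hD.mul (((isUnit_neg_one).pow _).mul hVu)).mul hZu
  have hden' : C * Z + D = denom (Matrix.fromBlocks A B C D) Z := rfl
  have e : moebius (Matrix.fromBlocks A B C D) Z =
      (A * Z + B) * (denom (Matrix.fromBlocks A B C D) Z)⁻¹ := rfl
  rw [e, hnum, hden', Matrix.add_mul, Matrix.mul_nonsing_inv_cancel_right _ _ hdu, hden,
    Matrix.mul_inv_rev, Matrix.mul_inv_rev, Matrix.mul_assoc Dᴴ⁻¹ Z,
    Matrix.mul_nonsing_inv_cancel_left _ _ hZu, hVn, Matrix.mul_assoc Dᴴ⁻¹]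

/-- The translation matrix `(1, S; 0, 1)`. -/
theorem fromBlocks_mul_translation (S : Matrix (Fin n) (Fin n) ℂ) :
    Matrix.fromBlocks A B C D * Matrix.fromBlocks 1 S 0 1 =
      Matrix.fromBlocks A (A * S + B) C (C * S + D) := by
  simp [Matrix.fromBlocks_multiply]

theorem mul_translation_mem_SU (h : Matrix.fromBlocks A B C D ∈ SU n)
    {S : Matrix (Fin n) (Fin n) ℂ} (hS : S.IsHermitian) :
    Matrix.fromBlocks A (A * S + B) C (C * S + D) ∈ SU n := by
  rw [← fromBlocks_mul_translation]
  have hT : (Matrix.fromBlocks 1 S 0 1)ᴴ * Matrix.J (Fin n) ℂ * Matrix.fromBlocks 1 S 0 1 =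
      Matrix.J (Fin n) ℂ := by
    simp [Matrix.J, Matrix.fromBlocks_conjTranspose, Matrix.fromBlocks_multiply, hS.eq]
  refine ⟨?_, ?_⟩
  · rw [Matrix.det_mul, h.1, Matrix.det_fromBlocks_zero₂₁]
    simp
  · rw [Matrix.conjTranspose_mul, Matrix.mul_assoc, Matrix.mul_assoc,
      ← Matrix.mul_assoc (Matrix.J (Fin n) ℂ), ← Matrix.mul_assoc (Matrix.fromBlocks A B C D)ᴴ,
      ← Matrix.mul_assoc (Matrix.fromBlocks A B C D)ᴴ, h.2, ← Matrix.mul_assoc, hT]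

theorem denom_translation (Z S : Matrix (Fin n) (Fin n) ℂ) :
    denom (Matrix.fromBlocks A (A * S + B) C (C * S + D)) (Z - S) =
      denom (Matrix.fromBlocks A B C D) Z := by
  simp only [denom, Matrix.toBlocks_fromBlocks₂₁, Matrix.toBlocks_fromBlocks₂₂, Matrix.mul_sub]
  abel

theorem moebius_translation (Z S : Matrix (Fin n) (Fin n) ℂ) :
    moebius (Matrix.fromBlocks A (A * S + B) C (C * S + D)) (Z - S) =
      moebius (Matrix.fromBlocks A B C D) Z := by
  rw [moebius, denom_translation, moebius]
  simp only [Matrix.toBlocks_fromBlocks₁₁, Matrix.toBlocks_fromBlocks₁₂, Matrix.mul_sub]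
  congr 1
  abel

theorem denom_blockMatrix_mul (U : Matrix (Fin n) (Fin n) ℂ)
    (M : Matrix (Fin n ⊕ Fin n) (Fin n ⊕ Fin n) ℂ) (Z : Matrix (Fin n) (Fin n) ℂ) :
    denom (blockMatrix U * M) Z = Uᴴ⁻¹ * denom M Z := by
  rw [← Matrix.fromBlocks_toBlocks M]
  simp [denom, blockMatrix, Matrix.fromBlocks_multiply, Matrix.mul_add, Matrix.mul_assoc]

theorem moebius_blockMatrix_mul {U : Matrix (Fin n) (Fin n) ℂ} (hU : IsUnit U.det)
    (M : Matrix (Fin n ⊕ Fin n) (Fin n ⊕ Fin n) ℂ) (Z : Matrix (Fin n) (Fin n) ℂ) :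
    moebius (blockMatrix U * M) Z = U * moebius M Z * Uᴴ := by
  have hUH : IsUnit Uᴴ.det := by rw [Matrix.det_conjTranspose]; exact hU.star
  rw [moebius, denom_blockMatrix_mul, moebius, Matrix.mul_inv_rev,
    Matrix.nonsing_inv_nonsing_inv _ hUH, ← Matrix.mul_assoc, ← Matrix.mul_assoc]
  congr 2
  rw [← Matrix.fromBlocks_toBlocks M]
  simp [blockMatrix, Matrix.fromBlocks_multiply, Matrix.mul_add, Matrix.mul_assoc]

end Unitary

/-! ## Symmetric pairs over a field -/

/-- The substitution `C ↦ U C V`, `D ↦ U D V⁻ᵀ` respects the symmetry relation and brings `C` to a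
diagonal idempotent `P`. There `S' = P - P D' P` turns `C S + D` into `P + D' (1 - P)`. A row vector
killing this matrix kills `P`, then `D' P = P D'ᵀ`, hence `D'`. So it kills both `C` and `D`,
against `D A - C B = 1`. The argument works in every characteristic, including two. -/
theorem exists_isSymm_det_add_ne_zero {F : Type*} [Field F] {n : ℕ}
    {C D A B : Matrix (Fin n) (Fin n) F} (h1 : D * A - C * B = 1) (h2 : C * Dᵀ = D * Cᵀ) :
    ∃ S : Matrix (Fin n) (Fin n) F, S.IsSymm ∧ (C * S + D).det ≠ 0 := by
  classical
  obtain ⟨l, l', d, hd⟩ := Matrix.Pivot.exists_list_transvec_mul_mul_list_transvec_eq_diagonal C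
  have hunit : ∀ l : List (Matrix.TransvectionStruct (Fin n) F),
      IsUnit (l.map Matrix.TransvectionStruct.toMatrix).prod := by
    intro l
    rw [Matrix.isUnit_iff_isUnit_det, Matrix.TransvectionStruct.det_toMatrix_prod]
    exact isUnit_one
  obtain ⟨u, hu⟩ := hunit l
  obtain ⟨v, hv⟩ := hunit l'
  rw [← hu, ← hv] at hd
  set P : Matrix (Fin n) (Fin n) F := Matrix.diagonal fun i => if d i = 0 then 0 else 1 with hP
  set E : Matrix (Fin n) (Fin n) F := Matrix.diagonal fun i => if d i = 0 then 1 else d i with hE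
  set E' : Matrix (Fin n) (Fin n) F :=
    Matrix.diagonal fun i => if d i = 0 then 1 else (d i)⁻¹ with hE'
  have hEE : E * E' = 1 := by
    rw [hE, hE', Matrix.diagonal_mul_diagonal, ← Matrix.diagonal_one]
    congr 1; ext i; split_ifs <;> simp_all
  have hEP : E' * Matrix.diagonal d = P := by
    rw [hP, hE', Matrix.diagonal_mul_diagonal]
    congr 1; ext i; split_ifs <;> simp_all
  have hPP : P * P = P := by
    rw [hP, Matrix.diagonal_mul_diagonal]
    congr 1; ext i; split_ifs <;> simp
  have hPT : Pᵀ = P := Matrix.diagonal_transpose _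
  obtain ⟨U, hU⟩ : ∃ U, U = E' * (u : Matrix (Fin n) (Fin n) F) := ⟨_, rfl⟩
  set V := (v : Matrix (Fin n) (Fin n) F)
  have hUV : U * C * V = P := by
    rw [← hEP, ← hd, hU]; simp only [V, Matrix.mul_assoc]
  set Vi := ((v⁻¹ : (Matrix (Fin n) (Fin n) F)ˣ) : Matrix (Fin n) (Fin n) F)
  have hVV : V * Vi = 1 := v.mul_inv
  have hVV' : Vi * V = 1 := v.inv_mul
  have hVT : Viᵀ * Vᵀ = 1 := by rw [← Matrix.transpose_mul, hVV, Matrix.transpose_one]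
  have hVT' : Vᵀ * Viᵀ = 1 := by rw [← Matrix.transpose_mul, hVV', Matrix.transpose_one]
  have hUC : U * C = P * Vi := by
    rw [← hUV, Matrix.mul_assoc, hVV, Matrix.mul_one]
  obtain ⟨D', hD'⟩ : ∃ D', D' = U * D * Viᵀ := ⟨_, rfl⟩
  have hUu : IsUnit U.det := by
    rw [hU, Matrix.det_mul]
    refine IsUnit.mul ?_ ((Matrix.isUnit_iff_isUnit_det _).1 u.isUnit)
    exact (Matrix.isUnit_det_of_left_inverse hEE)
  have hsym : P * D'ᵀ = D' * P := by
    have e1 : P * D'ᵀ = U * (C * Dᵀ) * Uᵀ := by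
      rw [hD', Matrix.transpose_mul, Matrix.transpose_mul, Matrix.transpose_transpose, ← hUV]
      calc U * C * V * (Vi * (Dᵀ * Uᵀ)) = U * C * (V * Vi) * (Dᵀ * Uᵀ) := by
            simp only [Matrix.mul_assoc]
        _ = _ := by rw [hVV, Matrix.mul_one]; simp only [Matrix.mul_assoc]
    have e2 : D' * P = U * (D * Cᵀ) * Uᵀ := by
      have : P = Vᵀ * Cᵀ * Uᵀ := by
        rw [← hPT, ← hUV, Matrix.transpose_mul, Matrix.transpose_mul, Matrix.mul_assoc]
      rw [hD', this]
      calc U * D * Viᵀ * (Vᵀ * Cᵀ * Uᵀ) = U * D * (Viᵀ * Vᵀ) * (Cᵀ * Uᵀ) := by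
            simp only [Matrix.mul_assoc]
        _ = _ := by rw [hVT, Matrix.mul_one]; simp only [Matrix.mul_assoc]
    rw [e1, e2, h2]
  set S' := P - P * D' * P with hS'
  have hPDP : P * D' * P = D' * P := by
    rw [Matrix.mul_assoc, ← hsym, ← Matrix.mul_assoc, hPP]
  have hS'T : S'ᵀ = S' := by
    rw [hS', Matrix.transpose_sub, Matrix.transpose_mul, Matrix.transpose_mul, hPT,
      ← Matrix.mul_assoc, hsym, Matrix.mul_assoc, hPP, hPDP]
  refine ⟨V * S' * Vᵀ, ?_, ?_⟩
  · rw [Matrix.IsSymm, Matrix.transpose_mul, Matrix.transpose_mul, Matrix.transpose_transpose,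
      hS'T, Matrix.mul_assoc]
  · intro h0
    obtain ⟨x, hx, hx0⟩ := Matrix.exists_vecMul_eq_zero_iff.2 h0
    apply hx
    obtain ⟨y, rfl⟩ : ∃ y, y ᵥ* U = x :=
      ⟨x ᵥ* U⁻¹, by rw [Matrix.vecMul_vecMul, Matrix.nonsing_inv_mul _ hUu, Matrix.vecMul_one]⟩
    have hkey : U * (C * (V * S' * Vᵀ) + D) = (P + D' * (1 - P)) * Vᵀ := by
      have e1 : U * D = D' * Vᵀ := by
        rw [hD', Matrix.mul_assoc, hVT, Matrix.mul_one]
      have e2 : U * (C * (V * S' * Vᵀ)) = P * S' * Vᵀ := by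
        rw [← hUV]; simp only [Matrix.mul_assoc]
      rw [Matrix.mul_add, e1, e2, ← Matrix.add_mul, hS', Matrix.mul_sub, hPP, ← Matrix.mul_assoc,
        ← Matrix.mul_assoc, hPP, hPDP, Matrix.mul_sub, Matrix.mul_one]
      congr 1
      abel
    rw [Matrix.vecMul_vecMul, hkey, ← Matrix.vecMul_vecMul] at hx0
    have hz : y ᵥ* (P + D' * (1 - P)) = 0 := by
      have := congrArg (fun z => z ᵥ* Viᵀ) hx0
      simpa only [Matrix.vecMul_vecMul, hVT', Matrix.mul_one, Matrix.zero_vecMul, Matrix.mul_assoc] using this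
    have hyP : y ᵥ* P = 0 := by
      have := congrArg (fun z => z ᵥ* P) hz
      simp only [Matrix.vecMul_vecMul, Matrix.zero_vecMul, Matrix.add_mul, hPP, Matrix.mul_assoc,
        Matrix.sub_mul, Matrix.one_mul, sub_self, Matrix.mul_zero, add_zero] at this
      exact this
    have hyD : y ᵥ* D' = 0 := by
      have e3 : y ᵥ* (D' * P) = 0 := by
        rw [← hsym, ← Matrix.vecMul_vecMul, hyP, Matrix.zero_vecMul]
      rw [Matrix.vecMul_add, hyP, zero_add, Matrix.mul_sub, Matrix.mul_one, Matrix.vecMul_sub, e3,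
        sub_zero] at hz
      exact hz
    have hyC : (y ᵥ* U) ᵥ* C = 0 := by
      rw [Matrix.vecMul_vecMul, hUC, ← Matrix.vecMul_vecMul, hyP, Matrix.zero_vecMul]
    have hyD2 : (y ᵥ* U) ᵥ* D = 0 := by
      have := congrArg (fun z => z ᵥ* Vᵀ) hyD
      simp only [hD', Matrix.vecMul_vecMul, Matrix.mul_assoc, hVT, Matrix.mul_one,
        Matrix.zero_vecMul] at this
      rw [Matrix.vecMul_vecMul]; exact this
    rw [← Matrix.vecMul_one (y ᵥ* U), ← h1, Matrix.vecMul_sub, ← Matrix.vecMul_vecMul _ D A,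
      ← Matrix.vecMul_vecMul _ C B, hyC, hyD2, Matrix.zero_vecMul, Matrix.zero_vecMul, sub_zero]

/-! ## Quadratic forms on matrices -/

section Forms

variable {r n : ℕ}

/-- The quadratic form `tr(wᴴ w Z)`. -/
def quad (Z : Matrix (Fin n) (Fin n) ℂ) (w : Matrix (Fin r) (Fin n) ℂ) : ℂ := (wᴴ * w * Z).trace

/-- The real inner product `Re tr(xᴴ y)`. -/
def pairing (x y : Matrix (Fin r) (Fin n) ℂ) : ℝ := (xᴴ * y).trace.re

theorem quad_add_left (Z Z' : Matrix (Fin n) (Fin n) ℂ) (w : Matrix (Fin r) (Fin n) ℂ) :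
    quad (Z + Z') w = quad Z w + quad Z' w := by
  simp [quad, Matrix.mul_add, Matrix.trace_add]

theorem quad_smul_left (c : ℂ) (Z : Matrix (Fin n) (Fin n) ℂ) (w : Matrix (Fin r) (Fin n) ℂ) :
    quad (c • Z) w = c * quad Z w := by
  simp [quad, Matrix.trace_smul]

theorem quad_neg_left (Z : Matrix (Fin n) (Fin n) ℂ) (w : Matrix (Fin r) (Fin n) ℂ) :
    quad (-Z) w = -quad Z w := by
  simp [quad, Matrix.trace_neg]

theorem quad_mul {k : ℕ} (Z : Matrix (Fin n) (Fin n) ℂ) (U : Matrix (Fin k) (Fin n) ℂ)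
    (w : Matrix (Fin r) (Fin k) ℂ) :
    quad Z (w * U) = quad (U * Z * Uᴴ) w := by
  rw [quad, quad, Matrix.conjTranspose_mul, Matrix.mul_assoc, Matrix.mul_assoc, Matrix.trace_mul_comm]
  simp only [Matrix.mul_assoc]

theorem quad_neg (Z : Matrix (Fin n) (Fin n) ℂ) (w : Matrix (Fin r) (Fin n) ℂ) :
    quad Z (-w) = quad Z w := by
  simp [quad]

theorem star_quad {S : Matrix (Fin n) (Fin n) ℂ} (hS : S.IsHermitian)
    (w : Matrix (Fin r) (Fin n) ℂ) : star (quad S w) = quad S w := by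
  rw [quad, ← Matrix.trace_conjTranspose, Matrix.conjTranspose_mul, Matrix.conjTranspose_mul,
    Matrix.conjTranspose_conjTranspose, hS.eq, Matrix.trace_mul_comm]

theorem quad_eq_ofReal {S : Matrix (Fin n) (Fin n) ℂ} (hS : S.IsHermitian)
    (w : Matrix (Fin r) (Fin n) ℂ) : quad S w = ((quad S w).re : ℂ) :=
  (Complex.conj_eq_iff_re.1 (star_quad hS w)).symm

theorem pairing_comm (x y : Matrix (Fin r) (Fin n) ℂ) : pairing x y = pairing y x := by
  have : (yᴴ * x).trace = star (xᴴ * y).trace := by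
    rw [← Matrix.trace_conjTranspose, Matrix.conjTranspose_mul, Matrix.conjTranspose_conjTranspose]
  rw [pairing, pairing, this]
  simp

theorem pairing_add_left (x x' y : Matrix (Fin r) (Fin n) ℂ) :
    pairing (x + x') y = pairing x y + pairing x' y := by
  simp [pairing, Matrix.add_mul, Matrix.trace_add]

theorem pairing_add_right (x y y' : Matrix (Fin r) (Fin n) ℂ) :
    pairing x (y + y') = pairing x y + pairing x y' := by
  simp [pairing, Matrix.mul_add, Matrix.trace_add]

theorem pairing_smul_right (x y : Matrix (Fin r) (Fin n) ℂ) (c : ℝ) :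
    pairing x (c • y) = c * pairing x y := by
  simp [pairing, Matrix.trace_smul]

theorem pairing_smul_left (x y : Matrix (Fin r) (Fin n) ℂ) (c : ℝ) :
    pairing (c • x) y = c * pairing x y := by
  rw [pairing_comm, pairing_smul_right, pairing_comm]

theorem pairing_mul_right (x y : Matrix (Fin r) (Fin n) ℂ) (U : Matrix (Fin n) (Fin n) ℂ) :
    pairing x (y * U) = pairing (x * Uᴴ) y := by
  rw [pairing, pairing, Matrix.conjTranspose_mul, Matrix.conjTranspose_conjTranspose,
    Matrix.mul_assoc, ← Matrix.mul_assoc, Matrix.trace_mul_comm]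

theorem quad_add {S : Matrix (Fin n) (Fin n) ℂ} (hS : S.IsHermitian)
    (v w : Matrix (Fin r) (Fin n) ℂ) :
    quad S (v + w) = quad S v + quad S w + 2 * (pairing v (w * S) : ℂ) := by
  have h1 : (wᴴ * v * S).trace = star (vᴴ * (w * S)).trace := by
    rw [← Matrix.trace_conjTranspose, Matrix.conjTranspose_mul, Matrix.conjTranspose_mul,
      Matrix.conjTranspose_conjTranspose, hS.eq, Matrix.mul_assoc, Matrix.mul_assoc,
      Matrix.trace_mul_comm, Matrix.mul_assoc, Matrix.trace_mul_comm v, Matrix.mul_assoc]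
  have h2 : quad S (v + w) = quad S v + quad S w + ((vᴴ * (w * S)).trace + (wᴴ * v * S).trace) := by
    simp only [quad, Matrix.conjTranspose_add, Matrix.add_mul, Matrix.mul_add, Matrix.trace_add,
      Matrix.mul_assoc]
    ring
  rw [h2, h1, Complex.star_def, Complex.add_conj, pairing]
  push_cast
  ring

/-- Right multiplication by a square matrix. -/
def mulRight (U : Matrix (Fin n) (Fin n) ℂ) :
    Matrix (Fin r) (Fin n) ℂ →ₗ[ℝ] Matrix (Fin r) (Fin n) ℂ where
  toFun w := w * U
  map_add' x y := Matrix.add_mul x y U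
  map_smul' c x := Matrix.smul_mul c x U

@[simp] theorem mulRight_apply (U : Matrix (Fin n) (Fin n) ℂ) (w : Matrix (Fin r) (Fin n) ℂ) :
    mulRight U w = w * U := rfl

/-- The map acts separately on each of the `r` rows, so its complex determinant is `(det U)^r`. The
real determinant is the squared absolute value of that. -/
theorem det_mulRight (U : Matrix (Fin n) (Fin n) ℂ) :
    LinearMap.det (mulRight (r := r) U) = ‖U.det‖ ^ (2 * r) := by
  let f : (Fin r → Fin n → ℂ) →ₗ[ℂ] (Fin r → Fin n → ℂ) :=
    LinearMap.pi fun i => (Matrix.toLin' Uᵀ).comp (LinearMap.proj i)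
  have h1 : mulRight (r := r) U = f.restrictScalars ℝ := by
    ext w i j
    change (w * U) i j = (Matrix.toLin' Uᵀ (w i)) j
    simp [Matrix.mul_apply, Matrix.mulVec, dotProduct, mul_comm]
  have h2 : LinearMap.det f = U.det ^ r := by
    simp only [f]
    rw [LinearMap.det_pi]
    simp
  rw [h1]
  refine (LinearMap.det_restrictScalars (R := ℝ) (S := ℂ) (f := f)).trans ?_
  rw [h2, Algebra.norm_complex_apply, Complex.normSq_eq_norm_sq, norm_pow]
  ring

end Forms

/-! ## The lattice of tuples -/

section Lattice

variable {m r : ℕ} {Λ : Submodule (𝓞 (imQuadField m)) (Fin r → ℂ)}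

/-- The lattice of matrices whose columns lie in `Λ`. -/
def tupleLattice (Λ : Submodule (𝓞 (imQuadField m)) (Fin r → ℂ)) (n : ℕ) :
    AddSubgroup (Matrix (Fin r) (Fin n) ℂ) where
  carrier := {w | ∀ j, wᵀ j ∈ Λ}
  zero_mem' _ := Λ.zero_mem
  add_mem' hx hy j := Λ.add_mem (hx j) (hy j)
  neg_mem' hx j := Λ.neg_mem (hx j)

theorem mem_tupleLattice {n : ℕ} {w : Matrix (Fin r) (Fin n) ℂ} :
    w ∈ tupleLattice Λ n ↔ ∀ j, wᵀ j ∈ Λ := Iff.rfl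

theorem smul_mem_of_mem_intRing {a : ℂ} (ha : a ∈ intRing (imQuadField m)) {x : Fin r → ℂ}
    (hx : x ∈ Λ) : a • x ∈ Λ := by
  obtain ⟨a, rfl⟩ := ha
  have : (algebraMap (𝓞 (imQuadField m)) ℂ a) • x = a • x := by
    ext i
    simp [Algebra.smul_def]
  exact this ▸ Λ.smul_mem a hx

theorem mul_mem_tupleLattice {n k : ℕ} {w : Matrix (Fin r) (Fin n) ℂ} (hw : w ∈ tupleLattice Λ n)
    {U : Matrix (Fin n) (Fin k) ℂ} (hU : ∀ i j, U i j ∈ intRing (imQuadField m)) :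
    w * U ∈ tupleLattice Λ k := by
  intro j
  have : (w * U)ᵀ j = ∑ i, U i j • wᵀ i := by
    ext l
    simp [Matrix.mul_apply, mul_comm]
  rw [this]
  exact Λ.sum_mem fun i _ => smul_mem_of_mem_intRing (hU i j) (hw i)

theorem pairing_eq_sum {n : ℕ} (x y : Matrix (Fin r) (Fin n) ℂ) :
    pairing x y = ∑ j, (herm (xᵀ j) (yᵀ j)).re := by
  simp [pairing, herm, Matrix.trace, Matrix.mul_apply, dotProduct, Matrix.diag]

theorem mem_tupleLattice_iff_pairing (hΛ : IsThetaLattice Λ) {n : ℕ}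
    {y : Matrix (Fin r) (Fin n) ℂ} :
    y ∈ tupleLattice Λ n ↔ ∀ x ∈ tupleLattice Λ n, ∃ k : ℤ, pairing x y = k := by
  constructor
  · intro hy x hx
    have : ∀ j, ∃ k : ℤ, (herm (xᵀ j) (yᵀ j)).re = k :=
      fun j => (hΛ.unimodular _).2 (hy j) _ (hx j)
    choose k hk using this
    exact ⟨∑ j, k j, by rw [pairing_eq_sum]; push_cast; exact Finset.sum_congr rfl fun j _ => hk j⟩
  · intro h j
    rw [← hΛ.unimodular]
    intro x hx
    -- Pairing with a tuple supported in column `j` isolates the condition on that column.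
    let X : Matrix (Fin r) (Fin n) ℂ := (Matrix.of fun i => if i = j then x else 0)ᵀ
    have hX : X ∈ tupleLattice Λ n := by
      intro i
      change (if i = j then x else 0) ∈ Λ
      split_ifs
      exacts [hx, Λ.zero_mem]
    obtain ⟨k, hk⟩ := h X hX
    refine ⟨k, ?_⟩
    rw [← hk, pairing_eq_sum, Finset.sum_eq_single j]
    · change _ = (herm (if j = j then x else 0) (yᵀ j)).re
      simp
    · intro i _ hij
      change (herm (if i = j then x else 0) (yᵀ i)).re = 0
      simp [hij, herm]
    · simp

theorem exists_int_pairing (hΛ : IsThetaLattice Λ) {n : ℕ} {x y : Matrix (Fin r) (Fin n) ℂ}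
    (hx : x ∈ tupleLattice Λ n) (hy : y ∈ tupleLattice Λ n) : ∃ k : ℤ, pairing x y = k :=
  (mem_tupleLattice_iff_pairing hΛ).1 hy x hx

/-- Write `w` as the sum of its columns. A diagonal term is an even norm times the rational integer
`S j j`, and each cross term is twice an integral pairing. Hence `exp(iπ tr(wᴴ w S)) = 1` on the
lattice. -/
theorem exists_int_quad (hΛ : IsThetaLattice Λ) {n : ℕ} {S : Matrix (Fin n) (Fin n) ℂ}
    (hS : S.IsHermitian) (hSO : ∀ i j, S i j ∈ intRing (imQuadField m))
    {w : Matrix (Fin r) (Fin n) ℂ} (hw : w ∈ tupleLattice Λ n) :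
    ∃ k : ℤ, quad S w = 2 * k := by
  let c : Fin n → Matrix (Fin r) (Fin n) ℂ := fun j => (Matrix.of fun i => if i = j then wᵀ j else 0)ᵀ
  have hc : ∀ j, c j ∈ tupleLattice Λ n := by
    intro j i
    change (if i = j then wᵀ j else 0) ∈ Λ
    split_ifs
    exacts [hw j, Λ.zero_mem]
  have hsum : w = ∑ j, c j := by
    ext a i
    rw [Matrix.sum_apply, Finset.sum_eq_single i]
    · simp [c]
    · intro j _ hj
      simp [c, hj.symm]
    · simp
  have hcj : ∀ j, ∃ k : ℤ, quad S (c j) = 2 * k := by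
    intro j
    obtain ⟨s, hs⟩ := exists_int_of_mem_intRing (hSO j j) (hS.apply j j)
    obtain ⟨k, hk⟩ := hΛ.even _ (hw j)
    refine ⟨s * k, ?_⟩
    have h1 : quad S (c j) = herm (wᵀ j) (wᵀ j) * S j j := by
      simp only [quad, c, herm, Matrix.trace, Matrix.diag, Matrix.mul_apply, dotProduct]
      rw [Finset.sum_eq_single j, Finset.sum_eq_single j]
      · simp
      · intro i _ hi
        simp [hi]
      · simp
      · intro i _ hi
        simp [hi]
      · simp
    have h2 : herm (wᵀ j) (wᵀ j) = (2 * k : ℝ) := by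
      rw [← hk]
      refine (Complex.conj_eq_iff_re.1 ?_).symm
      simp [herm, dotProduct, mul_comm]
    rw [h1, h2, hs]
    push_cast
    ring
  have key : ∀ t : Finset (Fin n), (∑ j ∈ t, c j) ∈ tupleLattice Λ n ∧
      ∃ k : ℤ, quad S (∑ j ∈ t, c j) = 2 * k := by
    classical
    intro t
    induction t using Finset.induction_on with
    | empty => exact ⟨by simp [zero_mem], 0, by simp [quad]⟩
    | insert j t hj ih =>
      obtain ⟨h1, k, hk⟩ := ih
      rw [Finset.sum_insert hj]
      refine ⟨add_mem (hc j) h1, ?_⟩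
      obtain ⟨k', hk'⟩ := hcj j
      obtain ⟨l, hl⟩ := exists_int_pairing hΛ (hc j) (mul_mem_tupleLattice h1 hSO)
      refine ⟨k' + k + l, ?_⟩
      rw [quad_add hS, hk, hk', hl]
      push_cast
      ring
  rw [hsum]
  exact (key _).2

theorem exists_basis_tupleLattice (hΛ : IsThetaLattice Λ) (n : ℕ) :
    ∃ (ι : Type) (_ : Fintype ι) (_ : DecidableEq ι)
      (b : Module.Basis ι ℝ (Matrix (Fin r) (Fin n) ℂ)),
      ∀ w, w ∈ tupleLattice Λ n ↔ ∀ i, ∃ k : ℤ, b.repr w i = k := by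
  classical
  let L : Submodule ℤ (Fin r → ℂ) := Λ.restrictScalars ℤ
  have : DiscreteTopology L := hΛ.discrete
  have : IsZLattice ℝ L := ⟨hΛ.span_eq_top⟩
  have := ZLattice.module_free ℝ L
  have := ZLattice.module_finite ℝ L
  let b0 := Module.finBasis ℤ L
  let b1 := b0.ofZLatticeBasis ℝ L
  have hb1 : ∀ x, x ∈ Λ ↔ ∀ i, ∃ k : ℤ, b1.repr x i = k := by
    intro x
    have h1 : x ∈ Λ ↔ x ∈ Submodule.span ℤ (Set.range b1) := by
      rw [b0.ofZLatticeBasis_span ℝ L]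
      rfl
    rw [h1, Module.Basis.mem_span_iff_repr_mem]
    simp only [Set.mem_range, eq_comm]
    rfl
  let e : (Fin n → Fin r → ℂ) ≃ₗ[ℝ] Matrix (Fin r) (Fin n) ℂ :=
    (Matrix.ofLinearEquiv ℝ).trans (Matrix.transposeLinearEquiv _ _ ℝ ℂ)
  refine ⟨_, inferInstance, inferInstance, (Pi.basis fun _ : Fin n => b1).map e, fun w => ?_⟩
  rw [mem_tupleLattice]
  simp only [hb1, Module.Basis.map_repr, LinearEquiv.trans_apply, Pi.basis_repr]
  constructor
  · rintro h ⟨j, i⟩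
    exact h j i
  · intro h j i
    exact h ⟨j, i⟩

end Lattice

/-! ## Poisson summation for Gaussian functions in several variables -/

section Poisson

open MeasureTheory

variable {ι : Type*}

/-- An integral vector as a real vector. -/
def intVec (k : ι → ℤ) : ι → ℝ := fun i => k i

theorem intVec_injective : Function.Injective (intVec : (ι → ℤ) → ι → ℝ) := by
  intro k l h
  ext i
  have := congrFun h i
  simpa [intVec] using this

theorem intVec_add (k l : ι → ℤ) : intVec (k + l) = intVec k + intVec l := by
  ext i
  simp [intVec]

/-- The translates of the unit cube. -/
def unitCube (k : ι → ℤ) : Set (ι → ℝ) := {x | ∀ i, x i - k i ∈ Set.Ioc (0 : ℝ) (0 + 1)}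

theorem mem_unitCube_iff {k : ι → ℤ} {x : ι → ℝ} : x ∈ unitCube k ↔ ∀ i, ⌈x i⌉ = k i + 1 := by
  simp only [unitCube, Set.mem_ofPred_eq, Set.mem_Ioc, Int.ceil_eq_iff]
  refine forall_congr' fun i => ?_
  push_cast
  constructor <;> rintro ⟨h1, h2⟩ <;> constructor <;> linarith

theorem iUnion_unitCube : (⋃ k : ι → ℤ, unitCube k) = Set.univ := by
  rw [Set.eq_univ_iff_forall]
  intro x
  rw [Set.mem_iUnion]
  exact ⟨fun i => ⌈x i⌉ - 1, mem_unitCube_iff.2 fun i => by ring⟩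

theorem pairwise_disjoint_unitCube :
    Pairwise (Function.onFun Disjoint (unitCube : (ι → ℤ) → Set (ι → ℝ))) := by
  intro k l hkl
  rw [Function.onFun, Set.disjoint_left]
  intro x hx hx'
  apply hkl
  ext i
  have h1 := mem_unitCube_iff.1 hx i
  have h2 := mem_unitCube_iff.1 hx' i
  linarith

variable [Fintype ι]

/-- The bound `e^x ≥ x^N / N!` compares the terms with `‖k‖^(-2N)`, which is summable because `2N`
exceeds the rank of the lattice. -/
theorem summable_exp_neg_norm_sq {a : ℝ} (ha : 0 < a) :
    Summable fun k : ι → ℤ => Real.exp (-a * ‖intVec k‖ ^ 2) := by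
  classical
  let b := Pi.basisFun ℝ ι
  let L := Submodule.span ℤ (Set.range b)
  let e : (ι → ℤ) → L := fun k => ⟨intVec k, by
    rw [Module.Basis.mem_span_iff_repr_mem]
    exact fun i => ⟨k i, by simp [b, intVec]⟩⟩
  have he : Function.Injective e := fun k l hkl => intVec_injective (congrArg Subtype.val hkl)
  set N := Module.finrank ℤ L + 1
  have hs := ((ZLattice.summable_norm_pow_inv L (2 * N) (by omega)).comp_injective he).mul_left
    (N.factorial / a ^ N : ℝ)
  refine Summable.of_norm_bounded_eventually hs ?_
  have h0 : ∀ᶠ k : ι → ℤ in Filter.cofinite, k ≠ 0 := by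
    simp [Filter.eventually_cofinite]
  filter_upwards [h0] with k hk
  have hpos : 0 < ‖intVec k‖ := by
    rw [norm_pos_iff]
    exact fun h => hk (intVec_injective (h.trans (by ext i; simp [intVec])))
  have hn : ‖e k‖ = ‖intVec k‖ := rfl
  simp only [Function.comp_apply, hn]
  rw [Real.norm_of_nonneg (Real.exp_pos _).le]
  set t := ‖intVec k‖
  have h1 := Real.pow_div_factorial_le_exp (a * t ^ 2) (by positivity) N
  rw [neg_mul, Real.exp_neg]
  calc (Real.exp (a * t ^ 2))⁻¹ ≤ ((a * t ^ 2) ^ N / N.factorial)⁻¹ := by gcongr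
    _ = N.factorial / a ^ N * (t ^ (2 * N))⁻¹ := by
      rw [mul_pow, ← pow_mul, inv_div, div_mul_eq_div_div, div_eq_mul_inv]
    _ = N.factorial / a ^ N * t⁻¹ ^ (2 * N) := by rw [inv_pow]

theorem measurableSet_unitCube (k : ι → ℤ) : MeasurableSet (unitCube k) := by
  have : unitCube k = Set.pi Set.univ fun i => Set.Ioc (k i : ℝ) (k i + 1) := by
    ext x
    simp only [unitCube, Set.mem_ofPred_eq, Set.mem_pi, Set.mem_univ, true_imp_iff, Set.mem_Ioc]
    refine forall_congr' fun i => ?_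
    constructor <;> rintro ⟨h1, h2⟩ <;> constructor <;> linarith
  rw [this]
  exact MeasurableSet.univ_pi fun i => measurableSet_Ioc

theorem integral_eq_tsum_unitCube {g : (ι → ℝ) → ℂ} (hg : Integrable g) :
    ∫ x, g x = ∑' k : ι → ℤ, ∫ x in unitCube (0 : ι → ℤ), g (x + intVec k) := by
  rw [← setIntegral_univ, ← iUnion_unitCube, integral_iUnion measurableSet_unitCube
    pairwise_disjoint_unitCube (by rw [iUnion_unitCube]; exact hg.integrableOn)]
  congr 1
  ext k
  rw [← (measurePreserving_add_right volume (intVec k)).setIntegral_preimage_emb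
    (measurableEmbedding_addRight _)]
  congr 2
  ext x
  simp [unitCube, intVec]

theorem norm_le_one_of_mem_unitCube {x : ι → ℝ} (hx : x ∈ unitCube (0 : ι → ℤ)) : ‖x‖ ≤ 1 := by
  rw [pi_norm_le_iff_of_nonneg zero_le_one]
  intro i
  have := hx i
  simp only [Pi.zero_apply, Int.cast_zero, sub_zero, zero_add] at this
  rw [Real.norm_of_nonneg this.1.le]
  exact this.2

/-- The additive character `x ↦ exp(2πi k·x)`. -/
def expChar (k : ι → ℤ) (x : ι → ℝ) : ℂ := 
  Complex.exp (2 * Real.pi * Complex.I * ∑ i, (k i : ℂ) * (x i : ℂ))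

theorem mFourier_coe (k : ι → ℤ) (x : ι → ℝ) :
    UnitAddTorus.mFourier k (fun i => (x i : UnitAddCircle)) = expChar k x := by
  simp only [UnitAddTorus.mFourier, ContinuousMap.coe_mk, expChar]
  rw [Finset.mul_sum, Complex.exp_sum]
  refine Finset.prod_congr rfl fun i _ => ?_
  rw [fourier_coe_apply]
  congr 1
  simp
  ring

theorem expChar_add_intVec (k l : ι → ℤ) (x : ι → ℝ) :
    expChar k (x + intVec l) = expChar k x := by
  rw [← mFourier_coe, ← mFourier_coe]
  congr 1
  ext i
  simp [intVec]

theorem norm_expChar (k : ι → ℤ) (x : ι → ℝ) : ‖expChar k x‖ = 1 := by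
  have : (2 * Real.pi * Complex.I * ∑ i, (k i : ℂ) * x i) =
      ((2 * Real.pi * ∑ i, (k i : ℝ) * x i : ℝ) : ℂ) * Complex.I := by
    push_cast; ring
  rw [expChar, this, Complex.norm_exp_ofReal_mul_I]

theorem continuous_expChar (k : ι → ℤ) : Continuous (expChar k) := by
  unfold expChar
  fun_prop

/-- The locally uniform bound makes the periodisation of `f` a continuous function on the torus. Its
Fourier coefficients unfold to integrals over the whole space, and a continuous function with
summable Fourier coefficients is the pointwise sum of its series. -/
theorem hasSum_poisson {f : (ι → ℝ) → ℂ} (hc : Continuous f) (hi : Integrable f)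
    (hsum : ∀ R : ℝ, ∃ u : (ι → ℤ) → ℝ, Summable u ∧
      ∀ x : ι → ℝ, ‖x‖ ≤ R → ∀ k, ‖f (x + intVec k)‖ ≤ u k)
    (hs : Summable fun k : ι → ℤ => ∫ x, expChar (-k) x * f x) (x : ι → ℝ) :
    HasSum (fun k : ι → ℤ => (∫ x, expChar (-k) x * f x) * expChar k x)
      (∑' k : ι → ℤ, f (x + intVec k)) := by
  set F : (ι → ℝ) → ℂ := fun x => ∑' k : ι → ℤ, f (x + intVec k) with hF
  have hFc : Continuous F := by
    rw [continuous_iff_continuousAt]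
    intro y
    obtain ⟨u, hu, hfu⟩ := hsum (‖y‖ + 1)
    have h1 : ContinuousOn F (Metric.closedBall 0 (‖y‖ + 1)) := by
      refine continuousOn_tsum (fun k => ?_) hu fun k x hx => hfu x (by simpa using hx) k
      exact (hc.comp (continuous_id.add continuous_const)).continuousOn
    refine h1.continuousAt (Filter.mem_of_superset (Metric.closedBall_mem_nhds y one_pos) ?_)
    intro z hz
    rw [mem_closedBall_zero_iff]
    have := mem_closedBall_iff_norm.1 hz
    calc ‖z‖ = ‖y + (z - y)‖ := by congr 1; abel
      _ ≤ _ := (norm_add_le _ _).trans (by gcongr)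
  have hFp : ∀ x l, F (x + intVec l) = F x := by
    intro x l
    simp only [hF]
    rw [← (Equiv.addLeft l).tsum_eq (fun k => f (x + intVec k))]
    congr 1
    ext k
    simp [intVec_add, add_assoc]
  have hq : IsOpenQuotientMap (fun (x : ι → ℝ) i => (x i : UnitAddCircle)) :=
    IsOpenQuotientMap.piMap (f := fun _ : ι => ((↑) : ℝ → UnitAddCircle))
      fun _ => QuotientAddGroup.isOpenQuotientMap_mk
  have hlift : ∀ a b : ι → ℝ, (fun i => (a i : UnitAddCircle)) = (fun i => (b i : UnitAddCircle)) →
      F a = F b := by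
    intro a b hab
    have : ∀ i, ∃ k : ℤ, a i = b i + k := by
      intro i
      have h1 := congrFun hab i
      rw [← sub_eq_zero, ← AddCircle.coe_sub, AddCircle.coe_eq_zero_iff] at h1
      obtain ⟨k, hk⟩ := h1
      exact ⟨k, by rw [zsmul_one] at hk; rw [hk]; ring⟩
    choose k hk using this
    rw [show a = b + intVec k from funext hk, hFp]
  let q : C(ι → ℝ, UnitAddTorus ι) := ⟨fun x i => (x i : UnitAddCircle), hq.continuous⟩
  have hq' : Topology.IsQuotientMap q := hq.isQuotientMap
  have hlift' : Function.FactorsThrough (⟨F, hFc⟩ : C(ι → ℝ, ℂ)) q := fun a b hab => hlift a b hab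
  let Φ : C(UnitAddTorus ι, ℂ) := hq'.lift ⟨F, hFc⟩ hlift'
  have hΦ : ∀ x : ι → ℝ, Φ (fun i => (x i : UnitAddCircle)) = F x := fun x =>
    DFunLike.congr_fun (hq'.lift_comp ⟨F, hFc⟩ hlift') x
  have hcoef : ∀ k, UnitAddTorus.mFourierCoeff Φ k = ∫ x, expChar (-k) x * f x := by
    intro k
    rw [UnitAddTorus.mFourierCoeff_eq_integral _ _ 0]
    have hset : {x : ι → ℝ | ∀ i, x i ∈ Set.Ioc ((0 : ι → ℝ) i) ((0 : ι → ℝ) i + 1)} =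
        unitCube (0 : ι → ℤ) := by
      ext x; simp [unitCube]
    rw [hset]
    simp only [mFourier_coe, hΦ, smul_eq_mul]
    have hint : Integrable (fun x => expChar (-k) x * f x) := by
      refine hi.bdd_mul (c := 1) (continuous_expChar _).aestronglyMeasurable ?_
      exact Filter.Eventually.of_forall fun x => (norm_expChar _ _).le
    rw [integral_eq_tsum_unitCube hint]
    obtain ⟨u, hu, hfu⟩ := hsum 1
    have hvol : volume (unitCube (0 : ι → ℤ)) < ⊤ := by
      refine (measure_mono (t := Metric.closedBall (0 : ι → ℝ) 1) fun x hx => ?_).trans_lt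
        measure_closedBall_lt_top
      simpa using norm_le_one_of_mem_unitCube hx
    have hb : ∀ l : ι → ℤ, ∀ x ∈ unitCube (0 : ι → ℤ), ‖expChar (-k) (x + intVec l) *
        f (x + intVec l)‖ ≤ u l := by
      intro l x hx
      rw [norm_mul, norm_expChar, one_mul]
      exact hfu x (norm_le_one_of_mem_unitCube hx) l
    have hcont : ∀ l : ι → ℤ, Continuous fun x => expChar (-k) (x + intVec l) *
        f (x + intVec l) := fun l =>
      ((continuous_expChar _).comp (continuous_id.add continuous_const)).mul
        (hc.comp (continuous_id.add continuous_const))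
    rw [integral_tsum_of_summable_integral_norm]
    · refine setIntegral_congr_fun (measurableSet_unitCube 0) fun x hx => ?_
      simp only [expChar_add_intVec, tsum_mul_left, hF]
    · intro l
      exact (IntegrableOn.of_bound hvol (hcont l).aestronglyMeasurable (u l)
        (ae_restrict_of_forall_mem (measurableSet_unitCube 0) (hb l)))
    · refine Summable.of_nonneg_of_le (fun l => integral_nonneg fun x => norm_nonneg _) (fun l => ?_)
        (hu.mul_right (volume.real (unitCube (0 : ι → ℤ))))
      refine (Real.le_norm_self _).trans ?_
      refine norm_setIntegral_le_of_norm_le_const hvol fun x hx => ?_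
      rw [norm_norm]
      exact hb l x hx
  have hs' : Summable (UnitAddTorus.mFourierCoeff Φ) := by
    rw [show UnitAddTorus.mFourierCoeff Φ = _ from funext hcoef]
    exact hs
  have := UnitAddTorus.hasSum_mFourier_series_apply_of_summable hs' (fun i => (x i : UnitAddCircle))
  simpa only [hcoef, mFourier_coe, hΦ, smul_eq_mul] using this

/-- The minimum on the compact unit sphere is positive, and homogeneity extends the bound. The
sphere is empty exactly when the space is zero, where any constant works. -/
theorem exists_le_dotProduct_mulVec {G : Matrix ι ι ℝ} (hG : G.PosDef) :
    ∃ c : ℝ, 0 < c ∧ ∀ x : ι → ℝ, c * ‖x‖ ^ 2 ≤ x ⬝ᵥ G *ᵥ x := by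
  classical
  by_cases hS : (Metric.sphere (0 : ι → ℝ) 1).Nonempty
  · have hcont : Continuous fun x : ι → ℝ => x ⬝ᵥ G *ᵥ x := by
      simp only [dotProduct, Matrix.mulVec]
      fun_prop
    obtain ⟨y, hy, hmin⟩ := (isCompact_sphere (0 : ι → ℝ) 1).exists_isMinOn hS hcont.continuousOn
    have hy0 : y ≠ 0 := by
      rintro rfl
      simp at hy
    refine ⟨y ⬝ᵥ G *ᵥ y, by simpa using hG.dotProduct_mulVec_pos hy0, fun x => ?_⟩
    by_cases hx : x = 0
    · simp [hx]
    have hx' : ‖x‖ ≠ 0 := norm_ne_zero_iff.2 hx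
    have h1 : ‖x‖⁻¹ • x ∈ Metric.sphere (0 : ι → ℝ) 1 := by
      simp [norm_smul, hx']
    have h2 : y ⬝ᵥ G *ᵥ y ≤ (‖x‖⁻¹ • x) ⬝ᵥ G *ᵥ (‖x‖⁻¹ • x) := hmin h1
    rw [Matrix.mulVec_smul, smul_dotProduct, dotProduct_smul, smul_eq_mul, smul_eq_mul] at h2
    calc (y ⬝ᵥ G *ᵥ y) * ‖x‖ ^ 2 ≤ (‖x‖⁻¹ * (‖x‖⁻¹ * (x ⬝ᵥ G *ᵥ x))) * ‖x‖ ^ 2 := by gcongr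
      _ = _ := by field_simp
  · refine ⟨1, one_pos, fun x => ?_⟩
    have hx : x = 0 := by
      by_contra hx
      exact hS ⟨‖x‖⁻¹ • x, by simp [norm_smul, norm_ne_zero_iff.2 hx]⟩
    simp [hx]

theorem summable_exp_neg_dotProduct {G : Matrix ι ι ℝ} (hG : G.PosDef) (R : ℝ) :
    ∃ u : (ι → ℤ) → ℝ, Summable u ∧ ∀ x : ι → ℝ, ‖x‖ ≤ R → ∀ k,
      Real.exp (-Real.pi * ((x + intVec k) ⬝ᵥ G *ᵥ (x + intVec k))) ≤ u k := by
  obtain ⟨c, hc, hle⟩ := exists_le_dotProduct_mulVec hG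
  -- The constants come from `‖k‖² ≤ 2‖x + k‖² + 2R²`.
  refine ⟨fun k => Real.exp (Real.pi * c * R ^ 2) * Real.exp (-(Real.pi * c / 2) * ‖intVec k‖ ^ 2),
    (summable_exp_neg_norm_sq (by positivity)).mul_left _, fun x hx k => ?_⟩
  change _ ≤ Real.exp (Real.pi * c * R ^ 2) * Real.exp (-(Real.pi * c / 2) * ‖intVec k‖ ^ 2)
  rw [← Real.exp_add, Real.exp_le_exp]
  have h1 := hle (x + intVec k)
  have h2 : ‖intVec k‖ ≤ ‖x + intVec k‖ + R := by
    calc ‖intVec k‖ = ‖(x + intVec k) - x‖ := by congr 1; abel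
      _ ≤ ‖x + intVec k‖ + ‖x‖ := norm_sub_le _ _
      _ ≤ _ := by gcongr
  have h3 : ‖intVec k‖ ^ 2 ≤ 2 * ‖x + intVec k‖ ^ 2 + 2 * R ^ 2 := by
    have := norm_nonneg (intVec k)
    nlinarith [sq_nonneg (‖x + intVec k‖ - R)]
  have h4 : c * ‖intVec k‖ ^ 2 ≤ 2 * ((x + intVec k) ⬝ᵥ G *ᵥ (x + intVec k)) + 2 * c * R ^ 2 := by
    nlinarith
  nlinarith [Real.pi_pos]

open scoped MatrixOrder in
theorem exists_eq_conjTranspose_mul_self {G : Matrix ι ι ℝ} (hG : G.PosSemidef) :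
    ∃ B : Matrix ι ι ℝ, G = Bᴴ * B := by
  classical
  exact CStarAlgebra.nonneg_iff_eq_star_mul_self.mp hG.nonneg

/-- Writing `G = Bᵀ B` and substituting `y = B x` reduces this to the standard Gaussian with a
linear term. The frequency `k` becomes `B⁻ᵀ k`, whose squared length is the value of `G⁻¹` at `k`.
-/
theorem integral_gaussian_expChar [DecidableEq ι] {G : Matrix ι ι ℝ} (hG : G.PosDef) (k : ι → ℤ) :
    Integrable (fun x : ι → ℝ => (Real.exp (-Real.pi * (x ⬝ᵥ G *ᵥ x)) : ℂ)) ∧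
    ∫ x : ι → ℝ, expChar (-k) x * (Real.exp (-Real.pi * (x ⬝ᵥ G *ᵥ x)) : ℂ) =
      ((Real.sqrt G.det)⁻¹ * Real.exp (-Real.pi * (intVec k ⬝ᵥ G⁻¹ *ᵥ intVec k)) : ℝ) := by
  obtain ⟨B, hB⟩ := exists_eq_conjTranspose_mul_self hG.posSemidef
  rw [Matrix.conjTranspose_eq_transpose_of_trivial] at hB
  have hdet : G.det = B.det ^ 2 := by rw [hB, Matrix.det_mul, Matrix.det_transpose, sq]
  have hB0 : B.det ≠ 0 := by
    intro h
    have := hG.det_pos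
    rw [hdet, h] at this
    simp at this
  have hBu : IsUnit B.det := isUnit_iff_ne_zero.2 hB0
  have hq : ∀ x : ι → ℝ, x ⬝ᵥ G *ᵥ x = ∑ i, (B *ᵥ x) i ^ 2 := by
    intro x
    rw [hB, ← Matrix.mulVec_mulVec, Matrix.dotProduct_mulVec, Matrix.vecMul_transpose]
    simp [dotProduct, sq]
  have hq' : ∀ x : ι → ℝ, x ⬝ᵥ G⁻¹ *ᵥ x = ∑ i, (B⁻¹ᵀ *ᵥ x) i ^ 2 := by
    intro x
    rw [hB, Matrix.mul_inv_rev, ← Matrix.mulVec_mulVec, Matrix.dotProduct_mulVec,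
      ← Matrix.transpose_nonsing_inv, Matrix.mulVec_transpose]
    simp [dotProduct, sq]
  set w := B⁻¹ᵀ *ᵥ intVec k with hw
  have hchar : ∀ x : ι → ℝ, (∑ i, (k i : ℂ) * (x i : ℂ)) = ∑ i, (w i : ℂ) * ((B *ᵥ x) i : ℂ) := by
    intro x
    have : intVec k ⬝ᵥ x = w ⬝ᵥ (B *ᵥ x) := by
      rw [hw, Matrix.dotProduct_mulVec, Matrix.mulVec_transpose, Matrix.vecMul_vecMul,
        Matrix.nonsing_inv_mul _ hBu, Matrix.vecMul_one]
    have h2 := congrArg (fun t : ℝ => (t : ℂ)) this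
    simpa [dotProduct, intVec] using h2
  have hpi : (0 : ℝ) < (Real.pi : ℂ).re := by simpa using Real.pi_pos
  have hmap := Real.map_matrix_volume_pi_eq_smul_volume_pi hB0
  have hmeas : Measurable (Matrix.toLin' B) := (LinearMap.continuous_of_finiteDimensional _).measurable
  have hint : ∀ c : ι → ℂ, Integrable (fun x : ι → ℝ =>
      Complex.exp (-Real.pi * ∑ i, ((B *ᵥ x) i : ℂ) ^ 2 + ∑ i, c i * ((B *ᵥ x) i : ℂ))) := by
    intro c
    have h1 := GaussianFourier.integrable_cexp_neg_mul_sum_add hpi c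
    have h2 : Integrable (fun v : ι → ℝ => Complex.exp (-Real.pi * ∑ i, (v i : ℂ) ^ 2 +
        ∑ i, c i * v i)) (Measure.map (Matrix.toLin' B) volume) := by
      rw [hmap]
      exact h1.smul_measure ENNReal.ofReal_ne_top
    exact (integrable_map_measure h2.1 hmeas.aemeasurable).1 h2
  have hf : ∀ x : ι → ℝ, (Real.exp (-Real.pi * (x ⬝ᵥ G *ᵥ x)) : ℂ) =
      Complex.exp (-Real.pi * ∑ i, ((B *ᵥ x) i : ℂ) ^ 2) := by
    intro x
    rw [hq]
    push_cast
    rfl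
  refine ⟨?_, ?_⟩
  · have := hint 0
    simpa only [hf, Pi.zero_apply, zero_mul, Finset.sum_const_zero, add_zero] using this
  · set c : ι → ℂ := fun i => -(2 * Real.pi * Complex.I) * w i with hc
    have h1 : ∀ x : ι → ℝ, expChar (-k) x * (Real.exp (-Real.pi * (x ⬝ᵥ G *ᵥ x)) : ℂ) =
        Complex.exp (-Real.pi * ∑ i, ((B *ᵥ x) i : ℂ) ^ 2 + ∑ i, c i * ((B *ᵥ x) i : ℂ)) := by
      intro x
      rw [hf, expChar, ← Complex.exp_add, add_comm]
      congr 2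
      have : ∑ i, ((-k) i : ℂ) * (x i : ℂ) = -∑ i, (k i : ℂ) * (x i : ℂ) := by
        rw [← Finset.sum_neg_distrib]
        simp
      rw [this, hchar, mul_neg, ← neg_mul, Finset.mul_sum]
      simp only [hc, mul_assoc]
    simp only [h1]
    have h2 := integral_map (μ := volume) hmeas.aemeasurable (f := fun v : ι → ℝ =>
      Complex.exp (-Real.pi * ∑ i, (v i : ℂ) ^ 2 + ∑ i, c i * v i)) (by
        refine Continuous.aestronglyMeasurable ?_
        fun_prop)
    simp only [Matrix.toLin'_apply] at h2
    rw [← h2, hmap, integral_smul_measure, GaussianFourier.integral_cexp_neg_mul_sum_add hpi]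
    have hpi0 : (Real.pi : ℂ) ≠ 0 := by exact_mod_cast Real.pi_ne_zero
    rw [div_self hpi0, Complex.one_cpow, one_mul, hq', ENNReal.toReal_ofReal (abs_nonneg _), hdet,
      Real.sqrt_sq_eq_abs, abs_inv]
    have h3 : (∑ i, c i ^ 2) / (4 * Real.pi) = -Real.pi * ∑ i, (w i : ℂ) ^ 2 := by
      rw [Finset.sum_div, Finset.mul_sum]
      refine Finset.sum_congr rfl fun i _ => ?_
      simp only [hc]
      field_simp
      rw [Complex.I_sq]
      ring
    rw [h3, Complex.real_smul]
    push_cast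
    rfl

theorem tsum_gaussian [DecidableEq ι] {G : Matrix ι ι ℝ} (hG : G.PosDef) (x : ι → ℝ) :
    ∑' k : ι → ℤ, (Real.exp (-Real.pi * ((x + intVec k) ⬝ᵥ G *ᵥ (x + intVec k))) : ℂ) =
      ((Real.sqrt G.det)⁻¹ : ℝ) * ∑' k : ι → ℤ,
        (Real.exp (-Real.pi * (intVec k ⬝ᵥ G⁻¹ *ᵥ intVec k)) : ℂ) * expChar k x := by
  have hc : Continuous fun x : ι → ℝ => (Real.exp (-Real.pi * (x ⬝ᵥ G *ᵥ x)) : ℂ) := by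
    simp only [dotProduct, Matrix.mulVec]
    fun_prop
  obtain ⟨v, hv, hvle⟩ := summable_exp_neg_dotProduct hG.inv 0
  have hs : Summable fun k : ι → ℤ =>
      ∫ x : ι → ℝ, expChar (-k) x * (Real.exp (-Real.pi * (x ⬝ᵥ G *ᵥ x)) : ℂ) := by
    refine Summable.of_norm_bounded (hv.mul_left (Real.sqrt G.det)⁻¹) fun k => ?_
    rw [(integral_gaussian_expChar hG k).2, Complex.norm_real, Real.norm_of_nonneg (by positivity)]
    gcongr
    simpa using hvle 0 (by simp) k
  have := (hasSum_poisson hc (integral_gaussian_expChar hG 0).1 (fun R => by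
    obtain ⟨u, hu, hle⟩ := summable_exp_neg_dotProduct hG R
    refine ⟨u, hu, fun x hx k => ?_⟩
    rw [Complex.norm_real, Real.norm_of_nonneg (Real.exp_pos _).le]
    exact hle x hx k) hs x).tsum_eq
  rw [← this, ← tsum_mul_left]
  congr 1
  ext k
  rw [(integral_gaussian_expChar hG k).2]
  push_cast
  ring

end Poisson

/-! ## Unimodular lattices of matrices and their theta series -/

section Unimodular

variable {r n : ℕ}

/-- A full lattice in the space of `r × n` matrices which is its own dual for `Re tr(xᴴ y)`. -/
structure IsUnimodularLattice (L : AddSubgroup (Matrix (Fin r) (Fin n) ℂ)) : Prop where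
  exists_basis : ∃ (ι : Type) (_ : Fintype ι) (_ : DecidableEq ι)
    (b : Module.Basis ι ℝ (Matrix (Fin r) (Fin n) ℂ)),
    ∀ w, w ∈ L ↔ ∀ i, ∃ k : ℤ, b.repr w i = k
  mem_iff : ∀ y, y ∈ L ↔ ∀ x ∈ L, ∃ k : ℤ, pairing x y = k

theorem IsThetaLattice.isUnimodularLattice {m : ℕ}
    {Λ : Submodule (𝓞 (imQuadField m)) (Fin r → ℂ)} (hΛ : IsThetaLattice Λ) (n : ℕ) :
    IsUnimodularLattice (tupleLattice Λ n) :=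
  ⟨exists_basis_tupleLattice hΛ n, fun _ => mem_tupleLattice_iff_pairing hΛ⟩

theorem quad_eq_sum (Z : Matrix (Fin n) (Fin n) ℂ) (w : Matrix (Fin r) (Fin n) ℂ) :
    quad Z w = ∑ i, w i ⬝ᵥ Z *ᵥ star (w i) := by
  rw [quad, Matrix.mul_assoc, Matrix.trace_mul_comm, Matrix.mul_assoc, Matrix.trace]
  refine Finset.sum_congr rfl fun i _ => ?_
  rfl

theorem quad_re_pos {Y : Matrix (Fin n) (Fin n) ℂ} (hY : Y.PosDef) {w : Matrix (Fin r) (Fin n) ℂ}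
    (hw : w ≠ 0) : 0 < (quad Y w).re := by
  have hrow : ∃ i, star (w i) ≠ 0 := by
    by_contra! h
    apply hw
    ext i j
    have := congrFun (h i) j
    simpa using this
  obtain ⟨i, hi⟩ := hrow
  have hnn : ∀ i, 0 ≤ (w i ⬝ᵥ Y *ᵥ star (w i)).re := by
    intro i
    have := hY.posSemidef.dotProduct_mulVec_nonneg (star (w i))
    rw [star_star] at this
    exact (Complex.le_def.1 this).1
  have hpos : 0 < (w i ⬝ᵥ Y *ᵥ star (w i)).re := by
    have := hY.dotProduct_mulVec_pos hi
    rw [star_star] at this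
    exact (Complex.lt_def.1 this).1
  rw [quad_eq_sum, Complex.re_sum]
  exact Finset.sum_pos' (fun i _ => hnn i) ⟨i, Finset.mem_univ _, hpos⟩

theorem quad_im (Z : Matrix (Fin n) (Fin n) ℂ) (w : Matrix (Fin r) (Fin n) ℂ) :
    (quad Z w).im = (quad ((1 / (2 * Complex.I)) • (Z - Zᴴ)) w).re := by
  have h1 : quad Zᴴ w = star (quad Z w) := by
    rw [quad, quad, ← Matrix.trace_conjTranspose, Matrix.conjTranspose_mul,
      Matrix.conjTranspose_mul, Matrix.conjTranspose_conjTranspose, Matrix.trace_mul_comm]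
  rw [quad_smul_left, sub_eq_add_neg, quad_add_left, quad_neg_left, h1, ← sub_eq_add_neg,
    Complex.star_def, Complex.sub_conj]
  have : 1 / (2 * Complex.I) * ((2 * (quad Z w).im : ℝ) * Complex.I) = ((quad Z w).im : ℂ) := by
    push_cast
    field_simp
  rw [this, Complex.ofReal_re]

variable {ι : Type} [Fintype ι] (b : Module.Basis ι ℝ (Matrix (Fin r) (Fin n) ℂ))

/-- The Gram matrix of a basis for the form `Re tr(xᴴ y Y)`. -/
def gram (Y : Matrix (Fin n) (Fin n) ℂ) : Matrix ι ι ℝ :=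
  Matrix.of fun i j => pairing (b i) (b j * Y)

theorem pairing_equivFun_symm (Y : Matrix (Fin n) (Fin n) ℂ) (x y : ι → ℝ) :
    pairing (b.equivFun.symm x) (b.equivFun.symm y * Y) = x ⬝ᵥ gram b Y *ᵥ y := by
  have hl : ∀ (s : Finset ι) (f : ι → Matrix (Fin r) (Fin n) ℂ) z,
      pairing (∑ i ∈ s, f i) z = ∑ i ∈ s, pairing (f i) z := by
    intro s f z
    simp [pairing, Matrix.sum_mul, Matrix.trace_sum, Matrix.conjTranspose_sum]
  have hr : ∀ (s : Finset ι) (f : ι → Matrix (Fin r) (Fin n) ℂ) z,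
      pairing z (∑ i ∈ s, f i) = ∑ i ∈ s, pairing z (f i) := by
    intro s f z
    rw [pairing_comm, hl]
    simp only [pairing_comm]
  rw [Module.Basis.equivFun_symm_apply, Module.Basis.equivFun_symm_apply, hl, Matrix.sum_mul]
  simp only [dotProduct, Matrix.mulVec, gram, Matrix.of_apply]
  refine Finset.sum_congr rfl fun i _ => ?_
  rw [hr, Finset.mul_sum]
  refine Finset.sum_congr rfl fun j _ => ?_
  rw [pairing_smul_left, Matrix.smul_mul, pairing_smul_right]
  ring

theorem quad_equivFun_symm {Y : Matrix (Fin n) (Fin n) ℂ} (x : ι → ℝ) :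
    (quad Y (b.equivFun.symm x)).re = x ⬝ᵥ gram b Y *ᵥ x := by
  rw [← pairing_equivFun_symm, quad, pairing, Matrix.mul_assoc]

theorem pairing_equivFun_symm' (x y : ι → ℝ) :
    pairing (b.equivFun.symm x) (b.equivFun.symm y) = x ⬝ᵥ gram b 1 *ᵥ y := by
  rw [← pairing_equivFun_symm, Matrix.mul_one]

theorem gram_posDef {Y : Matrix (Fin n) (Fin n) ℂ} (hY : Y.PosDef) : (gram b Y).PosDef := by
  refine Matrix.PosDef.of_dotProduct_mulVec_pos ?_ fun x hx => ?_
  · ext i j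
    simp only [gram, Matrix.conjTranspose_apply, Matrix.of_apply, star_trivial]
    rw [pairing_mul_right, hY.1.eq, pairing_comm]
  · rw [star_trivial, ← quad_equivFun_symm]
    exact quad_re_pos hY ((LinearEquiv.map_ne_zero_iff _).2 hx)

/-- Expanding `b j * Y` in the basis separates the lattice from `Y`. Determinants and inverses of
`gram b Y` then follow from those of `gram b 1` and of right multiplication by `Y`. -/
theorem gram_eq_mul [DecidableEq ι] (Y : Matrix (Fin n) (Fin n) ℂ) :
    gram b Y = gram b 1 * LinearMap.toMatrix b b (mulRight Y) := by
  ext i j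
  have h1 : b j * Y = b.equivFun.symm (b.repr (b j * Y)) := by
    rw [Module.Basis.equivFun_symm_apply, Module.Basis.sum_repr]
  have h2 : b i = b.equivFun.symm (Pi.single i 1) := by
    rw [Module.Basis.equivFun_symm_apply]
    simp [Pi.single_apply]
  rw [gram, Matrix.of_apply, h1, h2, pairing_equivFun_symm', single_one_dotProduct, Matrix.mulVec,
    Matrix.mul_apply, dotProduct]
  refine Finset.sum_congr rfl fun k _ => ?_
  rw [LinearMap.toMatrix_apply, mulRight_apply]

theorem det_gram [DecidableEq ι] (Y : Matrix (Fin n) (Fin n) ℂ) :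
    (gram b Y).det = (gram b 1).det * ‖Y.det‖ ^ (2 * r) := by
  rw [gram_eq_mul, Matrix.det_mul, LinearMap.det_toMatrix, det_mulRight]

theorem gram_inv [DecidableEq ι] {Y : Matrix (Fin n) (Fin n) ℂ} (hY : IsUnit Y.det) :
    gram b 1 * (gram b Y)⁻¹ * gram b 1 = gram b Y⁻¹ := by
  have h1 : LinearMap.toMatrix b b (mulRight Y) * LinearMap.toMatrix b b (mulRight Y⁻¹) = 1 := by
    rw [← LinearMap.toMatrix_comp, ← LinearMap.toMatrix_id b]
    congr 1
    ext1 w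
    simp [Matrix.mul_assoc, Matrix.nonsing_inv_mul _ hY]
  have hG : IsUnit (gram b 1).det := isUnit_iff_ne_zero.2 (gram_posDef b Matrix.PosDef.one).det_pos.ne'
  rw [gram_eq_mul b Y, gram_eq_mul b Y⁻¹, Matrix.mul_inv_rev, Matrix.inv_eq_right_inv h1,
    Matrix.mul_assoc, Matrix.nonsing_inv_mul_cancel_right _ _ hG]

variable {b} {L : AddSubgroup (Matrix (Fin r) (Fin n) ℂ)}

/-- The coordinates of a lattice with respect to a basis. -/
def latticeEquiv (hb : ∀ w, w ∈ L ↔ ∀ i, ∃ k : ℤ, b.repr w i = k) : (ι → ℤ) ≃ L where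
  toFun k := ⟨b.equivFun.symm (intVec k), (hb _).2 fun i => ⟨k i, by
    rw [← Module.Basis.equivFun_apply, LinearEquiv.apply_symm_apply]; rfl⟩⟩
  invFun w i := ⌊b.repr w i⌋
  left_inv k := by
    ext i
    change ⌊b.equivFun (b.equivFun.symm (intVec k)) i⌋ = k i
    rw [LinearEquiv.apply_symm_apply]
    simp [intVec]
  right_inv w := by
    apply Subtype.ext
    change b.equivFun.symm (intVec fun i => ⌊b.repr w i⌋) = w
    rw [LinearEquiv.symm_apply_eq]
    ext i
    obtain ⟨k, hk⟩ := (hb w).1 w.2 i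
    simp [intVec, hk]

theorem latticeEquiv_apply (hb : ∀ w, w ∈ L ↔ ∀ i, ∃ k : ℤ, b.repr w i = k) (k : ι → ℤ) :
    (latticeEquiv hb k : Matrix (Fin r) (Fin n) ℂ) = b.equivFun.symm (intVec k) := rfl

/-- The columns of the inverse Gram matrix are the coordinates of the dual basis, which lies in `L`
by self-duality. So the Gram matrix and its inverse are both integral. The determinant is then a
unit of `ℤ`, and positive definiteness excludes `-1`. -/
theorem exists_gram_equiv [DecidableEq ι] (hb : ∀ w, w ∈ L ↔ ∀ i, ∃ k : ℤ, b.repr w i = k)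
    (hL : ∀ y, y ∈ L ↔ ∀ x ∈ L, ∃ k : ℤ, pairing x y = k) :
    (gram b 1).det = 1 ∧ ∃ e : (ι → ℤ) ≃ (ι → ℤ), ∀ k, intVec (e k) = gram b 1 *ᵥ intVec k := by
  have hpd := gram_posDef b (Y := 1) Matrix.PosDef.one
  have hG : IsUnit (gram b 1).det := isUnit_iff_ne_zero.2 hpd.det_pos.ne'
  have hbL : ∀ i, b i ∈ L := fun i => (hb _).2 fun j => by
    rw [Module.Basis.repr_self]
    exact ⟨if i = j then 1 else 0, by rw [Finsupp.single_apply]; split_ifs <;> simp⟩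
  have hint : ∀ i j, ∃ k : ℤ, gram b 1 i j = k := fun i j => by
    obtain ⟨k, hk⟩ := (hL _).1 (hbL j) _ (hbL i)
    exact ⟨k, by rw [← hk, gram, Matrix.of_apply, Matrix.mul_one]⟩
  have hint' : ∀ i j, ∃ k : ℤ, (gram b 1)⁻¹ i j = k := by
    intro i j
    have hmem : b.equivFun.symm (fun i => (gram b 1)⁻¹ i j) ∈ L := by
      rw [hL]
      intro x hx
      have h1 : x = b.equivFun.symm (b.repr x) := by
        rw [Module.Basis.equivFun_symm_apply, Module.Basis.sum_repr]
      have h2 : gram b 1 *ᵥ (fun i => (gram b 1)⁻¹ i j) = Pi.single j 1 := by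
        have h3 : (fun i => (gram b 1)⁻¹ i j) = (gram b 1)⁻¹ *ᵥ Pi.single j 1 := by
          ext i
          simp
        rw [h3, Matrix.mulVec_mulVec, Matrix.mul_nonsing_inv _ hG, Matrix.one_mulVec]
      obtain ⟨k, hk⟩ := (hb x).1 hx j
      refine ⟨k, ?_⟩
      rw [h1, pairing_equivFun_symm', h2, dotProduct_single_one, hk]
    obtain ⟨k, hk⟩ := (hb _).1 hmem i
    rw [← Module.Basis.equivFun_apply, LinearEquiv.apply_symm_apply] at hk
    exact ⟨k, hk⟩
  choose g hg using hint
  choose g' hg' using hint'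
  let gm : Matrix ι ι ℤ := Matrix.of g
  let gm' : Matrix ι ι ℤ := Matrix.of g'
  have hgm : gm.map (Int.castRingHom ℝ) = gram b 1 := by
    ext i j; simp [gm, hg]
  have hgm' : gm'.map (Int.castRingHom ℝ) = (gram b 1)⁻¹ := by
    ext i j; simp [gm', hg']
  have hmul : gm * gm' = 1 := by
    have hinj : Function.Injective fun M : Matrix ι ι ℤ => M.map (Int.castRingHom ℝ) :=
      Matrix.map_injective Int.cast_injective
    apply hinj
    change (gm * gm').map (Int.castRingHom ℝ) = (1 : Matrix ι ι ℤ).map (Int.castRingHom ℝ)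
    rw [Matrix.map_mul, hgm, hgm', Matrix.mul_nonsing_inv _ hG]
    exact (map_one (Int.castRingHom ℝ).mapMatrix).symm
  have hmul' : gm' * gm = 1 := mul_eq_one_comm.1 hmul
  have hdet : (gram b 1).det = gm.det := by
    rw [← hgm]
    exact ((Int.castRingHom ℝ).map_det gm).symm
  have hcast : ∀ (M : Matrix ι ι ℤ) (k : ι → ℤ),
      intVec (M *ᵥ k) = M.map (Int.castRingHom ℝ) *ᵥ intVec k := by
    intro M k
    ext i
    simp [intVec, Matrix.mulVec, dotProduct]
  refine ⟨?_, ⟨fun k => gm *ᵥ k, fun k => gm' *ᵥ k, fun k => ?_, fun k => ?_⟩, fun k => ?_⟩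
  · have h1 : gm.det * gm'.det = 1 := by rw [← Matrix.det_mul, hmul, Matrix.det_one]
    have h2 := hpd.det_pos
    rw [hdet] at h2 ⊢
    have h3 : 0 < gm.det := by exact_mod_cast h2
    rcases Int.isUnit_iff.1 (IsUnit.of_mul_eq_one _ h1) with h | h
    · rw [h]; simp
    · rw [h] at h3; norm_num at h3
  · simp [Matrix.mulVec_mulVec, hmul']
  · simp [Matrix.mulVec_mulVec, hmul]
  · change intVec (gm *ᵥ k) = _
    rw [hcast, hgm]

/-- The general term of the theta series. -/
def thetaExp (Z : Matrix (Fin n) (Fin n) ℂ) (w : Matrix (Fin r) (Fin n) ℂ) : ℂ :=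
  Complex.exp (Complex.I * Real.pi * quad Z w)

/-- The unitary character attached to a matrix. -/
def unitChar (a w : Matrix (Fin r) (Fin n) ℂ) : ℂ :=
  Complex.exp (2 * Real.pi * Complex.I * (pairing a w : ℂ))

/-- Poisson summation for the form of `Y⁻¹` produces its inverse Gram matrix. Reindexing the dual
sum by the unimodular matrix `gram b 1` turns that inverse into the form of `Y` on the same lattice,
by `gram_inv`. -/
theorem theta_inversion_imaginary {L : AddSubgroup (Matrix (Fin r) (Fin n) ℂ)}
    (hL : IsUnimodularLattice L) {Y : Matrix (Fin n) (Fin n) ℂ} (hY : Y.PosDef)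
    (a : Matrix (Fin r) (Fin n) ℂ) :
    ∑' w : L, thetaExp (Complex.I • Y⁻¹) ((w : Matrix (Fin r) (Fin n) ℂ) + a) =
      Y.det ^ r * ∑' w : L, thetaExp (Complex.I • Y) (w : Matrix (Fin r) (Fin n) ℂ) * unitChar a w := by
  obtain ⟨ι, _, _, b, hb⟩ := hL.exists_basis
  obtain ⟨hdet, e, he⟩ := exists_gram_equiv hb hL.mem_iff
  have hterm : ∀ {Y : Matrix (Fin n) (Fin n) ℂ}, Y.PosDef → ∀ w : Matrix (Fin r) (Fin n) ℂ,
      thetaExp (Complex.I • Y) w = (Real.exp (-Real.pi * (quad Y w).re) : ℂ) := by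
    intro Y hY w
    rw [thetaExp, quad_smul_left, quad_eq_ofReal hY.1, Complex.ofReal_exp]
    congr 1
    push_cast
    linear_combination (Real.pi * (quad Y w).re : ℂ) * Complex.I_mul_I
  have hYu : IsUnit Y.det := isUnit_iff_ne_zero.2 hY.det_pos.ne'
  have ha : a = b.equivFun.symm (b.equivFun a) := by simp
  have h1 : ∑' w : L, thetaExp (Complex.I • Y⁻¹) ((w : Matrix (Fin r) (Fin n) ℂ) + a) = ∑' k : ι → ℤ,
      (Real.exp (-Real.pi * ((b.equivFun a + intVec k) ⬝ᵥ gram b Y⁻¹ *ᵥ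
        (b.equivFun a + intVec k))) : ℂ) := by
    rw [← (latticeEquiv hb).tsum_eq]
    congr 1
    ext k
    rw [hterm hY.inv, latticeEquiv_apply, ← quad_equivFun_symm, map_add, ← ha, add_comm]
  have h2 : ∑' w : L, thetaExp (Complex.I • Y) (w : Matrix (Fin r) (Fin n) ℂ) * unitChar a w = ∑' k : ι → ℤ,
      (Real.exp (-Real.pi * (intVec k ⬝ᵥ (gram b Y⁻¹)⁻¹ *ᵥ intVec k)) : ℂ) *
        expChar k (b.equivFun a) := by
    rw [← (latticeEquiv hb).tsum_eq]
    refine Eq.trans ?_ (e.tsum_eq _)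
    refine tsum_congr fun k => ?_
    have hYi : IsUnit Y⁻¹.det := Matrix.isUnit_nonsing_inv_det _ hYu
    have hsym : (gram b 1)ᵀ = gram b 1 := by
      have := (gram_posDef b (Y := 1) Matrix.PosDef.one).1.eq
      rwa [Matrix.conjTranspose_eq_transpose_of_trivial] at this
    congr 1
    · rw [hterm hY, latticeEquiv_apply, quad_equivFun_symm, he]
      have := gram_inv b hYi
      rw [Matrix.nonsing_inv_nonsing_inv _ hYu] at this
      rw [← this, ← Matrix.mulVec_mulVec, ← Matrix.mulVec_mulVec, Matrix.dotProduct_mulVec _ (gram b 1),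
        ← Matrix.mulVec_transpose, hsym]
    · rw [unitChar, expChar]
      congr 2
      rw [latticeEquiv_apply]
      nth_rewrite 1 [ha]
      rw [pairing_equivFun_symm', ← he]
      simp [dotProduct, intVec, mul_comm]
  have hYd : ‖Y⁻¹.det‖ ^ (2 * r) = ((‖Y.det‖ ^ r)⁻¹) ^ 2 := by
    rw [Matrix.det_nonsing_inv, Ring.inverse_eq_inv', norm_inv, ← inv_pow, ← pow_mul, mul_comm]
  rw [h1, h2, tsum_gaussian (gram_posDef b hY.inv), det_gram, hdet, one_mul, hYd,
    Real.sqrt_sq (by positivity), inv_inv]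
  congr 1
  have : Y.det = (‖Y.det‖ : ℂ) := (Complex.eq_coe_norm_of_nonneg hY.det_pos.le)
  rw [this]
  simp

end Unimodular

/-! ## Convergence and holomorphy -/

section Convergence

variable {r n : ℕ}

theorem norm_quad_le {Z : Matrix (Fin n) (Fin n) ℂ} {w : Matrix (Fin r) (Fin n) ℂ} {A B : ℝ}
    (hA : ∀ i j, ‖Z i j‖ ≤ A) (hB : ∀ i j, ‖w i j‖ ≤ B) :
    ‖quad Z w‖ ≤ r * n * n * A * B ^ 2 := by
  rw [quad_eq_sum]
  have h1 : ∀ i : Fin r, ‖w i ⬝ᵥ Z *ᵥ star (w i)‖ ≤ n * n * A * B ^ 2 := by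
    intro i
    simp only [dotProduct, Matrix.mulVec, Finset.mul_sum]
    have h2 : ∀ a c : Fin n, ‖w i a * (Z a c * star (w i) c)‖ ≤ A * B ^ 2 := by
      intro a c
      rw [norm_mul, norm_mul, Pi.star_apply, norm_star]
      have := (norm_nonneg _).trans (hA a c)
      have := (norm_nonneg _).trans (hB i c)
      calc ‖w i a‖ * (‖Z a c‖ * ‖w i c‖) ≤ B * (A * B) := by
            gcongr
            exacts [hB _ _, hA _ _, hB _ _]
        _ = _ := by ring
    calc ‖∑ a, ∑ c, w i a * (Z a c * star (w i) c)‖ ≤ ∑ a : Fin n, ∑ c : Fin n, A * B ^ 2 :=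
          norm_sum_le_of_le _ fun a _ => norm_sum_le_of_le _ fun c _ => h2 a c
      _ = _ := by simp; ring
  calc ‖∑ i, w i ⬝ᵥ Z *ᵥ star (w i)‖ ≤ ∑ i : Fin r, n * n * A * B ^ 2 :=
        norm_sum_le_of_le _ fun i _ => h1 i
    _ = _ := by simp; ring

variable {ι : Type} [Fintype ι] (b : Module.Basis ι ℝ (Matrix (Fin r) (Fin n) ℂ))

theorem exists_norm_quad_le : ∃ C : ℝ, 0 < C ∧ ∀ (Z : Fin n → Fin n → ℂ)
    (w : Matrix (Fin r) (Fin n) ℂ), ‖quad (Matrix.of Z) w‖ ≤ C * ‖Z‖ * ‖b.equivFun w‖ ^ 2 := by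
  let f : Fin r → Fin n → ((ι → ℝ) →L[ℝ] ℂ) := fun i j => LinearMap.toContinuousLinearMap
    { toFun := fun x => b.equivFun.symm x i j
      map_add' := fun x y => by rw [map_add]; rfl
      map_smul' := fun c x => by rw [map_smul]; rfl }
  let K := ∑ i, ∑ j, ‖f i j‖
  have hK : ∀ (w : Matrix (Fin r) (Fin n) ℂ) i j, ‖w i j‖ ≤ K * ‖b.equivFun w‖ := by
    intro w i j
    have h1 : f i j (b.equivFun w) = w i j := by
      change b.equivFun.symm (b.equivFun w) i j = _
      rw [LinearEquiv.symm_apply_apply]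
    rw [← h1]
    refine ((f i j).le_opNorm _).trans ?_
    gcongr
    calc ‖f i j‖ ≤ ∑ j, ‖f i j‖ :=
          Finset.single_le_sum (f := fun j => ‖f i j‖) (fun _ _ => norm_nonneg _) (Finset.mem_univ j)
      _ ≤ _ := Finset.single_le_sum (f := fun i => ∑ j, ‖f i j‖)
          (fun _ _ => Finset.sum_nonneg fun _ _ => norm_nonneg _) (Finset.mem_univ i)
  refine ⟨r * n * n * K ^ 2 + 1, by positivity, fun Z w => ?_⟩
  refine (norm_quad_le (A := ‖Z‖) (fun i j => ?_) (hK w)).trans ?_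
  · exact (norm_le_pi_norm (Z i) j).trans (norm_le_pi_norm Z i)
  · calc r * n * n * ‖Z‖ * (K * ‖b.equivFun w‖) ^ 2
        = (r * n * n * K ^ 2) * ‖Z‖ * ‖b.equivFun w‖ ^ 2 := by ring
      _ ≤ _ := by
        gcongr
        linarith

/-- The bound holds at `Z₀` with constant `c`, and a perturbation of size `c / (2C)` costs at most
half of it. Uniformity in `Z` is what openness of the half space and termwise differentiation rest
on. -/
theorem exists_le_quad_im {Z₀ : Fin n → Fin n → ℂ} (hZ : Matrix.of Z₀ ∈ halfSpace n) :
    ∃ c : ℝ, 0 < c ∧ ∃ ε : ℝ, 0 < ε ∧ ∀ Z ∈ Metric.ball Z₀ ε, ∀ w : Matrix (Fin r) (Fin n) ℂ,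
      c * ‖b.equivFun w‖ ^ 2 ≤ (quad (Matrix.of Z) w).im := by
  obtain ⟨c, hc, hle⟩ := exists_le_dotProduct_mulVec (gram_posDef b (mem_halfSpace_iff.1 hZ))
  obtain ⟨C, hC, hCle⟩ := exists_norm_quad_le b
  refine ⟨c / 2, by positivity, c / (2 * C), by positivity, fun Z hZ w => ?_⟩
  have h1 : c * ‖b.equivFun w‖ ^ 2 ≤ (quad (Matrix.of Z₀) w).im := by
    rw [quad_im]
    have := hle (b.equivFun w)
    rwa [← quad_equivFun_symm, LinearEquiv.symm_apply_apply] at this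
  have h2 : (quad (Matrix.of Z) w).im =
      (quad (Matrix.of Z₀) w).im + (quad (Matrix.of (Z - Z₀)) w).im := by
    rw [← Complex.add_im, ← quad_add_left]
    congr 2
    ext i j
    simp
  have h3 : |(quad (Matrix.of (Z - Z₀)) w).im| ≤ c / 2 * ‖b.equivFun w‖ ^ 2 := by
    refine (Complex.abs_im_le_norm _).trans ((hCle _ _).trans ?_)
    gcongr
    rw [mem_ball_iff_norm] at hZ
    calc C * ‖Z - Z₀‖ ≤ C * (c / (2 * C)) := by gcongr
      _ = c / 2 := by field_simp
  rw [h2]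
  have := (abs_le.1 h3).1
  linarith

/-- Single rows `w = xᴴ` already test positive definiteness. The criterion is real linear in `Z`,
which makes convexity immediate. -/
theorem mem_halfSpace_of_quad {Z : Matrix (Fin n) (Fin n) ℂ}
    (h : ∀ w : Matrix (Fin 1) (Fin n) ℂ, w ≠ 0 → 0 < (quad Z w).im) : Z ∈ halfSpace n := by
  rw [mem_halfSpace_iff]
  have hH : ((1 / (2 * Complex.I)) • (Z - Zᴴ)).IsHermitian := by
    rw [Matrix.IsHermitian, Matrix.conjTranspose_smul, Matrix.conjTranspose_sub,
      Matrix.conjTranspose_conjTranspose, ← neg_sub Z Zᴴ, smul_neg, ← neg_smul]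
    congr 1
    simp
  refine Matrix.PosDef.of_dotProduct_mulVec_pos hH fun x hx => ?_
  let w : Matrix (Fin 1) (Fin n) ℂ := fun _ => star x
  have hw : w ≠ 0 := by
    intro h0
    apply hx
    have h1 : star x = 0 := congrFun h0 0
    simpa using h1
  have h1 : quad ((1 / (2 * Complex.I)) • (Z - Zᴴ)) w =
      star x ⬝ᵥ ((1 / (2 * Complex.I)) • (Z - Zᴴ)) *ᵥ x := by
    rw [quad_eq_sum, Fin.sum_univ_one]
    simp only [w, star_star]
  rw [← h1, quad_eq_ofReal hH, ← quad_im]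
  exact_mod_cast h w hw

theorem quad_im_pos {Z : Matrix (Fin n) (Fin n) ℂ} (hZ : Z ∈ halfSpace n)
    {w : Matrix (Fin r) (Fin n) ℂ} (hw : w ≠ 0) : 0 < (quad Z w).im := by
  rw [quad_im]
  exact quad_re_pos (mem_halfSpace_iff.1 hZ) hw

theorem isOpen_halfSpace : IsOpen {Z : Fin n → Fin n → ℂ | Matrix.of Z ∈ halfSpace n} := by
  rw [Metric.isOpen_iff]
  intro Z hZ
  let b := Module.finBasis ℝ (Matrix (Fin 1) (Fin n) ℂ)
  obtain ⟨c, hc, ε, hε, h⟩ := exists_le_quad_im b hZ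
  refine ⟨ε, hε, fun Z' hZ' => mem_halfSpace_of_quad fun w hw => ?_⟩
  have hw' : b.equivFun w ≠ 0 := (LinearEquiv.map_ne_zero_iff _).2 hw
  refine lt_of_lt_of_le ?_ (h Z' hZ' w)
  have := norm_pos_iff.2 hw'
  positivity

theorem convex_halfSpace : Convex ℝ (halfSpace n) := by
  intro Z hZ Z' hZ' s t hs ht hst
  refine mem_halfSpace_of_quad fun w hw => ?_
  have h1 : quad (s • Z + t • Z') w = s * quad Z w + t * quad Z' w := by
    have : ∀ (s : ℝ) (Z : Matrix (Fin n) (Fin n) ℂ), s • Z = (s : ℂ) • Z := fun s Z => by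
      ext i j; simp
    rw [quad_add_left, this, this, quad_smul_left, quad_smul_left]
  have h2 := quad_im_pos hZ hw
  have h3 := quad_im_pos hZ' hw
  rw [h1, Complex.add_im, Complex.im_ofReal_mul, Complex.im_ofReal_mul]
  rcases hs.lt_or_eq with hs | rfl
  · positivity
  · have : t = 1 := by linarith
    rw [this]
    simpa using h3

theorem norm_thetaExp (Z : Matrix (Fin n) (Fin n) ℂ) (w : Matrix (Fin r) (Fin n) ℂ) :
    ‖thetaExp Z w‖ = Real.exp (-Real.pi * (quad Z w).im) := by
  rw [thetaExp, Complex.norm_exp]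
  congr 1
  simp

theorem summable_exp_neg_shift {c : ℝ} (hc : 0 < c) (x : ι → ℝ) :
    Summable fun k : ι → ℤ => Real.exp (-c * ‖intVec k + x‖ ^ 2) := by
  refine Summable.of_nonneg_of_le (fun _ => (Real.exp_pos _).le) (fun k => ?_)
    ((summable_exp_neg_norm_sq (ι := ι) (half_pos hc)).mul_left (Real.exp (c * ‖x‖ ^ 2)))
  rw [← Real.exp_add, Real.exp_le_exp]
  have h2 : ‖intVec k‖ ≤ ‖intVec k + x‖ + ‖x‖ := by
    calc ‖intVec k‖ = ‖(intVec k + x) - x‖ := by congr 1; abel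
      _ ≤ ‖intVec k + x‖ + ‖x‖ := norm_sub_le _ _
  have h3 : ‖intVec k‖ ^ 2 ≤ 2 * ‖intVec k + x‖ ^ 2 + 2 * ‖x‖ ^ 2 := by
    have := norm_nonneg (intVec k)
    nlinarith [sq_nonneg (‖intVec k + x‖ - ‖x‖)]
  nlinarith

variable {L : AddSubgroup (Matrix (Fin r) (Fin n) ℂ)}

theorem summable_norm_thetaExp (hL : IsUnimodularLattice L) {Z : Matrix (Fin n) (Fin n) ℂ}
    (hZ : Z ∈ halfSpace n) (a : Matrix (Fin r) (Fin n) ℂ) :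
    Summable fun w : L => ‖thetaExp Z ((w : Matrix (Fin r) (Fin n) ℂ) + a)‖ := by
  obtain ⟨ι, _, _, b, hb⟩ := hL.exists_basis
  obtain ⟨c, hc, ε, hε, h⟩ := exists_le_quad_im b (Z₀ := Z) hZ
  rw [← (latticeEquiv hb).summable_iff]
  refine Summable.of_nonneg_of_le (fun _ => norm_nonneg _) (fun k => ?_)
    (summable_exp_neg_shift (mul_pos Real.pi_pos hc) (b.equivFun a))
  simp only [Function.comp_apply, norm_thetaExp, Real.exp_le_exp, latticeEquiv_apply]
  have := h Z (Metric.mem_ball_self hε) (b.equivFun.symm (intVec k) + a)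
  rw [map_add, LinearEquiv.apply_symm_apply] at this
  have h2 : (quad (Matrix.of Z) (b.equivFun.symm (intVec k) + a)) =
    (quad Z (b.equivFun.symm (intVec k) + a)) := rfl
  rw [h2] at this
  nlinarith [Real.pi_pos]

/-- The linear form `Z ↦ iπ tr(wᴴ w Z)`. -/
def quadCLM (w : Matrix (Fin r) (Fin n) ℂ) : (Fin n → Fin n → ℂ) →L[ℂ] ℂ :=
  LinearMap.toContinuousLinearMap
    { toFun := fun Z => Complex.I * Real.pi * quad (Matrix.of Z) w
      map_add' := fun Z Z' => by
        have : Matrix.of (Z + Z') = Matrix.of Z + Matrix.of Z' := rfl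
        rw [this, quad_add_left, mul_add]
      map_smul' := fun c Z => by
        have : Matrix.of (c • Z) = c • Matrix.of Z := rfl
        rw [RingHom.id_apply, smul_eq_mul, this, quad_smul_left]
        ring }

theorem quadCLM_apply (w : Matrix (Fin r) (Fin n) ℂ) (Z : Fin n → Fin n → ℂ) :
    quadCLM w Z = Complex.I * Real.pi * quad (Matrix.of Z) w := rfl

/-- The termwise derivatives have a summable majorant near each point. The translation `a` and the
bounded weight `χ` allow both sides of the inversion formula to be treated at once. -/
theorem differentiableOn_tsum_thetaExp (hL : IsUnimodularLattice L) (a : Matrix (Fin r) (Fin n) ℂ)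
    (χ : L → ℂ) (hχ : ∀ w, ‖χ w‖ ≤ 1) :
    DifferentiableOn ℂ (fun Z : Fin n → Fin n → ℂ =>
      ∑' w : L, thetaExp (Matrix.of Z) ((w : Matrix (Fin r) (Fin n) ℂ) + a) * χ w)
      {Z | Matrix.of Z ∈ halfSpace n} := by
  intro Z₀ hZ₀
  obtain ⟨ι, _, _, b, hb⟩ := hL.exists_basis
  obtain ⟨C, hC, hCle⟩ := exists_norm_quad_le b
  obtain ⟨c, hc, ε, hε, h⟩ := exists_le_quad_im b hZ₀
  have hterm : ∀ (w : L) (Z : Fin n → Fin n → ℂ), HasFDerivAt (fun Z : Fin n → Fin n → ℂ =>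
      thetaExp (Matrix.of Z) ((w : Matrix (Fin r) (Fin n) ℂ) + a) * χ w)
      ((thetaExp (Matrix.of Z) ((w : Matrix (Fin r) (Fin n) ℂ) + a) * χ w) •
        quadCLM ((w : Matrix (Fin r) (Fin n) ℂ) + a)) Z := by
    intro w Z
    have h1 := ((quadCLM ((w : Matrix (Fin r) (Fin n) ℂ) + a)).hasFDerivAt (x := Z)).cexp.mul_const
      (χ w)
    refine h1.congr_fderiv ?_
    rw [smul_smul, mul_comm]
    rfl
  have hbound : ∀ (w : L), ∀ Z ∈ Metric.ball Z₀ ε,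
      ‖(thetaExp (Matrix.of Z) ((w : Matrix (Fin r) (Fin n) ℂ) + a) * χ w) •
        quadCLM ((w : Matrix (Fin r) (Fin n) ℂ) + a)‖ ≤
      2 * C / c * Real.exp (-(Real.pi * c / 2) *
        ‖b.equivFun ((w : Matrix (Fin r) (Fin n) ℂ) + a)‖ ^ 2) := by
    intro w Z hZ
    set v := (w : Matrix (Fin r) (Fin n) ℂ) + a
    have h1 : ‖quadCLM v‖ ≤ Real.pi * C * ‖b.equivFun v‖ ^ 2 := by
      refine ContinuousLinearMap.opNorm_le_bound _ (by positivity) fun Z' => ?_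
      rw [quadCLM_apply, norm_mul, norm_mul, Complex.norm_I, one_mul, Complex.norm_real,
        Real.norm_of_nonneg Real.pi_pos.le]
      calc Real.pi * ‖quad (Matrix.of Z') v‖ ≤ Real.pi * (C * ‖Z'‖ * ‖b.equivFun v‖ ^ 2) := by
            gcongr
            exact hCle _ _
        _ = _ := by ring
    have h2 : ‖thetaExp (Matrix.of Z) v * χ w‖ ≤ Real.exp (-Real.pi * (c * ‖b.equivFun v‖ ^ 2)) := by
      rw [norm_mul, norm_thetaExp]
      calc _ ≤ Real.exp (-Real.pi * (quad (Matrix.of Z) v).im) * 1 := by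
            gcongr
            exact hχ w
        _ ≤ _ := by
            rw [mul_one, Real.exp_le_exp]
            nlinarith [h Z hZ v, Real.pi_pos]
    set N := ‖b.equivFun v‖ ^ 2 with hN
    have hN0 : 0 ≤ N := by positivity
    -- Half of the Gaussian decay absorbs the factor `N` coming from the derivative.
    have h3 : Real.pi * c / 2 * N ≤ Real.exp (Real.pi * c / 2 * N) := by
      linarith [Real.add_one_le_exp (Real.pi * c / 2 * N)]
    rw [norm_smul]
    calc _ ≤ Real.exp (-Real.pi * (c * N)) * (Real.pi * C * N) := by gcongr
      _ = Real.exp (-Real.pi * (c * N)) * (2 * C / c * (Real.pi * c / 2 * N)) := by field_simp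
      _ ≤ Real.exp (-Real.pi * (c * N)) * (2 * C / c * Real.exp (Real.pi * c / 2 * N)) := by gcongr
      _ = 2 * C / c * (Real.exp (-Real.pi * (c * N)) * Real.exp (Real.pi * c / 2 * N)) := by ring
      _ = _ := by
        rw [← Real.exp_add]
        congr 2
        ring
  have hsum : Summable fun w : L => 2 * C / c * Real.exp (-(Real.pi * c / 2) *
        ‖b.equivFun ((w : Matrix (Fin r) (Fin n) ℂ) + a)‖ ^ 2) := by
    refine Summable.mul_left _ ?_
    rw [← (latticeEquiv hb).summable_iff]
    refine (summable_exp_neg_shift (c := Real.pi * c / 2) (by positivity) (b.equivFun a)).congr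
      fun k => ?_
    simp only [Function.comp_apply, latticeEquiv_apply, map_add, LinearEquiv.apply_symm_apply]
  have h0 : Summable fun w : L =>
      thetaExp (Matrix.of Z₀) ((w : Matrix (Fin r) (Fin n) ℂ) + a) * χ w := by
    refine Summable.of_norm_bounded (summable_norm_thetaExp hL hZ₀ a) fun w => ?_
    rw [norm_mul]
    exact mul_le_of_le_one_right (norm_nonneg _) (hχ w)
  exact (hasFDerivAt_tsum_of_isPreconnected hsum Metric.isOpen_ball
    (convex_ball Z₀ ε).isPreconnected (fun w Z _ => hterm w Z) hbound (Metric.mem_ball_self hε) h0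
    (Metric.mem_ball_self hε)).differentiableAt.differentiableWithinAt

/-- The theta series of a lattice of matrices. -/
def theta (L : AddSubgroup (Matrix (Fin r) (Fin n) ℂ)) (Z : Matrix (Fin n) (Fin n) ℂ) : ℂ :=
  ∑' w : L, thetaExp Z (w : Matrix (Fin r) (Fin n) ℂ)

theorem differentiableOn_theta (hL : IsUnimodularLattice L) :
    DifferentiableOn ℂ (theta L) (halfSpace n) := by
  have h := differentiableOn_tsum_thetaExp hL 0 (fun _ => 1) (by simp)
  simp only [add_zero, mul_one] at h
  exact h

end Convergence

/-! ## The inversion formula -/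

section Inversion

variable {r n : ℕ}

theorem differentiableOn_det {k : ℕ} {D : Set ℂ} {M : ℂ → Matrix (Fin k) (Fin k) ℂ}
    (hM : ∀ i j, DifferentiableOn ℂ (fun t => M t i j) D) :
    DifferentiableOn ℂ (fun t => (M t).det) D := by
  simp only [Matrix.det_apply]
  refine DifferentiableOn.fun_sum fun σ _ => ?_
  refine DifferentiableOn.const_smul ?_ _
  exact DifferentiableOn.fun_finsetProd fun i _ => hM _ _

theorem differentiableOn_inv {k : ℕ} {D : Set ℂ} {M : ℂ → Matrix (Fin k) (Fin k) ℂ}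
    (hM : ∀ i j, DifferentiableOn ℂ (fun t => M t i j) D) (hdet : ∀ t ∈ D, (M t).det ≠ 0)
    (i j : Fin k) : DifferentiableOn ℂ (fun t => (M t)⁻¹ i j) D := by
  have h : ∀ t, (M t)⁻¹ i j = (M t).det⁻¹ * (M t).adjugate i j := fun t => by
    rw [Matrix.inv_def, Ring.inverse_eq_inv', Matrix.smul_apply, smul_eq_mul]
  simp only [h, Matrix.adjugate_apply]
  refine ((differentiableOn_det hM).inv hdet).mul (differentiableOn_det fun a c => ?_)
  by_cases hc : a = j
  · subst hc
    simp only [Matrix.updateRow_self]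
    exact differentiableOn_const _
  · simp only [Matrix.updateRow_ne hc]
    exact hM _ _

theorem norm_unitChar (a w : Matrix (Fin r) (Fin n) ℂ) : ‖unitChar a w‖ = 1 := by
  rw [unitChar, Complex.norm_exp]
  simp

/-- With `Z = X + iY`, both sides are holomorphic in `t` at the points `t X + iY` of the half space,
a convex set of parameters. For `t = is` with `s` real the point is `i(Y + sX)`, where the formula
is known. These parameters accumulate at `0`, so the identity theorem reaches `t = 1`. -/
theorem theta_inversion {L : AddSubgroup (Matrix (Fin r) (Fin n) ℂ)}
    (hL : IsUnimodularLattice L) {Z : Matrix (Fin n) (Fin n) ℂ} (hZ : Z ∈ halfSpace n)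
    (a : Matrix (Fin r) (Fin n) ℂ) :
    ∑' w : L, thetaExp (-Z⁻¹) ((w : Matrix (Fin r) (Fin n) ℂ) + a) =
      (-Complex.I • Z).det ^ r *
        ∑' w : L, thetaExp Z (w : Matrix (Fin r) (Fin n) ℂ) * unitChar a w := by
  set X : Matrix (Fin n) (Fin n) ℂ := (1 / 2 : ℂ) • (Z + Zᴴ) with hX
  set Y : Matrix (Fin n) (Fin n) ℂ := (1 / (2 * Complex.I)) • (Z - Zᴴ) with hYdef
  have hY : Y.PosDef := hZ
  have hXH : X.IsHermitian := by
    rw [Matrix.IsHermitian, hX, Matrix.conjTranspose_smul, Matrix.conjTranspose_add,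
      Matrix.conjTranspose_conjTranspose, add_comm]
    simp
  have hXY : X + Complex.I • Y = Z := by
    rw [hX, hYdef, smul_smul]
    have : Complex.I * (1 / (2 * Complex.I)) = 1 / 2 := by field_simp
    rw [this, ← smul_add]
    ext i j
    simp
    ring
  let G : ℂ → Matrix (Fin n) (Fin n) ℂ := fun t => t • X + Complex.I • Y
  let D : Set ℂ := {t | G t ∈ halfSpace n}
  have hentry : ∀ i j, Differentiable ℂ fun t => G t i j := by
    intro i j
    simp only [G, Matrix.add_apply, Matrix.smul_apply, smul_eq_mul]
    fun_prop
  have hGd : Differentiable ℂ (fun t => (fun i j => G t i j : Fin n → Fin n → ℂ)) :=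
    differentiable_pi.2 fun i => differentiable_pi.2 fun j => hentry i j
  have hDo : IsOpen D := isOpen_halfSpace.preimage hGd.continuous
  have hDc : IsPreconnected D := by
    refine Convex.isPreconnected ?_
    intro s hs t ht a b ha hb hab
    have h1 : G (a • s + b • t) = a • G s + b • G t := by
      ext i j
      simp only [G, Matrix.add_apply, Matrix.smul_apply, smul_eq_mul, Complex.real_smul]
      have : (a : ℂ) + b = 1 := by exact_mod_cast hab
      linear_combination -(Complex.I * Y i j) * this
    change G _ ∈ halfSpace n
    rw [h1]
    exact convex_halfSpace hs ht ha hb hab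
  have h0 : (0 : ℂ) ∈ D := by
    change (0 : ℂ) • X + Complex.I • Y ∈ halfSpace n
    rw [zero_smul, zero_add]
    exact smul_I_mem_halfSpace hY
  have h1 : (1 : ℂ) ∈ D := by
    change (1 : ℂ) • X + Complex.I • Y ∈ halfSpace n
    rw [one_smul, hXY]
    exact hZ
  have hdet : ∀ t ∈ D, (G t).det ≠ 0 := fun t ht => (isUnit_det_of_mem_halfSpace ht).ne_zero
  let f : ℂ → ℂ := fun t => ∑' w : L, thetaExp (-(G t)⁻¹) ((w : Matrix (Fin r) (Fin n) ℂ) + a)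
  let g : ℂ → ℂ := fun t => (-Complex.I • G t).det ^ r *
        ∑' w : L, thetaExp (G t) (w : Matrix (Fin r) (Fin n) ℂ) * unitChar a w
  have hf : DifferentiableOn ℂ f D := by
    have h := differentiableOn_tsum_thetaExp hL a (fun _ => 1) (by simp)
    simp only [mul_one] at h
    have hi : DifferentiableOn ℂ (fun t => (fun i j => (-(G t)⁻¹) i j : Fin n → Fin n → ℂ)) D := by
      refine differentiableOn_pi.2 fun i => differentiableOn_pi.2 fun j => ?_
      simp only [Matrix.neg_apply]
      exact (differentiableOn_inv (fun i j => (hentry i j).differentiableOn) hdet i j).neg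
    exact h.comp hi fun t ht => neg_inv_mem_halfSpace ht
  have hg : DifferentiableOn ℂ g D := by
    refine DifferentiableOn.mul (DifferentiableOn.pow (differentiableOn_det fun i j => ?_) r) ?_
    · simp only [Matrix.smul_apply]
      exact ((hentry i j).differentiableOn).fun_const_smul _
    · have h := differentiableOn_tsum_thetaExp hL 0 (fun w => unitChar a w)
        (fun w => (norm_unitChar _ _).le)
      simp only [add_zero] at h
      exact h.comp hGd.differentiableOn fun t ht => ht
  have hfg : ∀ s : ℝ, Complex.I * s ∈ D → f (Complex.I * s) = g (Complex.I * s) := by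
    intro s hs
    have hG : G (Complex.I * s) = Complex.I • (Y + (s : ℂ) • X) := by
      simp only [G]
      rw [smul_add, mul_smul, add_comm]
    have hSH : (Y + (s : ℂ) • X).IsHermitian := by
      rw [Matrix.IsHermitian, Matrix.conjTranspose_add, hY.1.eq, Matrix.conjTranspose_smul, hXH.eq]
      simp
    have hpd : (Y + (s : ℂ) • X).PosDef := by
      have h2 : G (Complex.I * s) ∈ halfSpace n := hs
      rw [hG, mem_halfSpace_iff, Matrix.conjTranspose_smul, hSH.eq, ← sub_smul, smul_smul] at h2
      convert h2
      have : (1 / (2 * Complex.I) * (Complex.I - star Complex.I)) = 1 := by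
        simp
        field_simp
        norm_num
      rw [this, one_smul]
    have hu : IsUnit (Y + (s : ℂ) • X).det := isUnit_iff_ne_zero.2 hpd.det_pos.ne'
    have h3 := theta_inversion_imaginary hL hpd a
    simp only [f, g, hG]
    have e1 : -(Complex.I • (Y + (s : ℂ) • X))⁻¹ = Complex.I • (Y + (s : ℂ) • X)⁻¹ := by
      rw [neg_eq_iff_eq_neg]
      refine Matrix.inv_eq_right_inv ?_
      rw [Matrix.mul_neg, Matrix.smul_mul, Matrix.mul_smul, Matrix.mul_nonsing_inv _ hu, smul_smul,
        Complex.I_mul_I, neg_smul, one_smul, neg_neg]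
    have e2 : -Complex.I • Complex.I • (Y + (s : ℂ) • X) = Y + (s : ℂ) • X := by
      rw [smul_smul]
      simp
    rw [e1, e2, h3]
  have hfreq : ∃ᶠ t in nhdsWithin (0 : ℂ) {0}ᶜ, f t = g t := by
    have ht : Filter.Tendsto (fun s : ℝ => Complex.I * (s : ℂ)) (nhdsWithin 0 {0}ᶜ)
        (nhdsWithin 0 {0}ᶜ) := by
      refine tendsto_nhdsWithin_iff.2 ⟨?_, ?_⟩
      · have : Continuous fun s : ℝ => Complex.I * (s : ℂ) := by fun_prop
        have h := this.tendsto 0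
        simp only [Complex.ofReal_zero, mul_zero] at h
        exact h.mono_left nhdsWithin_le_nhds
      · filter_upwards [self_mem_nhdsWithin] with s hs
        simpa using hs
    have hev : ∀ᶠ s : ℝ in nhdsWithin 0 {0}ᶜ, f (Complex.I * s) = g (Complex.I * s) := by
      have h2 : ∀ᶠ t in nhdsWithin (0 : ℂ) {0}ᶜ, t ∈ D :=
        nhdsWithin_le_nhds (hDo.mem_nhds h0)
      filter_upwards [ht.eventually h2] with s hs using hfg s hs
    exact ht.frequently hev.frequently
  have key := AnalyticOnNhd.eqOn_of_preconnected_of_frequently_eq (hf.analyticOnNhd hDo)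
    (hg.analyticOnNhd hDo) hDc h0 hfreq h1
  have hG1 : G 1 = Z := by
    simp only [G]
    rw [one_smul, hXY]
  simpa only [f, g, hG1] using key

end Inversion

/-! ## The theta series as a sum over lattice tuples -/

section ThetaSeries

variable {m r n : ℕ} {Λ : Submodule (𝓞 (imQuadField m)) (Fin r → ℂ)}

/-- The Gram matrix of a tuple of vectors. -/
def hermGram (L : AddSubgroup (Matrix (Fin r) (Fin n) ℂ)) (w : L) :
    {T : Matrix (Fin n) (Fin n) ℂ // T.PosSemidef} :=
  ⟨(w : Matrix (Fin r) (Fin n) ℂ)ᴴ * (w : Matrix (Fin r) (Fin n) ℂ),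
    Matrix.posSemidef_conjTranspose_mul_self _⟩

/-- The representations of `T` are the lattice points with Gram matrix `T`. -/
def representationsEquiv (T : {T : Matrix (Fin n) (Fin n) ℂ // T.PosSemidef}) :
    {w : tupleLattice Λ n // hermGram (tupleLattice Λ n) w = T} ≃ representations Λ T.1 where
  toFun w := ⟨fun j k => (w.1 : Matrix (Fin r) (Fin n) ℂ) k j, fun i => w.1.2 i, fun i j =>
    congrFun (congrFun (congrArg Subtype.val w.2) i) j⟩
  invFun v := ⟨⟨fun k j => v.1 j k, fun j => v.2.1 j⟩, by
    apply Subtype.ext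
    ext i j
    rw [← v.2.2 i j]
    rfl⟩
  left_inv _ := rfl
  right_inv _ := rfl

theorem thetaExp_eq_hermGram (Z : Matrix (Fin n) (Fin n) ℂ)
    (w : tupleLattice Λ n) : thetaExp Z (w : Matrix (Fin r) (Fin n) ℂ) =
      Complex.exp (Complex.I * Real.pi * ((hermGram _ w).1 * Z).trace) := rfl

/-- The theta series converges absolutely at `Z = i` and its terms are a nonzero constant along the
fibre, so the fibre cannot be infinite. -/
theorem finite_hermGram_fiber (hΛ : IsThetaLattice Λ)
    (T : {T : Matrix (Fin n) (Fin n) ℂ // T.PosSemidef}) :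
    Finite {w : tupleLattice Λ n // hermGram (tupleLattice Λ n) w = T} := by
  by_contra h
  rw [not_finite_iff_infinite] at h
  have h1 := (summable_norm_thetaExp (hΛ.isUnimodularLattice n)
    (smul_I_mem_halfSpace (Matrix.PosDef.one (R := ℂ) (n := Fin n))) 0).subtype
      {w | hermGram (tupleLattice Λ n) w = T}
  have h2 : Summable fun _ : {w : tupleLattice Λ n // hermGram (tupleLattice Λ n) w = T} =>
      ‖Complex.exp (Complex.I * Real.pi *
        (T.1 * (Complex.I • (1 : Matrix (Fin n) (Fin n) ℂ))).trace)‖ := by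
    refine h1.congr fun w => ?_
    simp only [Function.comp_apply, add_zero, thetaExp_eq_hermGram]
    have hw : hermGram (tupleLattice Λ n) w.1 = T := w.2
    rw [hw]
  rw [summable_const_iff, norm_eq_zero] at h2
  exact Complex.exp_ne_zero _ h2

theorem finite_representations (hΛ : IsThetaLattice Λ) (T : Matrix (Fin n) (Fin n) ℂ) :
    (representations Λ T).Finite := by
  by_cases hT : T.PosSemidef
  · have := finite_hermGram_fiber hΛ ⟨T, hT⟩
    exact Finite.of_equiv _ (representationsEquiv ⟨T, hT⟩)
  · have : representations Λ T = ∅ := by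
      rw [Set.eq_empty_iff_forall_notMem]
      intro v hv
      apply hT
      have : T = (Matrix.of fun k j => v j k)ᴴ * (Matrix.of fun k j => v j k) := by
        ext i j
        rw [← hv.2 i j]
        rfl
      rw [this]
      exact Matrix.posSemidef_conjTranspose_mul_self _
    rw [this]
    exact Set.finite_empty

theorem summable_thetaExp {L : AddSubgroup (Matrix (Fin r) (Fin n) ℂ)}
    (hL : IsUnimodularLattice L) {Z : Matrix (Fin n) (Fin n) ℂ} (hZ : Z ∈ halfSpace n) :
    Summable fun w : L => thetaExp Z (w : Matrix (Fin r) (Fin n) ℂ) := by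
  have := (summable_norm_thetaExp hL hZ 0).of_norm
  simpa only [add_zero] using this

theorem hasSum_thetaTerm (hΛ : IsThetaLattice Λ) {Z : Matrix (Fin n) (Fin n) ℂ}
    (hZ : Z ∈ halfSpace n) :
    HasSum (fun T : {T : Matrix (Fin n) (Fin n) ℂ // T.PosSemidef} => thetaTerm Λ Z T)
      (theta (tupleLattice Λ n) Z) := by
  have h1 := (summable_thetaExp (hΛ.isUnimodularLattice n) hZ).hasSum
  rw [← (Equiv.sigmaFiberEquiv (hermGram (tupleLattice Λ n))).hasSum_iff] at h1
  refine h1.sigma fun T => ?_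
  have := finite_hermGram_fiber hΛ T
  have := Fintype.ofFinite {w : tupleLattice Λ n // hermGram (tupleLattice Λ n) w = T}
  have h2 : thetaTerm Λ Z T = ∑ w : {w : tupleLattice Λ n // hermGram (tupleLattice Λ n) w = T},
      thetaExp Z (w.1 : Matrix (Fin r) (Fin n) ℂ) := by
    have : ∀ w : {w : tupleLattice Λ n // hermGram (tupleLattice Λ n) w = T},
        thetaExp Z (w.1 : Matrix (Fin r) (Fin n) ℂ) =
          Complex.exp (Complex.I * Real.pi * (T.1 * Z).trace) := fun w => by
      rw [thetaExp_eq_hermGram, w.2]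
    rw [Finset.sum_congr rfl fun w _ => this w, Finset.sum_const, thetaTerm, nsmul_eq_mul,
      Finset.card_univ, ← Nat.card_eq_fintype_card, Nat.card_congr (representationsEquiv T)]
    rfl
  rw [h2]
  exact hasSum_fintype _

theorem thetaSeries_eq (hΛ : IsThetaLattice Λ) {Z : Matrix (Fin n) (Fin n) ℂ}
    (hZ : Z ∈ halfSpace n) : thetaSeries n Λ Z = theta (tupleLattice Λ n) Z :=
  (hasSum_thetaTerm hΛ hZ).tsum_eq

theorem norm_theta_le {L : AddSubgroup (Matrix (Fin r) (Fin 1) ℂ)} (hL : IsUnimodularLattice L)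
    {Z : Matrix (Fin 1) (Fin 1) ℂ} (hZ1 : ∀ i, 1 ≤ (Z i i).im) :
    ‖theta L Z‖ ≤
      ∑' w : L, ‖thetaExp (Complex.I • 1 : Matrix (Fin 1) (Fin 1) ℂ) (w : Matrix (Fin r) (Fin 1) ℂ)‖ := by
  have hs := summable_norm_thetaExp hL (smul_I_mem_halfSpace (Matrix.PosDef.one (R := ℂ) (n := Fin 1))) 0
  simp only [add_zero] at hs
  refine tsum_of_norm_bounded hs.hasSum fun w => ?_
  rw [norm_thetaExp, norm_thetaExp, Real.exp_le_exp]
  have hZe : Z = Z 0 0 • (1 : Matrix (Fin 1) (Fin 1) ℂ) := by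
    ext i j
    fin_cases i; fin_cases j
    simp
  rw [hZe, quad_smul_left, quad_smul_left, quad_eq_ofReal Matrix.isHermitian_one,
    Complex.im_mul_ofReal, Complex.im_mul_ofReal, Complex.I_im]
  have h0 : 0 ≤ (quad 1 (w : Matrix (Fin r) (Fin 1) ℂ)).re := by
    by_cases hw : (w : Matrix (Fin r) (Fin 1) ℂ) = 0
    · rw [hw]
      simp [quad]
    · exact (quad_re_pos Matrix.PosDef.one hw).le
  have := hZ1 0
  have := mul_le_mul_of_nonneg_right this h0
  nlinarith [Real.pi_pos]

end ThetaSeries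

/-! ## Mean values of periodic functions -/

section Mean

/-- The function `f` factors through a finite quotient, over which its mean value is `c`. -/
def HasMean {A : Type} [AddCommGroup A] (f : A → ℂ) (c : ℂ) : Prop :=
  ∃ (Q : Type) (_ : AddCommGroup Q) (_ : Fintype Q) (π : A →+ Q) (F : Q → ℂ),
    Function.Surjective π ∧ (∀ a, f a = F (π a)) ∧ ∑ q, F q = Fintype.card Q * c

theorem card_mul_sum_comp {R Q : Type} [AddCommGroup R] [AddCommGroup Q] [Fintype R] [Fintype Q]
    (p : R →+ Q) (hp : Function.Surjective p) (F : Q → ℂ) :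
    (Fintype.card Q : ℂ) * ∑ x, F (p x) = Fintype.card R * ∑ q, F q := by
  classical
  set k := (Finset.univ.filter fun x => p x = 0).card with hk
  have hfib : ∀ q, (Finset.univ.filter fun x => p x = q).card = k := fun q =>
    AddMonoidHom.card_fiber_eq_of_mem_range p (hp q) (hp 0)
  have h1 : ∑ x, F (p x) = k * ∑ q, F q := by
    rw [← Finset.sum_fiberwise (s := Finset.univ) (g := p), Finset.mul_sum]
    refine Finset.sum_congr rfl fun q _ => ?_
    rw [Finset.sum_congr rfl fun x hx => by rw [(Finset.mem_filter.1 hx).2], Finset.sum_const, hfib,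
      nsmul_eq_mul]
  have h2 : Fintype.card R = Fintype.card Q * k := by
    rw [← Finset.card_univ, Finset.card_eq_sum_card_fiberwise (f := p) (t := Finset.univ)
      (fun _ _ => Finset.mem_coe.2 (Finset.mem_univ _)), Finset.sum_congr rfl fun q _ => hfib q, Finset.sum_const,
      Finset.card_univ, smul_eq_mul]
  rw [h1, h2]
  push_cast
  ring

variable {A A' B : Type} [AddCommGroup A] [AddCommGroup A'] [AddCommGroup B]

theorem HasMean.comp {f : A → ℂ} {c : ℂ} (h : HasMean f c) {φ : A' →+ A}
    (hφ : Function.Surjective φ) : HasMean (fun a => f (φ a)) c := by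
  obtain ⟨Q, _, _, π, F, hπ, hf, hF⟩ := h
  exact ⟨Q, _, _, π.comp φ, F, hπ.comp hφ, fun a => hf _, hF⟩

/-- Both quotients are images of the image of `A` in their product, and averaging there computes
either mean. Gauss sums taken modulo different sublattices thereby become comparable. -/
theorem HasMean.unique {f : A → ℂ} {c d : ℂ} (hc : HasMean f c) (hd : HasMean f d) : c = d := by
  classical
  obtain ⟨Q, _, _, π, F, hπ, hf, hF⟩ := hc
  obtain ⟨Q', _, _, π', F', hπ', hf', hF'⟩ := hd
  let R : AddSubgroup (Q × Q') := (π.prod π').range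
  let p : R →+ Q := (AddMonoidHom.fst Q Q').comp R.subtype
  let p' : R →+ Q' := (AddMonoidHom.snd Q Q').comp R.subtype
  have hp : Function.Surjective p := fun q => by
    obtain ⟨a, rfl⟩ := hπ q
    exact ⟨⟨(π a, π' a), ⟨a, rfl⟩⟩, rfl⟩
  have hp' : Function.Surjective p' := fun q => by
    obtain ⟨a, rfl⟩ := hπ' q
    exact ⟨⟨(π a, π' a), ⟨a, rfl⟩⟩, rfl⟩
  have hFF : ∀ x, F (p x) = F' (p' x) := by
    rintro ⟨x, a, rfl⟩
    exact (hf a).symm.trans (hf' a)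
  have h1 := card_mul_sum_comp p hp F
  have h2 := card_mul_sum_comp p' hp' F'
  have hQ : (Fintype.card Q : ℂ) ≠ 0 := Nat.cast_ne_zero.2 Fintype.card_ne_zero
  have hQ' : (Fintype.card Q' : ℂ) ≠ 0 := Nat.cast_ne_zero.2 Fintype.card_ne_zero
  have hR : (Fintype.card R : ℂ) ≠ 0 := Nat.cast_ne_zero.2 Fintype.card_ne_zero
  rw [Finset.sum_congr rfl fun x _ => hFF x, hF, mul_left_comm] at h1
  rw [hF', mul_left_comm] at h2
  have h1 := mul_left_cancel₀ hQ h1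
  have h2 := mul_left_cancel₀ hQ' h2
  exact mul_left_cancel₀ hR (h1.symm.trans h2)

theorem HasMean.mul {f : A → ℂ} {g : B → ℂ} {c d : ℂ} (hc : HasMean f c) (hd : HasMean g d) :
    HasMean (fun x : A × B => f x.1 * g x.2) (c * d) := by
  obtain ⟨Q, _, _, π, F, hπ, hf, hF⟩ := hc
  obtain ⟨Q', _, _, π', F', hπ', hf', hF'⟩ := hd
  refine ⟨Q × Q', inferInstance, inferInstance, π.prodMap π', fun q => F q.1 * F' q.2,
    hπ.prodMap hπ', fun a => congrArg₂ (· * ·) (hf a.1) (hf' a.2), ?_⟩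
  rw [Fintype.sum_prod_type, Fintype.card_prod]
  simp only
  rw [← Finset.sum_mul_sum, hF, hF']
  push_cast
  ring

theorem apply_out {H : AddSubgroup A} {f : A → ℂ} (hf : ∀ a, ∀ h ∈ H, f (a + h) = f a) (a : A) :
    f (QuotientAddGroup.mk (s := H) a).out = f a := by
  obtain ⟨h, hh⟩ := QuotientAddGroup.mk_out_eq_add H a
  rw [hh, hf _ _ h.2]

/-- A group is the disjoint union of the cosets of a subgroup. -/
def cosetEquiv (H : AddSubgroup A) : (A ⧸ H) × H ≃ A where
  toFun p := p.1.out + p.2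
  invFun a := (QuotientAddGroup.mk a, ⟨-(QuotientAddGroup.mk (s := H) a).out + a,
    QuotientAddGroup.eq.1 (QuotientAddGroup.out_eq' _)⟩)
  left_inv p := by
    have h : (QuotientAddGroup.mk (s := H) (p.1.out + p.2)) = p.1 := by
      rw [QuotientAddGroup.mk_add_of_mem _ p.2.2, QuotientAddGroup.out_eq']
    refine Prod.ext h (Subtype.ext ?_)
    simp only [h]
    abel
  right_inv a := by
    simp only
    abel

theorem hasMean_of_periodic {H : AddSubgroup A} [Fintype (A ⧸ H)] {f : A → ℂ}
    (hf : ∀ a, ∀ h ∈ H, f (a + h) = f a) {c : ℂ}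
    (hc : ∑ q : A ⧸ H, f q.out = Fintype.card (A ⧸ H) * c) : HasMean f c :=
  ⟨A ⧸ H, _, _, QuotientAddGroup.mk' H, fun q => f q.out, QuotientAddGroup.mk'_surjective H,
    fun a => (apply_out hf a).symm, hc⟩

theorem exists_hasMean_of_periodic {H : AddSubgroup A} [Finite (A ⧸ H)] {f : A → ℂ}
    (hf : ∀ a, ∀ h ∈ H, f (a + h) = f a) : ∃ c, HasMean f c := by
  have := Fintype.ofFinite (A ⧸ H)
  have hQ : (Fintype.card (A ⧸ H) : ℂ) ≠ 0 := Nat.cast_ne_zero.2 Fintype.card_ne_zero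
  exact ⟨(∑ q : A ⧸ H, f q.out) / Fintype.card (A ⧸ H), hasMean_of_periodic hf (by field_simp)⟩

theorem sum_out_add {H : AddSubgroup A} [Fintype (A ⧸ H)] {f : A → ℂ}
    (hf : ∀ a, ∀ h ∈ H, f (a + h) = f a) (b : A) :
    ∑ q : A ⧸ H, f (q.out + b) = ∑ q : A ⧸ H, f q.out := by
  refine Eq.trans ?_ (Equiv.sum_comp (Equiv.addRight (QuotientAddGroup.mk (s := H) b)) _)
  refine Finset.sum_congr rfl fun q _ => ?_
  rw [← apply_out hf]
  congr 2
  simp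

theorem hasMean_const (c : ℂ) : HasMean (fun _ : A => c) c :=
  ⟨Unit, inferInstance, inferInstance, 0, fun _ => c, fun _ => ⟨0, rfl⟩, fun _ => rfl, by simp⟩

end Mean

/-! ## Sublattices -/

section Index

variable {m r n : ℕ} {Λ : Submodule (𝓞 (imQuadField m)) (Fin r → ℂ)}

theorem mul_apply_mem_intRing {j k l : ℕ} {U : Matrix (Fin j) (Fin k) ℂ}
    {V : Matrix (Fin k) (Fin l) ℂ} (hU : ∀ a b, U a b ∈ intRing (imQuadField m))
    (hV : ∀ a b, V a b ∈ intRing (imQuadField m)) (a : Fin j) (b : Fin l) :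
    (U * V) a b ∈ intRing (imQuadField m) := by
  rw [Matrix.mul_apply]
  exact Subring.sum_mem _ fun k _ => Subring.mul_mem _ (hU a k) (hV k b)

/-- Right multiplication of a lattice tuple by an integral matrix. -/
def latticeMul (Λ : Submodule (𝓞 (imQuadField m)) (Fin r → ℂ)) {k : ℕ}
    (U : Matrix (Fin n) (Fin k) ℂ) (hU : ∀ i j, U i j ∈ intRing (imQuadField m)) :
    tupleLattice Λ n →+ tupleLattice Λ k where
  toFun w := ⟨(w : Matrix (Fin r) (Fin n) ℂ) * U, mul_mem_tupleLattice w.2 hU⟩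
  map_zero' := Subtype.ext (Matrix.zero_mul U)
  map_add' v w := Subtype.ext (Matrix.add_mul v.1 w.1 U)

theorem coe_latticeMul {k : ℕ} (U : Matrix (Fin n) (Fin k) ℂ)
    (hU : ∀ i j, U i j ∈ intRing (imQuadField m)) (w : tupleLattice Λ n) :
    (latticeMul Λ U hU w : Matrix (Fin r) (Fin k) ℂ) = (w : Matrix (Fin r) (Fin n) ℂ) * U := rfl

variable {U : Matrix (Fin n) (Fin n) ℂ} (hU : ∀ i j, U i j ∈ intRing (imQuadField m))

theorem latticeMul_injective (hdet : IsUnit U.det) :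
    Function.Injective (latticeMul (r := r) Λ U hU) := by
  intro v w h
  have h1 : (v : Matrix (Fin r) (Fin n) ℂ) * U = (w : Matrix (Fin r) (Fin n) ℂ) * U := congrArg Subtype.val h
  apply Subtype.ext
  rw [← Matrix.mul_nonsing_inv_cancel_right U v.1 hdet, h1,
    Matrix.mul_nonsing_inv_cancel_right U w.1 hdet]

/-- The index of the image is the absolute value of the determinant over `ℤ`, which can be computed
over `ℝ` by `det_mulRight`. -/
theorem card_quotient_latticeMul (hΛ : IsThetaLattice Λ) (hdet : IsUnit U.det) :
    (Nat.card (tupleLattice Λ n ⧸ (latticeMul Λ U hU).range) : ℝ) = ‖U.det‖ ^ (2 * r) := by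
  obtain ⟨ι, _, _, b, hb⟩ := (hΛ.isUnimodularLattice n).exists_basis
  let e0 : (ι → ℤ) ≃+ tupleLattice Λ n := AddEquiv.mk' (latticeEquiv hb) fun k l => by
    apply Subtype.ext
    rw [latticeEquiv_apply, intVec_add, map_add]
    rfl
  have he0 : ∀ w : tupleLattice Λ n, b.equivFun w = intVec (e0.symm w) := by
    intro w
    obtain ⟨k, rfl⟩ := e0.surjective w
    rw [AddEquiv.symm_apply_apply]
    change b.equivFun (b.equivFun.symm (intVec k)) = _
    rw [LinearEquiv.apply_symm_apply]
  let bZ : Module.Basis ι ℤ (tupleLattice Λ n) := Module.Basis.ofEquivFun e0.symm.toIntLinearEquiv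
  have hrepr : ∀ w i, (bZ.repr w i : ℝ) = b.repr w i := by
    intro w i
    have := congrFun (he0 w) i
    rw [Module.Basis.equivFun_apply] at this
    rw [this]
    rfl
  have hbZ : ∀ j, (bZ j : Matrix (Fin r) (Fin n) ℂ) = b j := by
    intro j
    apply b.equivFun.injective
    ext i
    rw [Module.Basis.equivFun_apply, Module.Basis.equivFun_apply, ← hrepr, Module.Basis.repr_self,
      Module.Basis.repr_self, Finsupp.single_apply, Finsupp.single_apply]
    split_ifs <;> simp
  have : Module.Free ℤ (tupleLattice Λ n) := Module.Free.of_basis bZ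
  have : Module.Finite ℤ (tupleLattice Λ n) := Module.Finite.of_basis bZ
  have h1 : Int.natAbs (LinearMap.det (latticeMul Λ U hU).toIntLinearMap) =
      Nat.card (tupleLattice Λ n ⧸ (latticeMul Λ U hU).range) :=
    Submodule.natAbs_det_equiv (latticeMul Λ U hU).range.toIntSubmodule
      (AddMonoidHom.ofInjective (latticeMul_injective hU hdet))
  have h2 : ((LinearMap.det (latticeMul Λ U hU).toIntLinearMap : ℤ) : ℝ) =
      LinearMap.det (mulRight (r := r) U) := by
    rw [← LinearMap.det_toMatrix bZ, ← LinearMap.det_toMatrix b]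
    refine ((Int.castRingHom ℝ).map_det _).trans ?_
    congr 1
    ext i j
    rw [RingHom.mapMatrix_apply, Matrix.map_apply, LinearMap.toMatrix_apply,
      LinearMap.toMatrix_apply, mulRight_apply, ← hbZ]
    exact hrepr _ _
  rw [← h1, Nat.cast_natAbs, Int.cast_abs, h2, det_mulRight, abs_of_nonneg (by positivity)]

theorem finite_quotient_latticeMul (hΛ : IsThetaLattice Λ) (hdet : IsUnit U.det) :
    Finite (tupleLattice Λ n ⧸ (latticeMul Λ U hU).range) := by
  refine Nat.finite_of_card_ne_zero fun h => ?_
  have h1 := card_quotient_latticeMul hU hΛ hdet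
  rw [h, Nat.cast_zero] at h1
  have h2 : 0 < ‖U.det‖ ^ (2 * r) := by
    have := norm_pos_iff.2 hdet.ne_zero
    positivity
  linarith

end Index

/-! ## The transformation formula with a Gauss sum -/

section Gauss

variable {r n : ℕ}

theorem thetaExp_eq_one {Z : Matrix (Fin n) (Fin n) ℂ} {w : Matrix (Fin r) (Fin n) ℂ}
    (h : ∃ k : ℤ, quad Z w = 2 * k) : thetaExp Z w = 1 := by
  obtain ⟨k, hk⟩ := h
  rw [thetaExp, hk, Complex.exp_eq_one_iff]
  exact ⟨k, by ring⟩

theorem unitChar_eq_one {a w : Matrix (Fin r) (Fin n) ℂ}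
    (h : ∃ k : ℤ, pairing a w = k) : unitChar a w = 1 := by
  obtain ⟨k, hk⟩ := h
  rw [unitChar, hk, Complex.exp_eq_one_iff]
  exact ⟨k, by push_cast; ring⟩

theorem unitChar_eq_one_iff {a w : Matrix (Fin r) (Fin n) ℂ} :
    unitChar a w = 1 ↔ ∃ k : ℤ, pairing a w = k := by
  refine ⟨fun h => ?_, unitChar_eq_one⟩
  rw [unitChar, Complex.exp_eq_one_iff] at h
  obtain ⟨k, hk⟩ := h
  refine ⟨k, ?_⟩
  have h1 : (2 * Real.pi * Complex.I : ℂ) ≠ 0 := Complex.two_pi_I_ne_zero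
  rw [mul_comm (k : ℂ)] at hk
  exact_mod_cast mul_left_cancel₀ h1 hk

theorem thetaExp_mul (Z : Matrix (Fin n) (Fin n) ℂ) {k : ℕ} (w : Matrix (Fin r) (Fin k) ℂ)
    (U : Matrix (Fin k) (Fin n) ℂ) : thetaExp Z (w * U) = thetaExp (U * Z * Uᴴ) w := by
  rw [thetaExp, thetaExp, quad_mul]

theorem thetaExp_add_left (Z Z' : Matrix (Fin n) (Fin n) ℂ) (w : Matrix (Fin r) (Fin n) ℂ) :
    thetaExp (Z + Z') w = thetaExp Z w * thetaExp Z' w := by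
  rw [thetaExp, thetaExp, thetaExp, quad_add_left, mul_add, Complex.exp_add]

theorem thetaExp_add {S : Matrix (Fin n) (Fin n) ℂ} (hS : S.IsHermitian)
    (v w : Matrix (Fin r) (Fin n) ℂ) :
    thetaExp S (v + w) = thetaExp S v * thetaExp S w * unitChar v (w * S) := by
  rw [thetaExp, thetaExp, thetaExp, unitChar, quad_add hS, ← Complex.exp_add, ← Complex.exp_add]
  congr 1
  ring

theorem unitChar_add_left (a b w : Matrix (Fin r) (Fin n) ℂ) :
    unitChar (a + b) w = unitChar a w * unitChar b w := by
  rw [unitChar, unitChar, unitChar, pairing_add_left, ← Complex.exp_add]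
  congr 1
  push_cast
  ring

theorem unitChar_add_right (a w x : Matrix (Fin r) (Fin n) ℂ) :
    unitChar a (w + x) = unitChar a w * unitChar a x := by
  rw [unitChar, unitChar, unitChar, pairing_add_right, ← Complex.exp_add]
  congr 1
  push_cast
  ring

variable {m : ℕ} {Λ : Submodule (𝓞 (imQuadField m)) (Fin r → ℂ)}

/-- The function whose Gauss sums are studied. -/
def gaussExp (Λ : Submodule (𝓞 (imQuadField m)) (Fin r → ℂ)) (S : Matrix (Fin n) (Fin n) ℂ)
    (w : tupleLattice Λ n) : ℂ :=
  thetaExp S (w : Matrix (Fin r) (Fin n) ℂ)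

variable {A B C D : Matrix (Fin n) (Fin n) ℂ}

/-- The cross term depends on `w S` only modulo the lattice, because the lattice pairs integrally
with itself. -/
theorem gaussExp_add (hΛ : IsThetaLattice Λ) {S : Matrix (Fin n) (Fin n) ℂ} (hS : S.IsHermitian)
    (v w : tupleLattice Λ n) {x : Matrix (Fin r) (Fin n) ℂ} (y : tupleLattice Λ n)
    (hx : (w : Matrix (Fin r) (Fin n) ℂ) * S = x + (y : Matrix (Fin r) (Fin n) ℂ)) :
    gaussExp Λ S (v + w) = gaussExp Λ S v * gaussExp Λ S w *
      unitChar (v : Matrix (Fin r) (Fin n) ℂ) x := by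
  have h1 := thetaExp_add hS (v : Matrix (Fin r) (Fin n) ℂ) w
  rw [hx, unitChar_add_right, unitChar_eq_one (exists_int_pairing hΛ v.2 y.2), mul_one] at h1
  exact h1

/-- For `w = u Dᴴ` and `S = B D⁻¹`, the product `w S = u Bᴴ` lies in the lattice, and the quadratic
term of `w` is that of the integral Hermitian matrix `Dᴴ B` at `u`. -/
theorem gaussExp_periodic (hΛ : IsThetaLattice Λ)
    (hM : Matrix.fromBlocks A B C D ∈ modularGroup (imQuadField m) n) (hD : IsUnit D.det)
    (hU : ∀ i j, Dᴴ i j ∈ intRing (imQuadField m)) :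
    ∀ v : tupleLattice Λ n, ∀ w ∈ (latticeMul Λ Dᴴ hU).range,
      gaussExp Λ (B * D⁻¹) (v + w) = gaussExp Λ (B * D⁻¹) v := by
  rintro v _ ⟨u, rfl⟩
  obtain ⟨hSU, hint⟩ := hM
  obtain ⟨h1, h2, h3⟩ := mem_SU_fromBlocks hSU
  have hB : ∀ i j, B i j ∈ intRing (imQuadField m) := fun i j => hint (Sum.inl i) (Sum.inr j)
  have hD' : ∀ i j, D i j ∈ intRing (imQuadField m) := fun i j => hint (Sum.inr i) (Sum.inr j)
  have hBH : ∀ i j, Bᴴ i j ∈ intRing (imQuadField m) := fun i j => star_mem_intRing (hB j i)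
  have hDB : ∀ i j, (Dᴴ * B) i j ∈ intRing (imQuadField m) := mul_apply_mem_intRing hU hB
  have hDBH : (Dᴴ * B).IsHermitian := by
    rw [Matrix.IsHermitian, Matrix.conjTranspose_mul, Matrix.conjTranspose_conjTranspose, h2]
  have e1 : (u : Matrix (Fin r) (Fin n) ℂ) * Dᴴ * (B * D⁻¹) = 
      0 + (latticeMul Λ Bᴴ hBH u : Matrix (Fin r) (Fin n) ℂ) := by
    rw [zero_add, Matrix.mul_assoc, ← Matrix.mul_assoc Dᴴ, h2,
      Matrix.mul_nonsing_inv_cancel_right _ _ hD, coe_latticeMul]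
  rw [gaussExp_add hΛ (isHermitian_mul_inv hSU hD) _ _ _ e1]
  have e2 : gaussExp Λ (B * D⁻¹) (latticeMul Λ Dᴴ hU u) = 1 := by
    rw [gaussExp, coe_latticeMul, thetaExp_mul, Matrix.conjTranspose_conjTranspose,
      Matrix.mul_assoc, Matrix.nonsing_inv_mul_cancel_right _ _ hD]
    exact thetaExp_eq_one (exists_int_quad hΛ hDBH hDB u.2)
  rw [e2, mul_one, unitChar_eq_one ⟨0, by simp [pairing]⟩, mul_one]

theorem moebius_mem_halfSpace (hSU : Matrix.fromBlocks A B C D ∈ SU n) (hD : IsUnit D.det)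
    {Z : Matrix (Fin n) (Fin n) ℂ} (hZ : Z ∈ halfSpace n) :
    moebius (Matrix.fromBlocks A B C D) Z ∈ halfSpace n := by
  obtain ⟨W, hW, -, -, hmoe⟩ := exists_moebius_eq hSU hD hZ
  have hDH : IsUnit Dᴴ.det := by
    rw [Matrix.det_conjTranspose]
    exact hD.star
  rw [hmoe]
  refine add_mem_halfSpace ?_ (isHermitian_mul_inv hSU hD)
  have := conj_mem_halfSpace hW (U := Dᴴ⁻¹) (Matrix.isUnit_nonsing_inv_det _ hDH)
  rwa [Matrix.conjTranspose_nonsing_inv, Matrix.conjTranspose_conjTranspose] at this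

/-- On a coset of `L Dᴴ` the translation part `B D⁻¹` is a constant factor, and the rest is a
translated theta series at `W`, to which the inversion formula applies. The dual sums recombine into
one Gauss sum times the series at `-Z⁻¹`, and a second inversion returns to `Z`. -/
theorem theta_moebius (hΛ : IsThetaLattice Λ)
    (hM : Matrix.fromBlocks A B C D ∈ modularGroup (imQuadField m) n) (hD : IsUnit D.det)
    (hU : ∀ i j, Dᴴ i j ∈ intRing (imQuadField m))
    [Fintype (tupleLattice Λ n ⧸ (latticeMul Λ Dᴴ hU).range)]
    {Z : Matrix (Fin n) (Fin n) ℂ} (hZ : Z ∈ halfSpace n) :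
    D.det ^ r * theta (tupleLattice Λ n) (moebius (Matrix.fromBlocks A B C D) Z) =
      (∑ q : tupleLattice Λ n ⧸ (latticeMul Λ Dᴴ hU).range, gaussExp Λ (B * D⁻¹) q.out) *
        ((denom (Matrix.fromBlocks A B C D) Z).det ^ r * theta (tupleLattice Λ n) Z) := by
  have hper := gaussExp_periodic hΛ hM hD hU
  obtain ⟨hSU, hint⟩ := hM
  obtain ⟨h1, h2, h3⟩ := mem_SU_fromBlocks hSU
  have hL := hΛ.isUnimodularLattice n
  have hAH : ∀ i j, Aᴴ i j ∈ intRing (imQuadField m) := fun i j =>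
    star_mem_intRing (hint (Sum.inl j) (Sum.inl i))
  have hC : ∀ i j, C i j ∈ intRing (imQuadField m) := fun i j => hint (Sum.inr i) (Sum.inl j)
  have hCH : ∀ i j, Cᴴ i j ∈ intRing (imQuadField m) := fun i j => star_mem_intRing (hC j i)
  obtain ⟨W, hW, hWinv, hden, hmoe⟩ := exists_moebius_eq hSU hD hZ
  have hDH : IsUnit Dᴴ.det := by
    rw [Matrix.det_conjTranspose]
    exact hD.star
  set S := B * D⁻¹ with hS
  have hSH : S.IsHermitian := isHermitian_mul_inv hSU hD
  set W' := -W⁻¹ with hW'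
  have hW'm : W' ∈ halfSpace n := neg_inv_mem_halfSpace hW
  have hWu := isUnit_det_of_mem_halfSpace hW
  have hWW : -W'⁻¹ = W := by
    rw [hW']
    rw [neg_eq_iff_eq_neg]
    exact Matrix.inv_eq_right_inv (by
      rw [Matrix.neg_mul, Matrix.mul_neg, neg_neg, Matrix.nonsing_inv_mul _ hWu])
  let H := (latticeMul Λ Dᴴ hU).range
  let eH : tupleLattice Λ n ≃ H :=
    (AddMonoidHom.ofInjective (latticeMul_injective hU hDH)).toEquiv
  have hmoeH := moebius_mem_halfSpace hSU hD hZ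
  have hsplit : theta (tupleLattice Λ n) (moebius (Matrix.fromBlocks A B C D) Z) =
      ∑ q : tupleLattice Λ n ⧸ H, gaussExp Λ S q.out * ∑' u : tupleLattice Λ n,
        thetaExp W ((u : Matrix (Fin r) (Fin n) ℂ) +
          (q.out : Matrix (Fin r) (Fin n) ℂ) * Dᴴ⁻¹) := by
    have hs := summable_thetaExp hL hmoeH
    let e : (tupleLattice Λ n ⧸ H) × tupleLattice Λ n ≃ tupleLattice Λ n :=
      (Equiv.prodCongr (Equiv.refl _) eH).trans
        (cosetEquiv H)
    have he : ∀ q u, e (q, u) = q.out + latticeMul Λ Dᴴ hU u := fun q u => rfl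
    rw [theta, ← e.tsum_eq]
    refine (Summable.tsum_prod (e.summable_iff.2 hs)).trans ?_
    rw [tsum_fintype]
    refine Finset.sum_congr rfl fun q _ => ?_
    rw [← tsum_mul_left]
    refine tsum_congr fun u => ?_
    rw [Function.comp_apply, he, hmoe, thetaExp_add_left, mul_comm]
    congr 1
    · exact hper q.out _ ⟨u, rfl⟩
    · have : Dᴴ⁻¹ * W * D⁻¹ = Dᴴ⁻¹ * W * (Dᴴ⁻¹)ᴴ := by
        rw [Matrix.conjTranspose_nonsing_inv, Matrix.conjTranspose_conjTranspose]
      rw [this, ← thetaExp_mul]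
      congr 1
      have h4 : ((q.out + latticeMul Λ Dᴴ hU u : tupleLattice Λ n) : Matrix (Fin r) (Fin n) ℂ) =
        (q.out : Matrix (Fin r) (Fin n) ℂ) + (u : Matrix (Fin r) (Fin n) ℂ) * Dᴴ := rfl
      rw [h4, Matrix.add_mul, Matrix.mul_nonsing_inv_cancel_right _ _ hDH, add_comm]
  -- Completing the square: the shift of the summation variable by `-w Cᴴ` creates the character
  -- twist. Its own quadratic term agrees with that of `-D⁻¹C` up to the integral Hermitian matrix
  -- `Aᴴ C`.
  have hsquare : ∀ w : tupleLattice Λ n, thetaExp (-(D⁻¹ * C)) (w : Matrix (Fin r) (Fin n) ℂ) *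
      ∑ q : tupleLattice Λ n ⧸ H, gaussExp Λ S q.out *
        unitChar ((q.out : Matrix (Fin r) (Fin n) ℂ) * Dᴴ⁻¹) (w : Matrix (Fin r) (Fin n) ℂ) =
      ∑ q : tupleLattice Λ n ⧸ H, gaussExp Λ S q.out := by
    intro w
    rw [← sum_out_add hper (-latticeMul Λ Cᴴ hCH w), Finset.mul_sum]
    refine Finset.sum_congr rfl fun q _ => ?_
    have e1 : ((-latticeMul Λ Cᴴ hCH w : tupleLattice Λ n) : Matrix (Fin r) (Fin n) ℂ) * S =
        (w : Matrix (Fin r) (Fin n) ℂ) * D⁻¹ +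
          ((-latticeMul Λ Aᴴ hAH w : tupleLattice Λ n) : Matrix (Fin r) (Fin n) ℂ) := by
      change (-((w : Matrix (Fin r) (Fin n) ℂ) * Cᴴ)) * S = (w : Matrix (Fin r) (Fin n) ℂ) * D⁻¹ +
        -((w : Matrix (Fin r) (Fin n) ℂ) * Aᴴ)
      have : D⁻¹ = Aᴴ - Cᴴ * S := by
        rw [hS, ← Matrix.mul_assoc]
        nth_rewrite 1 [← Matrix.mul_nonsing_inv_cancel_right D Aᴴ hD]
        rw [← Matrix.sub_mul, h1, Matrix.one_mul]
      rw [this, Matrix.mul_sub, Matrix.neg_mul, Matrix.mul_assoc]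
      abel
    rw [gaussExp_add hΛ hSH _ _ _ e1]
    have e2 : gaussExp Λ S (-latticeMul Λ Cᴴ hCH w) =
        thetaExp (-(D⁻¹ * C)) (w : Matrix (Fin r) (Fin n) ℂ) := by
      have e3 : gaussExp Λ S (-latticeMul Λ Cᴴ hCH w) =
          thetaExp (Cᴴ * S * C) (w : Matrix (Fin r) (Fin n) ℂ) := by
        change thetaExp S (-((w : Matrix (Fin r) (Fin n) ℂ) * Cᴴ)) = _
        have : thetaExp S (-((w : Matrix (Fin r) (Fin n) ℂ) * Cᴴ)) =
            thetaExp S ((w : Matrix (Fin r) (Fin n) ℂ) * Cᴴ) := by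
          rw [thetaExp, quad_neg, thetaExp]
        rw [this, thetaExp_mul, Matrix.conjTranspose_conjTranspose]
      have e4 : Cᴴ * S * C = Aᴴ * C + -(D⁻¹ * C) := by
        have : Cᴴ * S = Aᴴ - D⁻¹ := by
          rw [hS, ← Matrix.mul_assoc]
          nth_rewrite 1 [← Matrix.mul_nonsing_inv_cancel_right D Aᴴ hD]
          have : Cᴴ * B = Aᴴ * D - 1 := by rw [← h1]; abel
          rw [this, Matrix.sub_mul, Matrix.one_mul]
        rw [this, Matrix.sub_mul, sub_eq_add_neg]
      have hACH : (Aᴴ * C).IsHermitian := by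
        rw [Matrix.IsHermitian, Matrix.conjTranspose_mul, Matrix.conjTranspose_conjTranspose, h3]
      rw [e3, e4, thetaExp_add_left,
        thetaExp_eq_one (exists_int_quad hΛ hACH (mul_apply_mem_intRing hAH hC) w.2), one_mul]
    have e5 : unitChar ((q.out : Matrix (Fin r) (Fin n) ℂ) * Dᴴ⁻¹) (w : Matrix (Fin r) (Fin n) ℂ) =
        unitChar (q.out : Matrix (Fin r) (Fin n) ℂ) ((w : Matrix (Fin r) (Fin n) ℂ) * D⁻¹) := by
      rw [unitChar, unitChar, pairing_mul_right, Matrix.conjTranspose_nonsing_inv]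
    rw [e2, e5]
    ring
  have hsW : ∀ a : Matrix (Fin r) (Fin n) ℂ, Summable fun w : tupleLattice Λ n =>
      thetaExp W' (w : Matrix (Fin r) (Fin n) ℂ) * unitChar a (w : Matrix (Fin r) (Fin n) ℂ) := by
    intro a
    refine Summable.of_norm ?_
    simp only [norm_mul, norm_unitChar, mul_one]
    exact (summable_thetaExp hL hW'm).norm
  have hmain : theta (tupleLattice Λ n) (moebius (Matrix.fromBlocks A B C D) Z) =
      (-Complex.I • W').det ^ r * ((∑ q : tupleLattice Λ n ⧸ H, gaussExp Λ S q.out) *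
        ∑' w : tupleLattice Λ n, thetaExp (-Z⁻¹) (w : Matrix (Fin r) (Fin n) ℂ)) := by
    have hinv : ∀ a : Matrix (Fin r) (Fin n) ℂ, ∑' u : tupleLattice Λ n,
        thetaExp W ((u : Matrix (Fin r) (Fin n) ℂ) + a) = (-Complex.I • W').det ^ r *
          ∑' w : tupleLattice Λ n, thetaExp W' (w : Matrix (Fin r) (Fin n) ℂ) *
            unitChar a (w : Matrix (Fin r) (Fin n) ℂ) := by
      intro a
      rw [← theta_inversion hL hW'm, hWW]
    rw [hsplit]
    simp only [hinv]
    rw [← tsum_mul_left (a := ∑ q : tupleLattice Λ n ⧸ H, gaussExp Λ S q.out)]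
    have h5 : ∀ q : tupleLattice Λ n ⧸ H, gaussExp Λ S q.out * ((-Complex.I • W').det ^ r *
        ∑' w : tupleLattice Λ n, thetaExp W' (w : Matrix (Fin r) (Fin n) ℂ) *
          unitChar ((q.out : Matrix (Fin r) (Fin n) ℂ) * Dᴴ⁻¹) (w : Matrix (Fin r) (Fin n) ℂ)) =
        (-Complex.I • W').det ^ r * ∑' w : tupleLattice Λ n, gaussExp Λ S q.out *
          (thetaExp W' (w : Matrix (Fin r) (Fin n) ℂ) *
          unitChar ((q.out : Matrix (Fin r) (Fin n) ℂ) * Dᴴ⁻¹) (w : Matrix (Fin r) (Fin n) ℂ)) := by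
      intro q
      rw [tsum_mul_left]
      ring
    rw [Finset.sum_congr rfl fun q _ => h5 q, ← Finset.mul_sum,
      ← Summable.tsum_finsetSum fun q _ => (hsW _).mul_left _]
    congr 1
    refine tsum_congr fun w => ?_
    rw [← hsquare w]
    have : thetaExp W' (w : Matrix (Fin r) (Fin n) ℂ) =
        thetaExp (-Z⁻¹) (w : Matrix (Fin r) (Fin n) ℂ) *
          thetaExp (-(D⁻¹ * C)) (w : Matrix (Fin r) (Fin n) ℂ) := by
      rw [hWinv, sub_eq_add_neg, thetaExp_add_left]
    rw [this, Finset.mul_sum, Finset.sum_mul]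
    refine Finset.sum_congr rfl fun q _ => ?_
    ring
  have hZinv : ∑' w : tupleLattice Λ n, thetaExp (-Z⁻¹) (w : Matrix (Fin r) (Fin n) ℂ) =
      (-Complex.I • Z).det ^ r * theta (tupleLattice Λ n) Z := by
    have := theta_inversion hL hZ 0
    simp only [add_zero] at this
    rw [this]
    congr 1
    refine tsum_congr fun w => ?_
    rw [unitChar_eq_one ⟨0, by simp [pairing]⟩, mul_one]
  -- The factors `-i` of the two inversions combine with `W' = -W⁻¹` to give exactly `W⁻¹ Z`, so no
  -- root of unity remains.
  have hdd : (denom (Matrix.fromBlocks A B C D) Z).det =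
      D.det * ((-Complex.I • W').det * (-Complex.I • Z).det) := by
    have : (-Complex.I • W') * (-Complex.I • Z) = W⁻¹ * Z := by
      rw [hW', Matrix.smul_mul, Matrix.mul_smul, smul_smul, Matrix.neg_mul]
      simp
    rw [← Matrix.det_mul, this, ← Matrix.det_mul, hden, Matrix.mul_assoc]
  rw [hmain, hZinv, hdd]
  ring

end Gauss

/-! ## The absolute value of the Gauss sum -/

section GaussNorm

variable {m r n : ℕ} {Λ : Submodule (𝓞 (imQuadField m)) (Fin r → ℂ)}
  {A B C D : Matrix (Fin n) (Fin n) ℂ}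

theorem gaussExp_mul_star (Λ : Submodule (𝓞 (imQuadField m)) (Fin r → ℂ))
    {S : Matrix (Fin n) (Fin n) ℂ} (hS : S.IsHermitian) (w : tupleLattice Λ n) :
    gaussExp Λ S w * star (gaussExp Λ S w) = 1 := by
  have : ‖gaussExp Λ S w‖ = 1 := by
    rw [gaussExp, norm_thetaExp, quad_eq_ofReal hS, Complex.ofReal_im]
    simp
  rw [Complex.star_def, Complex.mul_conj, Complex.normSq_eq_norm_sq, this]
  simp

/-- Summing over differences `u` leaves, for each `u`, the sum of the character `q ↦ exp(2πi⟨q, u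
S⟩)`. This vanishes unless `u S` lies in the self-dual lattice, which forces `u ∈ L Dᴴ`. Only the
trivial class contributes, with the full cardinality. -/
theorem gauss_sum_mul_star (hΛ : IsThetaLattice Λ)
    (hM : Matrix.fromBlocks A B C D ∈ modularGroup (imQuadField m) n) (hD : IsUnit D.det)
    (hU : ∀ i j, Dᴴ i j ∈ intRing (imQuadField m))
    [Fintype (tupleLattice Λ n ⧸ (latticeMul Λ Dᴴ hU).range)] :
    (∑ q : tupleLattice Λ n ⧸ (latticeMul Λ Dᴴ hU).range, gaussExp Λ (B * D⁻¹) q.out) *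
      star (∑ q : tupleLattice Λ n ⧸ (latticeMul Λ Dᴴ hU).range, gaussExp Λ (B * D⁻¹) q.out) =
      Fintype.card (tupleLattice Λ n ⧸ (latticeMul Λ Dᴴ hU).range) := by
  classical
  have hper := gaussExp_periodic hΛ hM hD hU
  obtain ⟨hSU, hint⟩ := hM
  obtain ⟨h1, h2, h3⟩ := mem_SU_fromBlocks hSU
  have hB : ∀ i j, B i j ∈ intRing (imQuadField m) := fun i j => hint (Sum.inl i) (Sum.inr j)
  have hA : ∀ i j, A i j ∈ intRing (imQuadField m) := fun i j => hint (Sum.inl i) (Sum.inl j)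
  have hC : ∀ i j, C i j ∈ intRing (imQuadField m) := fun i j => hint (Sum.inr i) (Sum.inl j)
  have hDH : IsUnit Dᴴ.det := by
    rw [Matrix.det_conjTranspose]
    exact hD.star
  have hSD : B * D⁻¹ * D = B := Matrix.nonsing_inv_mul_cancel_right _ _ hD
  have hSH : (B * D⁻¹).IsHermitian := isHermitian_mul_inv hSU hD
  set S := B * D⁻¹ with hS
  let H := (latticeMul Λ Dᴴ hU).range
  let f := gaussExp Λ S
  let e : (tupleLattice Λ n ⧸ H) → (tupleLattice Λ n ⧸ H) → ℂ := fun u q =>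
    unitChar (q.out : Matrix (Fin r) (Fin n) ℂ) ((u.out : Matrix (Fin r) (Fin n) ℂ) * S)
  have hstep : (∑ q : tupleLattice Λ n ⧸ H, f q.out) *
      star (∑ q : tupleLattice Λ n ⧸ H, f q.out) =
      ∑ u : tupleLattice Λ n ⧸ H, f u.out * ∑ q : tupleLattice Λ n ⧸ H, e u q := by
    have : ∀ q : tupleLattice Λ n ⧸ H, (∑ p : tupleLattice Λ n ⧸ H, f p.out) * star (f q.out) =
        ∑ u : tupleLattice Λ n ⧸ H, f u.out * e u q := by
      intro q
      rw [← sum_out_add hper q.out, Finset.sum_mul]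
      refine Finset.sum_congr rfl fun u _ => ?_
      have h4 : f (u.out + q.out) = f q.out * f u.out * e u q := by
        rw [add_comm]
        exact thetaExp_add hSH _ _
      change f (u.out + q.out) * _ = _
      rw [h4]
      have := gaussExp_mul_star Λ hSH q.out
      linear_combination (f u.out * e u q) * this
    rw [star_sum, Finset.mul_sum, Finset.sum_congr rfl fun q _ => this q, Finset.sum_comm]
    refine Finset.sum_congr rfl fun u _ => ?_
    rw [Finset.mul_sum]
  have hinner : ∀ u : tupleLattice Λ n ⧸ H, u ≠ 0 → ∑ q : tupleLattice Λ n ⧸ H, e u q = 0 := by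
    intro u hu
    let χ : tupleLattice Λ n → ℂ := fun v =>
      unitChar (v : Matrix (Fin r) (Fin n) ℂ) ((u.out : Matrix (Fin r) (Fin n) ℂ) * S)
    have hχ : ∀ v w, χ (v + w) = χ v * χ w := fun v w => unitChar_add_left _ _ _
    have hχper : ∀ v, ∀ w ∈ H, χ (v + w) = χ v := by
      rintro v _ ⟨y, rfl⟩
      have : χ (latticeMul Λ Dᴴ hU y) = 1 := by
        refine unitChar_eq_one ?_
        have h5 := pairing_mul_right (y : Matrix (Fin r) (Fin n) ℂ)
          ((u.out : Matrix (Fin r) (Fin n) ℂ) * S) D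
        rw [Matrix.mul_assoc, hSD] at h5
        rw [coe_latticeMul, ← h5]
        exact exists_int_pairing hΛ y.2 (mul_mem_tupleLattice u.out.2 hB)
      rw [hχ, this, mul_one]
    obtain ⟨x, hx⟩ : ∃ x, χ x ≠ 1 := by
      by_contra! hall
      apply hu
      have h6 : (u.out : Matrix (Fin r) (Fin n) ℂ) * S ∈ tupleLattice Λ n := by
        rw [mem_tupleLattice_iff_pairing hΛ]
        intro x hx
        exact unitChar_eq_one_iff.1 (hall ⟨x, hx⟩)
      -- Since `A - S C` is the inverse of `Dᴴ`, this element is the preimage of `u` under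
      -- multiplication by `Dᴴ`.
      let a := latticeMul Λ A hA u.out - latticeMul Λ C hC ⟨_, h6⟩
      have ha : latticeMul Λ Dᴴ hU a = u.out := by
        apply Subtype.ext
        change ((u.out : Matrix (Fin r) (Fin n) ℂ) * A - (u.out : Matrix (Fin r) (Fin n) ℂ) * S * C)
          * Dᴴ = u.out
        have h7 : Dᴴ * A - Bᴴ * C = 1 := by
          have := congrArg Matrix.conjTranspose h1
          simpa [Matrix.conjTranspose_sub, Matrix.conjTranspose_mul] using this
        have h8 : S = Dᴴ⁻¹ * Bᴴ := by
          have := hSH.eq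
          rw [hS, Matrix.conjTranspose_mul, Matrix.conjTranspose_nonsing_inv] at this
          exact hS.trans this.symm
        have h9 : A - S * C = Dᴴ⁻¹ := by
          rw [h8, Matrix.mul_assoc]
          nth_rewrite 1 [← Matrix.nonsing_inv_mul_cancel_left Dᴴ A hDH]
          rw [← Matrix.mul_sub, h7, Matrix.mul_one]
        rw [Matrix.mul_assoc _ S, ← Matrix.mul_sub, h9, Matrix.nonsing_inv_mul_cancel_right _ _ hDH]
      rw [← QuotientAddGroup.out_eq' u, QuotientAddGroup.eq_zero_iff]
      exact ⟨a, ha⟩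
    have h10 : (∑ q : tupleLattice Λ n ⧸ H, χ q.out) * χ x = ∑ q : tupleLattice Λ n ⧸ H, χ q.out := by
      rw [Finset.sum_mul, ← sum_out_add hχper x]
      exact Finset.sum_congr rfl fun q _ => (hχ _ _).symm
    have h11 : (∑ q : tupleLattice Λ n ⧸ H, χ q.out) * (χ x - 1) = 0 := by
      rw [mul_sub, h10, mul_one, sub_self]
    rcases mul_eq_zero.1 h11 with h | h
    · exact h
    · exact absurd (sub_eq_zero.1 h) hx
  change (∑ q : tupleLattice Λ n ⧸ H, f q.out) * star (∑ q : tupleLattice Λ n ⧸ H, f q.out) = _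
  rw [hstep, Finset.sum_eq_single 0 (fun u _ hu => by rw [hinner u hu, mul_zero]) (by simp)]
  obtain ⟨y, hy⟩ : (0 : tupleLattice Λ n ⧸ H).out ∈ H := by
    rw [← QuotientAddGroup.eq_zero_iff, QuotientAddGroup.out_eq']
  have h12 : f (0 : tupleLattice Λ n ⧸ H).out = 1 := by
    have := hper 0 _ ⟨y, rfl⟩
    rw [zero_add] at this
    rw [← hy]
    refine this.trans ?_
    refine thetaExp_eq_one ⟨0, ?_⟩
    simp [quad]
  have h13 : ∀ q : tupleLattice Λ n ⧸ H, e 0 q = 1 := by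
    intro q
    refine unitChar_eq_one ?_
    have : ((0 : tupleLattice Λ n ⧸ H).out : Matrix (Fin r) (Fin n) ℂ) * S =
        (y : Matrix (Fin r) (Fin n) ℂ) * Bᴴ := by
      rw [← hy, coe_latticeMul, Matrix.mul_assoc, ← hSH.eq, hS, Matrix.conjTranspose_mul,
        Matrix.conjTranspose_nonsing_inv, Matrix.mul_nonsing_inv_cancel_left _ _ hDH]
    rw [this]
    exact exists_int_pairing hΛ q.out.2 (mul_mem_tupleLattice y.2 fun i j => star_mem_intRing (hB j i))
  rw [h12, one_mul, Finset.sum_congr rfl fun q _ => h13 q]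
  simp
  rfl

/-- If the mean value of the Gauss sum is positive and `det D` is a nonzero real number, the theta
series transforms without a multiplier. -/
theorem theta_moebius_of_hasMean (hΛ : IsThetaLattice Λ) (hr : Even r)
    (hM : Matrix.fromBlocks A B C D ∈ modularGroup (imQuadField m) n) (hD : IsUnit D.det)
    {c : ℂ} (hc : 0 < c) (hmean : HasMean (gaussExp Λ (B * D⁻¹)) c)
    {Z : Matrix (Fin n) (Fin n) ℂ} (hZ : Z ∈ halfSpace n) :
    theta (tupleLattice Λ n) (moebius (Matrix.fromBlocks A B C D) Z) =
      (denom (Matrix.fromBlocks A B C D) Z).det ^ r * theta (tupleLattice Λ n) Z := by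
  have hU : ∀ i j, Dᴴ i j ∈ intRing (imQuadField m) := fun i j =>
    star_mem_intRing (hM.2 (Sum.inr j) (Sum.inr i))
  have hDH : IsUnit Dᴴ.det := by
    rw [Matrix.det_conjTranspose]
    exact hD.star
  have := finite_quotient_latticeMul hU hΛ hDH
  have := Fintype.ofFinite (tupleLattice Λ n ⧸ (latticeMul Λ Dᴴ hU).range)
  have h1 := theta_moebius hΛ hM hD hU hZ
  have h2 := gauss_sum_mul_star hΛ hM hD hU
  have hcard := card_quotient_latticeMul hU hΛ hDH
  rw [Nat.card_eq_fintype_card] at hcard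
  set g := ∑ q : tupleLattice Λ n ⧸ (latticeMul Λ Dᴴ hU).range, gaussExp Λ (B * D⁻¹) q.out
  set k := Fintype.card (tupleLattice Λ n ⧸ (latticeMul Λ Dᴴ hU).range)
  have hk : (k : ℂ) ≠ 0 := Nat.cast_ne_zero.2 Fintype.card_ne_zero
  have hg : g = k * c := by
    have h3 := hasMean_of_periodic (gaussExp_periodic hΛ hM hD hU) (c := g / k) (by
      change g = k * (g / k)
      field_simp)
    rw [← h3.unique hmean]
    field_simp
  have hgpos : 0 < g := by
    rw [hg]
    have : (0 : ℂ) < k := by exact_mod_cast Nat.pos_of_ne_zero Fintype.card_ne_zero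
    exact mul_pos this hc
  have hgn : g = (‖g‖ : ℂ) := Complex.eq_coe_norm_of_nonneg hgpos.le
  have hnorm : ‖g‖ ^ 2 = (‖D.det‖ ^ r) ^ 2 := by
    rw [Complex.star_def, Complex.mul_conj, Complex.normSq_eq_norm_sq] at h2
    have h4 : ‖g‖ ^ 2 = (k : ℝ) := by exact_mod_cast h2
    rw [h4, hcard, Matrix.det_conjTranspose, norm_star, ← pow_mul, mul_comm]
  have hnorm' : ‖g‖ = ‖D.det‖ ^ r := (sq_eq_sq₀ (norm_nonneg _) (by positivity)).1 hnorm
  -- Evenness of `r` removes the possible sign of the real number `det D`.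
  have hdet : ((‖D.det‖ ^ r : ℝ) : ℂ) = D.det ^ r := by
    obtain ⟨s, rfl⟩ := hr
    have h5 : ((‖D.det‖ ^ 2 : ℝ) : ℂ) = D.det ^ 2 := by
      rw [← Complex.normSq_eq_norm_sq, ← Complex.mul_conj, ← Complex.star_def, star_det_eq hM.1, sq]
    rw [← two_mul, pow_mul, pow_mul, Complex.ofReal_pow, h5]
  have hgd : g = D.det ^ r := by rw [hgn, hnorm', hdet]
  rw [hgd] at h1
  exact mul_left_cancel₀ (pow_ne_zero _ hD.ne_zero) h1

end GaussNorm

/-! ## Degree one -/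

section DegreeOne

variable {m r : ℕ} {Λ : Submodule (𝓞 (imQuadField m)) (Fin r → ℂ)}

/-- The theta series of degree one as a function on the upper half plane. -/
def theta1 (Λ : Submodule (𝓞 (imQuadField m)) (Fin r → ℂ)) (τ : ℂ) : ℂ :=
  theta (tupleLattice Λ 1) (τ • (1 : Matrix (Fin 1) (Fin 1) ℂ))

theorem smul_one_mem_halfSpace {τ : ℂ} (hτ : 0 < τ.im) :
    τ • (1 : Matrix (Fin 1) (Fin 1) ℂ) ∈ halfSpace 1 := by
  refine mem_halfSpace_of_quad fun w hw => ?_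
  rw [quad_smul_left, quad_eq_ofReal Matrix.isHermitian_one, Complex.im_mul_ofReal]
  exact mul_pos hτ (quad_re_pos Matrix.PosDef.one hw)

theorem inv_smul_one {τ : ℂ} (hτ : τ ≠ 0) :
    (τ • (1 : Matrix (Fin 1) (Fin 1) ℂ))⁻¹ = τ⁻¹ • 1 := by
  refine Matrix.inv_eq_right_inv ?_
  rw [Matrix.smul_mul, Matrix.mul_smul, smul_smul, Matrix.one_mul, mul_inv_cancel₀ hτ, one_smul]

theorem det_smul_one (c : ℂ) : (c • (1 : Matrix (Fin 1) (Fin 1) ℂ)).det = c := by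
  simp

theorem theta1_neg_inv (hΛ : IsThetaLattice Λ) {τ : ℂ} (hτ : 0 < τ.im) :
    theta1 Λ (-τ⁻¹) = (-Complex.I * τ) ^ r * theta1 Λ τ := by
  have h := theta_inversion (hΛ.isUnimodularLattice 1) (smul_one_mem_halfSpace hτ) 0
  have hτ0 : τ ≠ 0 := by
    rintro rfl
    simp at hτ
  have h2 : ∀ w : Matrix (Fin r) (Fin 1) ℂ, unitChar 0 w = 1 := fun w =>
    unitChar_eq_one ⟨0, by simp [pairing]⟩
  simp only [add_zero, h2, mul_one] at h
  rw [inv_smul_one hτ0, ← neg_smul, smul_smul, det_smul_one] at h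
  exact h

theorem theta_add_of_integral (hΛ : IsThetaLattice Λ) {n : ℕ} {S : Matrix (Fin n) (Fin n) ℂ}
    (hS : S.IsHermitian) (hSO : ∀ i j, S i j ∈ intRing (imQuadField m))
    (Z : Matrix (Fin n) (Fin n) ℂ) :
    theta (tupleLattice Λ n) (Z + S) = theta (tupleLattice Λ n) Z := by
  refine tsum_congr fun w => ?_
  rw [thetaExp_add_left, thetaExp_eq_one (exists_int_quad hΛ hS hSO w.2), mul_one]

theorem one_apply_mem_intRing {n : ℕ} (i j : Fin n) :
    (1 : Matrix (Fin n) (Fin n) ℂ) i j ∈ intRing (imQuadField m) := by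
  rw [Matrix.one_apply]
  split_ifs
  · exact Subring.one_mem _
  · exact Subring.zero_mem _

theorem theta1_add_one (hΛ : IsThetaLattice Λ) (τ : ℂ) : theta1 Λ (τ + 1) = theta1 Λ τ := by
  rw [theta1, add_smul, one_smul, theta_add_of_integral hΛ Matrix.isHermitian_one
    one_apply_mem_intRing]
  rfl

theorem theta1_I_ne_zero (hΛ : IsThetaLattice Λ) : theta1 Λ Complex.I ≠ 0 := by
  have hs := summable_thetaExp (hΛ.isUnimodularLattice 1)
    (smul_one_mem_halfSpace (τ := Complex.I) (by simp))
  have hterm : ∀ w : Matrix (Fin r) (Fin 1) ℂ, thetaExp (Complex.I • 1) w =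
      (Real.exp (-Real.pi * (quad 1 w).re) : ℂ) := by
    intro w
    rw [thetaExp, quad_smul_left, quad_eq_ofReal Matrix.isHermitian_one, Complex.ofReal_exp]
    congr 1
    push_cast
    linear_combination (Real.pi * (quad 1 w).re : ℂ) * Complex.I_mul_I
  rw [theta1, theta, tsum_congr fun w : tupleLattice Λ 1 => hterm w, ← Complex.ofReal_tsum]
  simp only [hterm] at hs
  have hs' := Complex.summable_ofReal.1 hs
  exact Complex.ofReal_ne_zero.2 (hs'.tsum_pos (fun _ => (Real.exp_pos _).le) 0 (Real.exp_pos _)).ne'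

theorem im_neg_inv_pos {τ : ℂ} (hτ : 0 < τ.im) : 0 < (-τ⁻¹).im := by
  rw [Complex.neg_im, Complex.inv_im, neg_div, neg_neg]
  refine div_pos hτ (Complex.normSq_pos.2 ?_)
  rintro rfl
  simp at hτ

/-- The map `τ ↦ -(τ + 1)⁻¹` has order three. Starting from `i`, the three automorphy factors
multiply to `(-i)^r`, and the nonzero value at `i` cancels. -/
theorem neg_I_pow_rank (hΛ : IsThetaLattice Λ) : (-Complex.I) ^ r = 1 := by
  have hstep : ∀ τ : ℂ, 0 < τ.im → 0 < (-(τ + 1)⁻¹).im ∧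
      theta1 Λ (-(τ + 1)⁻¹) = (-Complex.I * (τ + 1)) ^ r * theta1 Λ τ := by
    intro τ hτ
    have h1 : 0 < (τ + 1).im := by simpa using hτ
    exact ⟨im_neg_inv_pos h1, by rw [theta1_neg_inv hΛ h1, theta1_add_one hΛ]⟩
  have h0 : 0 < Complex.I.im := by simp
  obtain ⟨i1, e1⟩ := hstep _ h0
  obtain ⟨i2, e2⟩ := hstep _ i1
  obtain ⟨i3, e3⟩ := hstep _ i2
  have hI : Complex.I + 1 ≠ 0 := fun h => by simpa using congrArg Complex.im h
  have hI0 := Complex.I_ne_zero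
  have f1 : -(Complex.I + 1)⁻¹ + 1 = Complex.I / (Complex.I + 1) := by field_simp; ring
  rw [f1, inv_div] at e2 e3
  have f2 : -((Complex.I + 1) / Complex.I) + 1 = -(1 / Complex.I) := by field_simp; ring
  rw [f2] at e3
  have f3 : -(-(1 / Complex.I))⁻¹ = Complex.I := by field_simp
  rw [f3, e2, e1] at e3
  have h := mul_right_cancel₀ (theta1_I_ne_zero hΛ)
    ((one_mul _).trans (e3.trans (by rw [← mul_assoc, ← mul_assoc, ← mul_pow, ← mul_pow])))
  rw [h]
  congr 1
  field_simp
  linear_combination -Complex.I_sq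

theorem even_rank (hΛ : IsThetaLattice Λ) : Even r := by
  have h := congrArg (· ^ 2) (neg_I_pow_rank hΛ)
  rw [← pow_mul, mul_comm, pow_mul, neg_sq, Complex.I_sq, one_pow] at h
  exact (neg_one_pow_eq_one_iff_even (by norm_num)).1 h

open ModularGroup in
theorem theta1_smul (hΛ : IsThetaLattice Λ) (γ : Matrix.SpecialLinearGroup (Fin 2) ℤ)
    (τ : UpperHalfPlane) : theta1 Λ ((γ • τ : UpperHalfPlane) : ℂ) =
      ((γ 1 0 : ℂ) * τ + (γ 1 1 : ℂ)) ^ r * theta1 Λ τ := by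
  let F : UpperHalfPlane → ℂ := fun τ => theta1 Λ τ
  have key : SlashAction.map (r : ℤ) γ F = F := by
    have hγ : γ ∈ Subgroup.closure {S, T} := by
      rw [SpecialLinearGroup.SL2Z_generators]
      trivial
    induction hγ using Subgroup.closure_induction with
    | mem γ h =>
      rcases h with rfl | rfl
      · ext τ
        rw [ModularForm.slash_action_eq'_iff]
        have : ((S • τ : UpperHalfPlane) : ℂ) = -(τ : ℂ)⁻¹ := by
          rw [UpperHalfPlane.modular_S_smul]
          simp [inv_neg]
        simp only [F]
        rw [this, theta1_neg_inv hΛ τ.im_pos, mul_pow, neg_I_pow_rank hΛ, one_mul]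
        simp [S]
      · ext τ
        rw [ModularForm.slash_action_eq'_iff]
        have : ((T • τ : UpperHalfPlane) : ℂ) = (τ : ℂ) + 1 := by
          rw [UpperHalfPlane.modular_T_smul]
          simp [add_comm]
        simp only [F]
        rw [this, theta1_add_one hΛ]
        simp [T]
    | one => exact SlashAction.slash_one _ _
    | mul γ δ _ _ h1 h2 => rw [SlashAction.slash_mul, h1, h2]
    | inv γ _ h =>
      nth_rewrite 1 [← h]
      rw [← SlashAction.slash_mul, mul_inv_cancel, SlashAction.slash_one]
  have h := (ModularForm.slash_action_eq'_iff (r : ℤ) F γ τ).1 (congrFun key τ)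
  rw [zpow_natCast] at h
  exact h

theorem fromBlocks_mem_modularGroup_one {a b c d : ℤ} (h : a * d - b * c = 1) :
    Matrix.fromBlocks ((a : ℂ) • (1 : Matrix (Fin 1) (Fin 1) ℂ)) ((b : ℂ) • 1) ((c : ℂ) • 1)
      ((d : ℂ) • 1) ∈ modularGroup (imQuadField m) 1 := by
  have hC : (a : ℂ) * d - b * c = 1 := by exact_mod_cast h
  refine ⟨⟨?_, ?_⟩, ?_⟩
  · rw [← Matrix.det_reindex_self finSumFinEquiv, Matrix.det_fin_two]
    have h0 : (finSumFinEquiv : Fin 1 ⊕ Fin 1 ≃ Fin (1 + 1)).symm 0 = Sum.inl 0 := rfl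
    have h1 : (finSumFinEquiv : Fin 1 ⊕ Fin 1 ≃ Fin (1 + 1)).symm 1 = Sum.inr 0 := rfl
    simp [h0, h1, hC]
  · rw [Matrix.J, Matrix.fromBlocks_conjTranspose, Matrix.fromBlocks_multiply,
      Matrix.fromBlocks_multiply]
    congr 1 <;> ext i j <;> fin_cases i <;> fin_cases j <;> simp
    · ring
    · linear_combination -hC
    · linear_combination hC
    · ring
  · have hO : ∀ (k : ℤ) i j, ((k : ℂ) • (1 : Matrix (Fin 1) (Fin 1) ℂ)) i j ∈
        intRing (imQuadField m) := fun k i j => by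
      rw [Matrix.smul_apply, smul_eq_mul]
      exact Subring.mul_mem _ (intCast_mem_intRing k) (one_apply_mem_intRing i j)
    rintro (i | i) (j | j)
    exacts [hO a i j, hO b i j, hO c i j, hO d i j]

/-- Complete the reduced fraction `b/d` to a matrix of `SL₂(ℤ)` with right column `(b, d)`. At `i`,
where the series does not vanish, comparing `theta_moebius` with `theta1_smul` identifies the Gauss
sum as `d^r`, which is positive because `r` is even. -/
theorem exists_hasMean_one (hΛ : IsThetaLattice Λ) (q : ℚ) :
    ∃ c : ℂ, 0 < c ∧ HasMean (gaussExp Λ ((q : ℂ) • (1 : Matrix (Fin 1) (Fin 1) ℂ))) c := by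
  have hcop : IsCoprime q.num (q.den : ℤ) := Int.isCoprime_iff_gcd_eq_one.2 q.reduced
  set b := q.num with hb
  set d : ℤ := (q.den : ℤ) with hd
  obtain ⟨u, v, huv⟩ := hcop
  have hd0 : (d : ℂ) ≠ 0 := by
    rw [hd]
    exact_mod_cast q.den_ne_zero
  have habcd : v * d - b * (-u) = 1 := by linear_combination huv
  have hM := fromBlocks_mem_modularGroup_one (m := m) habcd
  have hdet : ((d : ℂ) • (1 : Matrix (Fin 1) (Fin 1) ℂ)).det = d := det_smul_one _
  have hD : IsUnit ((d : ℂ) • (1 : Matrix (Fin 1) (Fin 1) ℂ)).det := by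
    rw [hdet]
    exact hd0.isUnit
  have hU : ∀ i j, ((d : ℂ) • (1 : Matrix (Fin 1) (Fin 1) ℂ))ᴴ i j ∈ intRing (imQuadField m) :=
    fun i j => star_mem_intRing (hM.2 (Sum.inr j) (Sum.inr i))
  have := finite_quotient_latticeMul hU hΛ (by
    rw [Matrix.det_conjTranspose]
    exact hD.star)
  have := Fintype.ofFinite (tupleLattice Λ 1 ⧸ (latticeMul Λ _ hU).range)
  have h1 := theta_moebius hΛ hM hD hU (smul_one_mem_halfSpace (τ := Complex.I) (by simp))
  let γ : Matrix.SpecialLinearGroup (Fin 2) ℤ := ⟨!![v, b; -u, d], by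
    rw [Matrix.det_fin_two_of]
    exact habcd⟩
  have h2 := theta1_smul hΛ γ UpperHalfPlane.I
  have hγ : ((γ • UpperHalfPlane.I : UpperHalfPlane) : ℂ) =
      (v * Complex.I + b) / (((-u : ℤ) : ℂ) * Complex.I + d) := by
    rw [UpperHalfPlane.specialLinearGroup_apply]
    simp [γ]
  have hne : (((-u : ℤ) : ℂ) * Complex.I + d) ≠ 0 := by
    intro h
    have hre := congrArg Complex.re h
    simp at hre
    exact hd0 (by exact_mod_cast hre)
  have hden : denom (Matrix.fromBlocks ((v : ℂ) • (1 : Matrix (Fin 1) (Fin 1) ℂ)) ((b : ℂ) • 1)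
      (((-u : ℤ) : ℂ) • 1) ((d : ℂ) • 1)) (Complex.I • 1) =
      (((-u : ℤ) : ℂ) * Complex.I + d) • 1 := by
    rw [denom, Matrix.toBlocks_fromBlocks₂₁, Matrix.toBlocks_fromBlocks₂₂, Matrix.smul_mul,
      Matrix.one_mul, smul_smul, add_smul]
  have hmoe : moebius (Matrix.fromBlocks ((v : ℂ) • (1 : Matrix (Fin 1) (Fin 1) ℂ)) ((b : ℂ) • 1)
      (((-u : ℤ) : ℂ) • 1) ((d : ℂ) • 1)) (Complex.I • 1) =
      ((γ • UpperHalfPlane.I : UpperHalfPlane) : ℂ) • 1 := by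
    rw [moebius, hden, inv_smul_one hne, hγ, Matrix.toBlocks_fromBlocks₁₁,
      Matrix.toBlocks_fromBlocks₁₂, Matrix.smul_mul, Matrix.one_mul, smul_smul, ← add_smul,
      Matrix.mul_smul, Matrix.mul_one, smul_smul, mul_comm, div_eq_mul_inv]
  have h3 : theta (tupleLattice Λ 1) (((γ • UpperHalfPlane.I : UpperHalfPlane) : ℂ) • 1) =
      (((-u : ℤ) : ℂ) * Complex.I + d) ^ r * theta1 Λ Complex.I := h2
  rw [hmoe, h3, hden, hdet, det_smul_one] at h1
  have h4 := mul_right_cancel₀ (mul_ne_zero (pow_ne_zero r hne) (theta1_I_ne_zero hΛ)) h1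
  have hS : (b : ℂ) • (1 : Matrix (Fin 1) (Fin 1) ℂ) * ((d : ℂ) • 1)⁻¹ = (q : ℂ) • 1 := by
    rw [inv_smul_one hd0, Matrix.smul_mul, Matrix.one_mul, smul_smul, hb, hd, ← div_eq_mul_inv]
    congr 1
    exact_mod_cast (Rat.num_div_den q)
  have hper := gaussExp_periodic hΛ hM hD hU
  rw [hS] at h4 hper
  have hk : (0 : ℂ) < (Fintype.card (tupleLattice Λ 1 ⧸ (latticeMul Λ _ hU).range) : ℂ) := by
    exact_mod_cast Nat.pos_of_ne_zero Fintype.card_ne_zero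
  refine ⟨(d : ℂ) ^ r / (Fintype.card (tupleLattice Λ 1 ⧸ (latticeMul Λ _ hU).range) : ℂ), ?_,
    hasMean_of_periodic hper ?_⟩
  · refine div_pos ?_ hk
    have : 0 < ((d : ℝ)) ^ r := (even_rank hΛ).pow_pos (by exact_mod_cast hd0)
    exact_mod_cast this
  · rw [← h4, mul_div_cancel₀ _ hk.ne']

end DegreeOne

/-! ## Positivity of Gauss sums with unramified denominators -/

section Positivity

variable {m r n : ℕ} {Λ : Submodule (𝓞 (imQuadField m)) (Fin r → ℂ)}

/-- The Gauss sums of `S` are positive. -/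
def GaussPos (Λ : Submodule (𝓞 (imQuadField m)) (Fin r → ℂ)) (S : Matrix (Fin n) (Fin n) ℂ) : Prop :=
  ∃ c : ℂ, 0 < c ∧ HasMean (gaussExp Λ S) c

/-- The entries of the matrix are integers of the quadratic field. -/
abbrev IsIntegralMatrix (m : ℕ) {k : ℕ} (S : Matrix (Fin n) (Fin k) ℂ) : Prop :=
  ∀ i j, S i j ∈ intRing (imQuadField m)

theorem GaussPos.conj {S U V : Matrix (Fin n) (Fin n) ℂ} (h : GaussPos Λ S)
    (hU : IsIntegralMatrix m U) (hV : IsIntegralMatrix m V) (hVU : V * U = 1) :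
    GaussPos Λ (U * S * Uᴴ) := by
  obtain ⟨c, hc, hm⟩ := h
  refine ⟨c, hc, ?_⟩
  have hs : Function.Surjective (latticeMul Λ U hU) := fun w => ⟨latticeMul Λ V hV w, by
    apply Subtype.ext
    rw [coe_latticeMul, coe_latticeMul, Matrix.mul_assoc, hVU, Matrix.mul_one]⟩
  have h1 := hm.comp hs
  have h2 : (fun a => gaussExp Λ S (latticeMul Λ U hU a)) = gaussExp Λ (U * S * Uᴴ) := by
    ext w
    rw [gaussExp, coe_latticeMul, thetaExp_mul]
    rfl
  rwa [h2] at h1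

theorem gaussExp_add_integral (hΛ : IsThetaLattice Λ) {T : Matrix (Fin n) (Fin n) ℂ}
    (hT : T.IsHermitian) (hTO : IsIntegralMatrix m T) (S : Matrix (Fin n) (Fin n) ℂ) :
    gaussExp Λ (S + T) = gaussExp Λ S := by
  ext w
  rw [gaussExp, thetaExp_add_left, thetaExp_eq_one (exists_int_quad hΛ hT hTO w.2), mul_one]
  rfl

theorem GaussPos.of_integral (hΛ : IsThetaLattice Λ) {S : Matrix (Fin n) (Fin n) ℂ}
    (hS : S.IsHermitian) (hSO : IsIntegralMatrix m S) : GaussPos Λ S := by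
  refine ⟨1, one_pos, ?_⟩
  have : gaussExp Λ S = fun _ => 1 := by
    ext w
    exact thetaExp_eq_one (exists_int_quad hΛ hS hSO w.2)
  rw [this]
  exact hasMean_const 1

theorem IsIntegralMatrix.smul {S : Matrix (Fin n) (Fin n) ℂ} (hS : IsIntegralMatrix m S) {c : ℂ}
    (hc : c ∈ intRing (imQuadField m)) : IsIntegralMatrix m (c • S) := fun i j => by
  rw [Matrix.smul_apply, smul_eq_mul]
  exact Subring.mul_mem _ hc (hS i j)

theorem natCast_mem_intRing (N : ℕ) : (N : ℂ) ∈ intRing (imQuadField m) :=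
  natCast_mem _ N

theorem isHermitian_natCast_smul {S : Matrix (Fin n) (Fin n) ℂ} (hS : S.IsHermitian) (N : ℕ) :
    ((N : ℂ) • S).IsHermitian := by
  rw [Matrix.IsHermitian, Matrix.conjTranspose_smul, hS.eq]
  simp

theorem exists_hasMean_gaussExp (hΛ : IsThetaLattice Λ) {S : Matrix (Fin n) (Fin n) ℂ}
    (hS : S.IsHermitian) {N : ℕ} (hN : N ≠ 0) (hNS : IsIntegralMatrix m ((N : ℂ) • S)) :
    ∃ c, HasMean (gaussExp Λ S) c := by
  have hU : IsIntegralMatrix m ((N : ℂ) • (1 : Matrix (Fin n) (Fin n) ℂ)) :=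
    IsIntegralMatrix.smul one_apply_mem_intRing (natCast_mem_intRing N)
  have hdet : IsUnit ((N : ℂ) • (1 : Matrix (Fin n) (Fin n) ℂ)).det := by
    rw [Matrix.det_smul, Matrix.det_one, mul_one]
    exact (pow_ne_zero _ (Nat.cast_ne_zero.2 hN)).isUnit
  have := finite_quotient_latticeMul (Λ := Λ) hU hΛ hdet
  refine exists_hasMean_of_periodic (H := (latticeMul Λ _ hU).range) ?_
  rintro v _ ⟨y, rfl⟩
  have e1 : (latticeMul Λ _ hU y : Matrix (Fin r) (Fin n) ℂ) * S =
      0 + (latticeMul Λ _ hNS y : Matrix (Fin r) (Fin n) ℂ) := by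
    rw [coe_latticeMul, coe_latticeMul, zero_add, Matrix.mul_assoc, Matrix.smul_mul, Matrix.one_mul]
  rw [gaussExp_add hΛ hS _ _ _ e1, unitChar_eq_one ⟨0, by simp [pairing]⟩, mul_one]
  have e2 : gaussExp Λ S (latticeMul Λ _ hU y) = 1 := by
    rw [gaussExp, coe_latticeMul, thetaExp_mul]
    refine thetaExp_eq_one ?_
    have : (N : ℂ) • (1 : Matrix (Fin n) (Fin n) ℂ) * S * ((N : ℂ) • (1 : Matrix (Fin n) (Fin n) ℂ))ᴴ =
        (N : ℂ) • ((N : ℂ) • S) := by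
      rw [Matrix.conjTranspose_smul, Matrix.conjTranspose_one, Matrix.smul_mul, Matrix.one_mul,
        Matrix.mul_smul, Matrix.mul_one]
      simp
    rw [this]
    exact exists_int_quad hΛ (isHermitian_natCast_smul (isHermitian_natCast_smul hS N) N)
      (hNS.smul (natCast_mem_intRing N)) y.2
  rw [e2, mul_one]

/-- By Bézout every lattice point is `M x + N y`. The cross term is a pairing with `MN·S` and hence
integral, so the exponential factors into those of `M²S` at `x` and `N²S` at `y`, and the means
multiply. -/
theorem GaussPos.of_coprime (hΛ : IsThetaLattice Λ) {S : Matrix (Fin n) (Fin n) ℂ}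
    (hS : S.IsHermitian) {M N : ℕ} (hMN : M.Coprime N) (hM0 : M ≠ 0) (hN0 : N ≠ 0)
    (hMNS : IsIntegralMatrix m (((M * N : ℕ) : ℂ) • S))
    (hM : GaussPos Λ ((M : ℂ) • (M : ℂ) • S)) (hN : GaussPos Λ ((N : ℂ) • (N : ℂ) • S)) :
    GaussPos Λ S := by
  obtain ⟨c, hc, hcm⟩ := hM
  obtain ⟨d, hd, hdm⟩ := hN
  obtain ⟨e, he⟩ := exists_hasMean_gaussExp hΛ hS (Nat.mul_ne_zero hM0 hN0) hMNS
  obtain ⟨u, v, huv⟩ := Nat.isCoprime_iff_coprime.2 hMN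
  let φ : tupleLattice Λ n × tupleLattice Λ n →+ tupleLattice Λ n :=
    { toFun := fun x => M • x.1 + N • x.2
      map_zero' := by simp
      map_add' := fun x y => by
        simp only [Prod.fst_add, Prod.snd_add, smul_add]
        abel }
  have hφ : Function.Surjective φ := fun w => ⟨(u • w, v • w), by
    change M • u • w + N • v • w = w
    rw [← natCast_zsmul, ← natCast_zsmul, smul_smul, smul_smul, ← add_smul, mul_comm, mul_comm (N : ℤ),
      huv, one_smul]⟩
  have h1 := he.comp hφ
  have h2 : (fun x => gaussExp Λ S (φ x)) = fun x : tupleLattice Λ n × tupleLattice Λ n =>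
      gaussExp Λ ((M : ℂ) • (M : ℂ) • S) x.1 * gaussExp Λ ((N : ℂ) • (N : ℂ) • S) x.2 := by
    ext x
    have hcoe : ∀ (k : ℕ) (w : tupleLattice Λ n), ((k • w : tupleLattice Λ n) : Matrix (Fin r) (Fin n) ℂ) =
        (w : Matrix (Fin r) (Fin n) ℂ) * ((k : ℂ) • (1 : Matrix (Fin n) (Fin n) ℂ)) := by
      intro k w
      rw [Matrix.mul_smul, Matrix.mul_one, Nat.cast_smul_eq_nsmul]
      rfl
    have hsq : ∀ (k : ℕ) (w : tupleLattice Λ n), gaussExp Λ S (k • w) =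
        gaussExp Λ ((k : ℂ) • (k : ℂ) • S) w := by
      intro k w
      rw [gaussExp, hcoe, thetaExp_mul, gaussExp]
      congr 1
      rw [Matrix.conjTranspose_smul, Matrix.conjTranspose_one, Matrix.smul_mul, Matrix.one_mul,
        Matrix.mul_smul, Matrix.mul_one]
      simp
    change gaussExp Λ S (M • x.1 + N • x.2) = _
    rw [← hsq, ← hsq]
    have h3 := thetaExp_add hS ((M • x.1 : tupleLattice Λ n) : Matrix (Fin r) (Fin n) ℂ)
      ((N • x.2 : tupleLattice Λ n) : Matrix (Fin r) (Fin n) ℂ)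
    refine h3.trans ?_
    rw [unitChar_eq_one, mul_one]
    · rfl
    · rw [hcoe, pairing_comm, pairing_mul_right, pairing_comm]
      have : ((N • x.2 : tupleLattice Λ n) : Matrix (Fin r) (Fin n) ℂ) * S *
          ((M : ℂ) • (1 : Matrix (Fin n) (Fin n) ℂ))ᴴ =
          (x.2 : Matrix (Fin r) (Fin n) ℂ) * (((M * N : ℕ) : ℂ) • S) := by
        rw [hcoe, Matrix.conjTranspose_smul, Matrix.conjTranspose_one]
        simp [smul_smul]
      rw [this]
      exact exists_int_pairing hΛ x.1.2 (mul_mem_tupleLattice x.2.2 hMNS)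
  rw [h2] at h1
  have h3 := h1.unique (hcm.mul hdm)
  exact ⟨e, h3 ▸ mul_pos hc hd, he⟩

/-- The off-diagonal part `T` of row and column `i` is integral and Hermitian, so subtracting it
changes no exponential. What remains is an orthogonal sum of a `1 × 1` block and its complement, for
which the means multiply. -/
theorem GaussPos.of_split (hΛ : IsThetaLattice Λ) {S : Matrix (Fin (n + 1)) (Fin (n + 1)) ℂ}
    (hS : S.IsHermitian) (i : Fin (n + 1)) (hint : ∀ a, a ≠ i → S a i ∈ intRing (imQuadField m))
    (h1 : GaussPos Λ (S i i • (1 : Matrix (Fin 1) (Fin 1) ℂ)))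
    (h2 : GaussPos Λ (S.submatrix i.succAbove i.succAbove)) : GaussPos Λ S := by
  let T : Matrix (Fin (n + 1)) (Fin (n + 1)) ℂ := Matrix.of fun a b =>
    if a = i then (if b = i then 0 else S a b) else (if b = i then S a b else 0)
  have hT : T.IsHermitian := by
    ext a b
    simp only [T, Matrix.conjTranspose_apply, Matrix.of_apply]
    split_ifs
    all_goals first | exact star_zero _ | exact hS.apply _ _
  have hTO : IsIntegralMatrix m T := by
    intro a b
    simp only [T, Matrix.of_apply]
    split_ifs with ha hb hb
    · exact Subring.zero_mem _
    · subst ha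
      rw [← hS.apply]
      exact star_mem_intRing (hint b hb)
    · subst hb
      exact hint a ha
    · exact Subring.zero_mem _
  have hST : S = (S - T) + T := by abel
  rw [GaussPos, hST, gaussExp_add_integral hΛ hT hTO]
  obtain ⟨c, hc, hcm⟩ := h1
  obtain ⟨d, hd, hdm⟩ := h2
  refine ⟨c * d, mul_pos hc hd, ?_⟩
  let φ : tupleLattice Λ (n + 1) →+ tupleLattice Λ 1 × tupleLattice Λ n :=
    { toFun := fun w => (⟨(w : Matrix (Fin r) (Fin (n + 1)) ℂ).submatrix id (fun _ => i),
        fun _ => w.2 i⟩, ⟨(w : Matrix (Fin r) (Fin (n + 1)) ℂ).submatrix id i.succAbove,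
        fun j => w.2 (i.succAbove j)⟩)
      map_zero' := rfl
      map_add' := fun v w => rfl }
  have hφ1 : ∀ w k j, ((φ w).1 : Matrix (Fin r) (Fin 1) ℂ) k j =
      (w : Matrix (Fin r) (Fin (n + 1)) ℂ) k i := fun _ _ _ => rfl
  have hφ2 : ∀ w k j, ((φ w).2 : Matrix (Fin r) (Fin n) ℂ) k j =
      (w : Matrix (Fin r) (Fin (n + 1)) ℂ) k (i.succAbove j) := fun _ _ _ => rfl
  have hφ : Function.Surjective φ := by
    rintro ⟨x, y⟩
    refine ⟨⟨Matrix.of fun k => Fin.insertNth i ((x : Matrix (Fin r) (Fin 1) ℂ) k 0)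
      ((y : Matrix (Fin r) (Fin n) ℂ) k), fun j => ?_⟩, ?_⟩
    · refine Fin.succAboveCases i ?_ (fun j => ?_) j
      · convert x.2 0 using 1
        ext k
        simp
      · convert y.2 j using 1
        ext k
        simp
    · refine Prod.ext (Subtype.ext ?_) (Subtype.ext ?_)
      · ext k j
        fin_cases j
        rw [hφ1]
        simp
      · ext k j
        rw [hφ2]
        simp
  have key := (hcm.mul hdm).comp hφ
  convert key using 1
  ext w
  change thetaExp _ _ = thetaExp _ _ * thetaExp _ _
  rw [thetaExp, thetaExp, thetaExp, ← Complex.exp_add, ← mul_add]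
  congr 2
  rw [quad_eq_sum, quad_eq_sum, quad_eq_sum, ← Finset.sum_add_distrib]
  refine Finset.sum_congr rfl fun k _ => ?_
  simp only [dotProduct, Matrix.mulVec, Fin.sum_univ_succAbove _ i]
  simp [T, hφ1, hφ2, Fin.succAbove_ne]

/-- The matrix obtained from `S` by adding `c a` times row `i` to the row `a`, and likewise for
columns. -/
def shear (S : Matrix (Fin n) (Fin n) ℂ) (i : Fin n) (c : Fin n → ℂ) : Matrix (Fin n) (Fin n) ℂ :=
  Matrix.of fun a b => S a b + c a * S i b + S a i * star (c b) + c a * S i i * star (c b)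

theorem shear_apply (S : Matrix (Fin n) (Fin n) ℂ) (i : Fin n) (c : Fin n → ℂ) (a b : Fin n) :
    shear S i c a b = S a b + c a * S i b + S a i * star (c b) + c a * S i i * star (c b) := rfl

theorem isHermitian_shear {S : Matrix (Fin n) (Fin n) ℂ} (hS : S.IsHermitian) (i : Fin n)
    (c : Fin n → ℂ) : (shear S i c).IsHermitian := by
  ext a b
  rw [Matrix.conjTranspose_apply, shear_apply, shear_apply]
  simp only [star_add, star_mul', star_star, hS.apply]
  ring

theorem isIntegralMatrix_smul_shear {S : Matrix (Fin n) (Fin n) ℂ} {x : ℂ}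
    (hS : IsIntegralMatrix m (x • S)) (i : Fin n) {c : Fin n → ℂ}
    (hc : ∀ a, c a ∈ intRing (imQuadField m)) : IsIntegralMatrix m (x • shear S i c) := by
  intro a b
  have h : (x • shear S i c) a b = (x • S) a b + c a * (x • S) i b + (x • S) a i * star (c b) +
      c a * (x • S) i i * star (c b) := by
    simp only [Matrix.smul_apply, shear_apply, smul_eq_mul]
    ring
  rw [h]
  have hcb := star_mem_intRing (hc b)
  exact Subring.add_mem _ (Subring.add_mem _ (Subring.add_mem _ (hS a b)
    (Subring.mul_mem _ (hc a) (hS i b))) (Subring.mul_mem _ (hS a i) hcb))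
    (Subring.mul_mem _ (Subring.mul_mem _ (hc a) (hS i i)) hcb)

/-- The shear is congruence by `1 + E` with `E² = 0`, which is invertible over the integers with
inverse `1 - E`. Such a congruence only permutes the lattice. -/
theorem GaussPos.of_shear {S : Matrix (Fin n) (Fin n) ℂ} (i : Fin n) {c : Fin n → ℂ} (hci : c i = 0)
    (hc : ∀ a, c a ∈ intRing (imQuadField m))
    (h : GaussPos Λ (shear S i c)) : GaussPos Λ S := by
  set E : Matrix (Fin n) (Fin n) ℂ := Matrix.vecMulVec c (Pi.single i 1) with hE
  have hEE : E * E = 0 := by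
    rw [hE, Matrix.vecMulVec_mul_vecMulVec, single_one_dotProduct, hci]
    simp
  have hEO : IsIntegralMatrix m E := fun a b => by
    rw [hE, Matrix.vecMulVec_apply, Pi.single_apply]
    split_ifs
    · simpa using hc a
    · simp
  have hU : IsIntegralMatrix m (1 + E) := fun a b =>
    Subring.add_mem _ (one_apply_mem_intRing a b) (hEO a b)
  have hV : IsIntegralMatrix m (1 - E) := fun a b =>
    Subring.sub_mem _ (one_apply_mem_intRing a b) (hEO a b)
  have hUV : (1 + E) * (1 - E) = 1 := by
    rw [Matrix.add_mul, Matrix.mul_sub, Matrix.mul_sub, hEE]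
    simp
  have hVU : (1 - E) * (1 + E) = 1 := mul_eq_one_comm.1 hUV
  have hS : shear S i c = (1 + E) * S * (1 + E)ᴴ := by
    have h1 : ∀ X : Matrix (Fin n) (Fin n) ℂ, ∀ a b, (E * X) a b = c a * X i b := by
      intro X a b
      rw [Matrix.mul_apply, Finset.sum_eq_single i]
      · simp [hE, Matrix.vecMulVec_apply]
      · intro k _ hk
        simp [hE, Matrix.vecMulVec_apply, hk]
      · simp
    have h2 : ∀ X : Matrix (Fin n) (Fin n) ℂ, ∀ a b, (X * Eᴴ) a b = X a i * star (c b) := by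
      intro X a b
      rw [Matrix.mul_apply, Finset.sum_eq_single i]
      · simp [hE, Matrix.vecMulVec_apply]
      · intro k _ hk
        simp [hE, Matrix.vecMulVec_apply, hk]
      · simp
    ext a b
    rw [Matrix.conjTranspose_add, Matrix.conjTranspose_one, Matrix.mul_add, Matrix.mul_one,
      Matrix.add_apply, h2, Matrix.add_mul, Matrix.one_mul, Matrix.add_apply, Matrix.add_apply, h1,
      h1, shear_apply]
    ring
  rw [hS] at h
  have h3 := h.conj hV hU hUV
  have h4 : (1 - E) * ((1 + E) * S * (1 + E)ᴴ) * (1 - E)ᴴ = S := by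
    rw [Matrix.mul_assoc (1 + E), ← Matrix.mul_assoc (1 - E), hVU, Matrix.one_mul, Matrix.mul_assoc,
      ← Matrix.conjTranspose_mul, hVU, Matrix.conjTranspose_one, Matrix.mul_one]
  rwa [h4] at h3

end Positivity

/-! ### Diagonalisation modulo integral matrices at unramified primes -/

section PositivityInduction

variable {m r n : ℕ} {Λ : Submodule (𝓞 (imQuadField m)) (Fin r → ℂ)}

/-- With `N = p^l` the integer `k = N S i i` is prime to `p`, so `u k + v N = 1`. Subtracting `u N S
a i` times row `i` from row `a` leaves `S a i (1 - u k) = v N S a i`, which is integral. The matrix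
then splits into a rational number and a smaller matrix. -/
theorem GaussPos.of_pivot (hΛ : IsThetaLattice Λ) {p l : ℕ} (hp : p.Prime)
    (ih : ∀ S : Matrix (Fin n) (Fin n) ℂ, S.IsHermitian →
      IsIntegralMatrix m (((p ^ l : ℕ) : ℂ) • S) → GaussPos Λ S)
    {S : Matrix (Fin (n + 1)) (Fin (n + 1)) ℂ} (hS : S.IsHermitian)
    (hSO : IsIntegralMatrix m (((p ^ l : ℕ) : ℂ) • S)) {i : Fin (n + 1)}
    (hi : ¬∃ k : ℤ, (((p ^ l : ℕ) : ℂ) • S) i i = p * k) : GaussPos Λ S := by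
  have hN0 : ((p ^ l : ℕ) : ℂ) ≠ 0 := Nat.cast_ne_zero.2 (pow_ne_zero _ hp.ne_zero)
  obtain ⟨k, hk⟩ := exists_int_of_mem_intRing (hSO i i)
    ((isHermitian_natCast_smul hS _).apply i i)
  have hpk : ¬(p : ℤ) ∣ k := by
    rintro ⟨t, rfl⟩
    exact hi ⟨t, by rw [hk]; push_cast; rfl⟩
  have hcop : IsCoprime k ((p ^ l : ℕ) : ℤ) := by
    rw [Nat.cast_pow]
    exact (((Nat.prime_iff_prime_int.1 hp).coprime_iff_not_dvd.2 hpk).symm).pow_right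
  obtain ⟨u, v, huv⟩ := hcop
  have huvC : (u : ℂ) * k + v * ((p ^ l : ℕ) : ℂ) = 1 := by exact_mod_cast huv
  generalize hN : ((p ^ l : ℕ) : ℂ) = N at *
  let c : Fin (n + 1) → ℂ := fun a => if a = i then 0 else -(u * (N • S) a i)
  have hci : c i = 0 := if_pos rfl
  have hc : ∀ a, c a ∈ intRing (imQuadField m) := by
    intro a
    simp only [c]
    split_ifs
    · exact Subring.zero_mem _
    · exact Subring.neg_mem _ (Subring.mul_mem _ (intCast_mem_intRing u) (hSO a i))
  have hSii : N * S i i = k := hk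
  refine GaussPos.of_shear i hci hc (GaussPos.of_split hΛ (isHermitian_shear hS i c) i ?_ ?_ ?_)
  · intro a ha
    have : shear S i c a i = v * (N • S) a i := by
      rw [shear_apply, hci]
      simp only [c, if_neg ha, star_zero, mul_zero, add_zero, Matrix.smul_apply, smul_eq_mul]
      linear_combination (-S a i) * huvC - u * S a i * hSii
    rw [this]
    exact Subring.mul_mem _ (intCast_mem_intRing v) (hSO a i)
  · have : shear S i c i i = (((k : ℚ) / ((p ^ l : ℕ) : ℚ) : ℚ) : ℂ) := by
      rw [shear_apply, hci, Rat.cast_div, Rat.cast_intCast, Rat.cast_natCast, hN]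
      field_simp
      simpa [mul_comm] using hSii
    rw [this]
    exact exists_hasMean_one hΛ _
  · refine ih _ ((isHermitian_shear hS i c).submatrix _) fun a b => ?_
    exact isIntegralMatrix_smul_shear hSO i hc (i.succAbove a) (i.succAbove b)

/-- Double induction on size and exponent. A diagonal entry of the cleared matrix prime to `p`
serves as pivot. If every entry is divisible by `p`, the exponent drops. The remaining case has an
off-diagonal entry not divisible by `p`, and a shear creates a pivot from it. -/
theorem gaussPos_of_prime_pow (hΛ : IsThetaLattice Λ) {p : ℕ} (hp : p.Prime)
    (hram : ¬IsRamified m p) : ∀ (n l : ℕ) (S : Matrix (Fin n) (Fin n) ℂ), S.IsHermitian →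
      IsIntegralMatrix m (((p ^ l : ℕ) : ℂ) • S) → GaussPos Λ S := by
  intro n
  induction n with
  | zero => exact fun l S hS _ => GaussPos.of_integral hΛ hS fun i => i.elim0
  | succ n ihn =>
    intro l
    induction l with
    | zero =>
      intro S hS hSO
      rw [pow_zero, Nat.cast_one, one_smul] at hSO
      exact GaussPos.of_integral hΛ hS hSO
    | succ l ihl =>
      intro S hS hSO
      have hp0 : (p : ℂ) ≠ 0 := Nat.cast_ne_zero.2 hp.ne_zero
      by_cases hdiag : ∃ i, ¬∃ k : ℤ, (((p ^ (l + 1) : ℕ) : ℂ) • S) i i = p * k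
      · obtain ⟨i, hi⟩ := hdiag
        exact GaussPos.of_pivot hΛ hp (ihn (l + 1)) hS hSO hi
      push Not at hdiag
      by_cases hall : ∀ i j, ∃ t ∈ intRing (imQuadField m), (((p ^ (l + 1) : ℕ) : ℂ) • S) i j = p * t
      · refine ihl S hS fun i j => ?_
        obtain ⟨t, ht, h⟩ := hall i j
        have : (((p ^ l : ℕ) : ℂ) • S) i j = t := by
          rw [Matrix.smul_apply, smul_eq_mul] at h ⊢
          apply mul_left_cancel₀ hp0
          rw [← h]
          push_cast
          ring
        rw [this]
        exact ht
      push Not at hall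
      obtain ⟨j, i, hji⟩ := hall
      have hij : i ≠ j := by
        rintro rfl
        obtain ⟨k, hk⟩ := hdiag i
        exact hji k (intCast_mem_intRing k) hk
      -- Adding `a` times row `j` to row `i` (and likewise for columns) changes the cleared diagonal
      -- entry at `i` by the trace of `a` times the entry at `(j, i)`, modulo `p`. As `p` is
      -- unramified, some trace is not divisible by `p`.
      obtain ⟨a, ha, hak⟩ : ∃ a ∈ intRing (imQuadField m), ∀ k : ℤ,
          a * (((p ^ (l + 1) : ℕ) : ℂ) • S) j i + star (a * (((p ^ (l + 1) : ℕ) : ℂ) • S) j i) ≠ p * k := by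
        by_contra! hcon
        obtain ⟨t, ht, h⟩ := exists_eq_mul_of_not_isRamified hp hram (hSO j i) hcon
        exact hji t ht h
      let c : Fin (n + 1) → ℂ := Pi.single i a
      have hcj : c j = 0 := by simp [c, hij.symm]
      have hci : c i = a := by simp [c]
      have hc : ∀ b, c b ∈ intRing (imQuadField m) := by
        intro b
        by_cases hb : b = i
        · rw [hb, hci]
          exact ha
        · simp only [c]
          rw [Pi.single_eq_of_ne hb]
          exact Subring.zero_mem _
      refine GaussPos.of_shear j hcj hc (GaussPos.of_pivot hΛ hp (ihn (l + 1))
        (isHermitian_shear hS j c) (isIntegralMatrix_smul_shear hSO j hc) (i := i) ?_)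
      rintro ⟨k, hk⟩
      obtain ⟨k1, hk1⟩ := hdiag i
      obtain ⟨k2, hk2⟩ := hdiag j
      obtain ⟨k3, hk3⟩ := exists_int_of_mem_intRing (Subring.mul_mem _ ha (star_mem_intRing ha))
        (by rw [star_mul', star_star, mul_comm])
      refine hak (k - k1 - k2 * k3) ?_
      have hHij := (isHermitian_natCast_smul hS (p ^ (l + 1))).apply i j
      rw [Matrix.smul_apply, shear_apply, hci] at hk
      rw [star_mul', hHij]
      simp only [Matrix.smul_apply, smul_eq_mul] at hk hk1 hk2 ⊢
      push_cast at hk hk1 hk2 ⊢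
      linear_combination hk - hk1 - a * star a * hk2 - p * k2 * hk3

/-- Gauss sums with denominators prime to the ramified primes are positive. -/
theorem gaussPos_of_unramified (hΛ : IsThetaLattice Λ) (N : ℕ) : N ≠ 0 →
    (∀ p : ℕ, p.Prime → p ∣ N → ¬IsRamified m p) → ∀ S : Matrix (Fin n) (Fin n) ℂ, S.IsHermitian →
      IsIntegralMatrix m ((N : ℂ) • S) → GaussPos Λ S := by
  induction N using Nat.recOnPosPrimePosCoprime with
  | prime_pow p k hp hk =>
    intro _ hram S hS hSO
    exact gaussPos_of_prime_pow hΛ hp (hram p hp (dvd_pow_self p hk.ne')) n k S hS hSO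
  | zero => exact fun h => absurd rfl h
  | one =>
    intro _ _ S hS hSO
    rw [Nat.cast_one, one_smul] at hSO
    exact GaussPos.of_integral hΛ hS hSO
  | coprime a b ha hb hab iha ihb =>
    intro _ hram S hS hSO
    have ha0 : a ≠ 0 := by omega
    have hb0 : b ≠ 0 := by omega
    -- The denominator of `a²S` divides `b` and that of `b²S` divides `a`, so the two induction
    -- hypotheses are used crosswise.
    refine GaussPos.of_coprime hΛ hS hab ha0 hb0 hSO
      (ihb hb0 (fun p hp h => hram p hp (h.mul_left a)) _
        (isHermitian_natCast_smul (isHermitian_natCast_smul hS a) a) ?_)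
      (iha ha0 (fun p hp h => hram p hp (h.mul_right b)) _
        (isHermitian_natCast_smul (isHermitian_natCast_smul hS b) b) ?_)
    · have : (b : ℂ) • (a : ℂ) • (a : ℂ) • S = (a : ℂ) • ((a * b : ℕ) : ℂ) • S := by
        simp only [smul_smul]
        push_cast
        congr 1
        ring
      rw [this]
      exact hSO.smul (natCast_mem_intRing a)
    · have : (a : ℂ) • (b : ℂ) • (b : ℂ) • S = (b : ℂ) • ((a * b : ℕ) : ℂ) • S := by
        simp only [smul_smul]
        push_cast
        congr 1
        ring
      rw [this]
      exact hSO.smul (natCast_mem_intRing b)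

end PositivityInduction

/-! ## The Hermitian modular group -/

section ModularGroup

variable {m r n : ℕ} {Λ : Submodule (𝓞 (imQuadField m)) (Fin r → ℂ)}
  {A B C D : Matrix (Fin n) (Fin n) ℂ}

theorem det_mem_intRing {k : ℕ} {S : Matrix (Fin k) (Fin k) ℂ} (hS : IsIntegralMatrix m S) :
    S.det ∈ intRing (imQuadField m) := by
  rw [Matrix.det_apply]
  refine Subring.sum_mem _ fun σ _ => ?_
  rw [Units.smul_def]
  exact Subring.zsmul_mem _ (Subring.prod_mem _ fun i _ => hS _ _) _

theorem adjugate_apply_mem_intRing {S : Matrix (Fin n) (Fin n) ℂ} (hS : IsIntegralMatrix m S) :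
    IsIntegralMatrix m S.adjugate := by
  intro i j
  rw [Matrix.adjugate_apply]
  refine det_mem_intRing fun a b => ?_
  by_cases h : a = j
  · subst h
    rw [Matrix.updateRow_self, Pi.single_apply]
    split_ifs
    · exact Subring.one_mem _
    · exact Subring.zero_mem _
  · rw [Matrix.updateRow_ne h]
    exact hS a b

theorem exists_int_det (hM : Matrix.fromBlocks A B C D ∈ modularGroup (imQuadField m) n) :
    ∃ d : ℤ, D.det = d :=
  exists_int_of_mem_intRing (det_mem_intRing fun i j => hM.2 (Sum.inr i) (Sum.inr j))
    (star_det_eq hM.1)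

/-- Since `d B D⁻¹ = B adj(D)` is integral, the denominator of the Gauss sum divides `d`, and
`gaussPos_of_unramified` applies. -/
theorem theta_moebius_of_unramified_det (hΛ : IsThetaLattice Λ)
    (hM : Matrix.fromBlocks A B C D ∈ modularGroup (imQuadField m) n) {d : ℤ} (hd : D.det = d)
    (hd0 : d ≠ 0) (hram : ∀ p : ℕ, p.Prime → (p : ℤ) ∣ d → ¬IsRamified m p)
    {Z : Matrix (Fin n) (Fin n) ℂ} (hZ : Z ∈ halfSpace n) :
    theta (tupleLattice Λ n) (moebius (Matrix.fromBlocks A B C D) Z) =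
      (denom (Matrix.fromBlocks A B C D) Z).det ^ r * theta (tupleLattice Λ n) Z := by
  have hdC : (d : ℂ) ≠ 0 := Int.cast_ne_zero.2 hd0
  have hD : IsUnit D.det := by
    rw [hd]
    exact hdC.isUnit
  have hB : IsIntegralMatrix m B := fun i j => hM.2 (Sum.inl i) (Sum.inr j)
  have hDO : IsIntegralMatrix m D := fun i j => hM.2 (Sum.inr i) (Sum.inr j)
  have hint : IsIntegralMatrix m ((d.natAbs : ℂ) • (B * D⁻¹)) := by
    have h1 : (d : ℂ) • (B * D⁻¹) = B * D.adjugate := by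
      rw [Matrix.inv_def, Ring.inverse_eq_inv', hd, Matrix.mul_smul, smul_smul,
        mul_inv_cancel₀ hdC, one_smul]
    have h2 : IsIntegralMatrix m ((d : ℂ) • (B * D⁻¹)) := by
      rw [h1]
      exact mul_apply_mem_intRing hB (adjugate_apply_mem_intRing hDO)
    rcases Int.natAbs_eq d with h | h
    · have : ((d.natAbs : ℕ) : ℂ) = (d : ℂ) :=
        (Int.cast_natCast _).symm.trans (congrArg (Int.cast : ℤ → ℂ) h.symm)
      rw [this]
      exact h2
    · have : ((d.natAbs : ℕ) : ℂ) = -(d : ℂ) := by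
        exact (neg_eq_iff_eq_neg.2 ((congrArg (Int.cast : ℤ → ℂ) h).trans
          ((Int.cast_neg _).trans (congrArg _ (Int.cast_natCast _))))).symm
      rw [this, neg_smul]
      intro i j
      rw [Matrix.neg_apply]
      exact Subring.neg_mem _ (h2 i j)
  obtain ⟨c, hc, hmean⟩ := gaussPos_of_unramified hΛ d.natAbs (Int.natAbs_ne_zero.2 hd0)
    (fun p hp h => hram p hp (Int.natCast_dvd.2 h)) _ (isHermitian_mul_inv hM.1 hD) hint
  exact theta_moebius_of_hasMean hΛ (even_rank hΛ) hM hD hc hmean hZ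

theorem exists_int_modEq (P : Finset ℕ) (hP : ∀ p ∈ P, p.Prime) (f : ℕ → ℤ) :
    ∃ x : ℤ, ∀ p ∈ P, (p : ℤ) ∣ x - f p := by
  obtain ⟨k, hk⟩ := Nat.chineseRemainderOfFinset (fun p => (f p % p).toNat) (fun p => p) P
    (fun p hp => (hP p hp).ne_zero)
    (fun p hp q hq hpq => (Nat.coprime_primes (hP p hp) (hP q hq)).2 hpq)
  refine ⟨k, fun p hp => ?_⟩
  have h1 := (Int.natCast_modEq_iff.2 (hk p hp)).symm.dvd
  have hp0 : (p : ℤ) ≠ 0 := Int.natCast_ne_zero.2 (hP p hp).ne_zero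
  rw [Int.toNat_of_nonneg (Int.emod_nonneg _ hp0)] at h1
  have h2 : (k : ℤ) - f p = (k - f p % p) - p * (f p / p) := by
    linear_combination (Int.emod_add_mul_ediv (f p) p)
  rw [h2]
  exact dvd_sub h1 (dvd_mul_right _ _)

/-- A symmetric integral translation makes `det (C S + D)` prime to a given ramified prime. -/
theorem exists_isSymm_not_dvd_det
    (hM : Matrix.fromBlocks A B C D ∈ modularGroup (imQuadField m) n) {p : ℕ} (hp : p.Prime)
    (hram : IsRamified m p) : ∃ T : Matrix (Fin n) (Fin n) ℤ, T.IsSymm ∧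
      ∀ T' : Matrix (Fin n) (Fin n) ℤ, (∀ i j, (p : ℤ) ∣ T' i j - T i j) → ∀ d : ℤ,
        (C * T'.map (Int.cast : ℤ → ℂ) + D).det = d → ¬(p : ℤ) ∣ d := by
  -- Conjugation is trivial in `F`, so the reduction of `C Dᴴ = D Cᴴ` is the symmetry relation `C Dᵀ
  -- = D Cᵀ`.
  obtain ⟨F, _, ρ, hρ, hsurj, hker⟩ := exists_residue_hom hp hram
  let lift : ∀ S : Matrix (Fin n) (Fin n) ℂ, IsIntegralMatrix m S →
    Matrix (Fin n) (Fin n) (intRing (imQuadField m)) := fun S hS => Matrix.of fun i j => ⟨S i j, hS i j⟩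
  let ι := (intRing (imQuadField m)).subtype
  have hlift : ∀ S hS, ι.mapMatrix (lift S hS) = S := fun S hS => rfl
  have hι : Function.Injective (ι.mapMatrix (m := Fin n)) :=
    Matrix.map_injective Subtype.val_injective
  have hA : IsIntegralMatrix m A := fun i j => hM.2 (Sum.inl i) (Sum.inl j)
  have hB : IsIntegralMatrix m B := fun i j => hM.2 (Sum.inl i) (Sum.inr j)
  have hC : IsIntegralMatrix m C := fun i j => hM.2 (Sum.inr i) (Sum.inl j)
  have hD : IsIntegralMatrix m D := fun i j => hM.2 (Sum.inr i) (Sum.inr j)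
  have hstar : ∀ {S : Matrix (Fin n) (Fin n) ℂ}, IsIntegralMatrix m S → IsIntegralMatrix m Sᴴ :=
    fun hS i j => star_mem_intRing (hS j i)
  have hρT : ∀ S (hS : IsIntegralMatrix m S), ρ.mapMatrix (lift Sᴴ (hstar hS)) =
      (ρ.mapMatrix (lift S hS))ᵀ := by
    intro S hS
    ext i j
    exact hρ _ _ rfl
  obtain ⟨h1, h2⟩ := mem_SU_fromBlocks' hM.1
  have h1' : lift D hD * lift Aᴴ (hstar hA) - lift C hC * lift Bᴴ (hstar hB) = 1 := by
    apply hι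
    rw [map_sub, map_mul, map_mul, map_one]
    exact h1
  have h2' : lift C hC * lift Dᴴ (hstar hD) = lift D hD * lift Cᴴ (hstar hC) := by
    apply hι
    rw [map_mul, map_mul]
    exact h2
  have h1'' := congrArg ρ.mapMatrix h1'
  have h2'' := congrArg ρ.mapMatrix h2'
  rw [map_sub, map_mul, map_mul, map_one] at h1''
  rw [map_mul, map_mul, hρT D hD, hρT C hC] at h2''
  obtain ⟨S, hS, hdet⟩ := exists_isSymm_det_add_ne_zero h1'' h2''
  choose g hg using hsurj
  -- A fixed choice `g` of integral representatives keeps the lift symmetric.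
  refine ⟨Matrix.of fun i j => g (S i j), ?_, fun T' hT' d hd hdvd => hdet ?_⟩
  · ext i j
    simp only [Matrix.transpose_apply, Matrix.of_apply]
    rw [hS.apply]
  · let T'' : Matrix (Fin n) (Fin n) (intRing (imQuadField m)) := T'.map (Int.cast)
    have e1 : ρ.mapMatrix T'' = S := by
      ext i j
      have h3 := (hker _).2 (hT' i j)
      rw [Matrix.of_apply, Int.cast_sub, map_sub, hg, sub_eq_zero] at h3
      exact h3
    have e2 : ι.mapMatrix T'' = T'.map (Int.cast : ℤ → ℂ) := by
      ext i j
      simp [T'', ι]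
    have e3 : (lift C hC * T'' + lift D hD).det = (d : intRing (imQuadField m)) := by
      apply Subtype.val_injective
      have h4 : ι (lift C hC * T'' + lift D hD).det = (C * T'.map (Int.cast : ℤ → ℂ) + D).det := by
        rw [RingHom.map_det, map_add, map_mul, e2]
        rfl
      refine h4.trans (hd.trans ?_)
      simp
    rw [← e1, ← map_mul, ← map_add, ← RingHom.map_det, e3]
    exact (hker d).2 hdvd

/-- The transformation formula of the theta series under the Hermitian modular group. -/
theorem theta_modularGroup (hm : Squarefree m) (hΛ : IsThetaLattice Λ)
    {M : Matrix (Fin n ⊕ Fin n) (Fin n ⊕ Fin n) ℂ} (hM : M ∈ modularGroup (imQuadField m) n)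
    {Z : Matrix (Fin n) (Fin n) ℂ} (hZ : Z ∈ halfSpace n) : moebius M Z ∈ halfSpace n ∧
      theta (tupleLattice Λ n) (moebius M Z) =
        (denom M Z).det ^ r * theta (tupleLattice Λ n) Z := by
  classical
  rw [← Matrix.fromBlocks_toBlocks M] at hM ⊢
  generalize M.toBlocks₁₁ = A at *
  generalize M.toBlocks₁₂ = B at *
  generalize M.toBlocks₂₁ = C at *
  generalize M.toBlocks₂₂ = D at *
  -- By `IsRamified.dvd` this finite set contains every ramified prime.
  let P := (4 * m).primeFactors.filter (IsRamified m)
  have hP : ∀ p, p ∈ P ↔ p.Prime ∧ IsRamified m p := by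
    intro p
    rw [Finset.mem_filter, Nat.mem_primeFactors]
    refine ⟨fun h => ⟨h.1.1, h.2⟩, fun h => ⟨⟨h.1, h.2.dvd, ?_⟩, h.2⟩⟩
    have := hm.ne_zero
    positivity
  have hT : ∀ p, ∃ T : Matrix (Fin n) (Fin n) ℤ, T.IsSymm ∧ (p ∈ P →
      ∀ T' : Matrix (Fin n) (Fin n) ℤ, (∀ i j, (p : ℤ) ∣ T' i j - T i j) → ∀ d : ℤ,
        (C * T'.map (Int.cast : ℤ → ℂ) + D).det = d → ¬(p : ℤ) ∣ d) := by
    intro p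
    by_cases hp : p ∈ P
    · obtain ⟨T, h1, h2⟩ := exists_isSymm_not_dvd_det hM ((hP p).1 hp).1 ((hP p).1 hp).2
      exact ⟨T, h1, fun _ => h2⟩
    · exact ⟨0, Matrix.isSymm_zero, fun h => absurd h hp⟩
  choose T hTs hTd using hT
  choose x hx using exists_int_modEq P fun p hp => ((hP p).1 hp).1
  let T' : Matrix (Fin n) (Fin n) ℤ := Matrix.of fun i j => x fun p => T p i j
  set S := T'.map (Int.cast : ℤ → ℂ) with hS
  have hSH : S.IsHermitian := by
    ext i j
    rw [Matrix.conjTranspose_apply, hS, Matrix.map_apply, Matrix.map_apply]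
    simp only [T', Matrix.of_apply, (hTs _).apply i j]
    simp
  have hSO : IsIntegralMatrix m S := fun i j => intCast_mem_intRing _
  have hM' : Matrix.fromBlocks A (A * S + B) C (C * S + D) ∈ modularGroup (imQuadField m) n := by
    refine ⟨mul_translation_mem_SU hM.1 hSH, ?_⟩
    have hA : IsIntegralMatrix m A := fun i j => hM.2 (Sum.inl i) (Sum.inl j)
    have hB : IsIntegralMatrix m B := fun i j => hM.2 (Sum.inl i) (Sum.inr j)
    have hC : IsIntegralMatrix m C := fun i j => hM.2 (Sum.inr i) (Sum.inl j)
    have hD : IsIntegralMatrix m D := fun i j => hM.2 (Sum.inr i) (Sum.inr j)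
    rintro (i | i) (j | j)
    exacts [hA i j, Subring.add_mem _ (mul_apply_mem_intRing hA hSO i j) (hB i j), hC i j,
      Subring.add_mem _ (mul_apply_mem_intRing hC hSO i j) (hD i j)]
  obtain ⟨d, hd⟩ := exists_int_det hM'
  have hram : ∀ p ∈ P, ¬(p : ℤ) ∣ d := fun p hp =>
    hTd p hp T' (fun i j => hx (fun p => T p i j) p hp) d hd
  -- Zero is divisible by every prime, so the existence of one ramified prime already forces `d ≠
  -- 0`.
  have hd0 : d ≠ 0 := by
    obtain ⟨p, hp⟩ := exists_prime_isRamified hm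
    rintro rfl
    exact hram p ((hP p).2 hp) (dvd_zero _)
  have hZ' : Z - S ∈ halfSpace n := by
    rw [sub_eq_add_neg]
    exact add_mem_halfSpace hZ hSH.neg
  have h1 := theta_moebius_of_unramified_det hΛ hM' hd hd0
    (fun p hp hpd hpr => hram p ((hP p).2 ⟨hp, hpr⟩) hpd) hZ'
  have h2 := moebius_mem_halfSpace hM'.1 (by
    rw [hd]
    exact (Int.cast_ne_zero.2 hd0).isUnit) hZ'
  -- The translated matrix at `Z - S` acts as `M` does at `Z`, and `theta` has the same value at `Z
  -- - S` and at `Z`.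
  rw [moebius_translation] at h1 h2
  have h3 := theta_add_of_integral hΛ hSH hSO (Z - S)
  rw [sub_add_cancel] at h3
  rw [denom_translation, ← h3] at h1
  exact ⟨h2, h1⟩

end ModularGroup

/-! ## The extension matrices -/

section Extension

variable {m r n : ℕ} {Λ : Submodule (𝓞 (imQuadField m)) (Fin r → ℂ)}

theorem algebraMap_smul_eq (a : 𝓞 (imQuadField m)) (x : Fin r → ℂ) :
    (algebraMap (𝓞 (imQuadField m)) ℂ a) • x = a • x := by
  ext i
  simp [Algebra.smul_def]

theorem apply_mem_entryIdeal {K : IntermediateField ℚ ℂ} (L : Matrix (Fin n) (Fin n) (𝓞 K))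
    (i j : Fin n) : L i j ∈ entryIdeal K L :=
  Ideal.subset_span ⟨i, j, rfl⟩

theorem det_mem_pow {R : Type*} [CommRing R] {I : Ideal R} {k : ℕ} {M : Matrix (Fin k) (Fin k) R}
    (hM : ∀ i j, M i j ∈ I) : M.det ∈ I ^ k := by
  rw [Matrix.det_apply]
  refine Ideal.sum_mem _ fun σ _ => ?_
  rw [Units.smul_def]
  refine zsmul_mem ?_ _
  have := Ideal.prod_mem_prod (s := Finset.univ) (I := fun _ : Fin k => I)
    (x := fun i => M (σ i) i) fun i _ => hM _ _
  simpa using this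

theorem adjugate_mem_pow {R : Type*} [CommRing R] {I : Ideal R} {k : ℕ}
    {M : Matrix (Fin (k + 1)) (Fin (k + 1)) R} (hM : ∀ i j, M i j ∈ I) (i j : Fin (k + 1)) :
    M.adjugate i j ∈ I ^ k := by
  rw [Matrix.adjugate_fin_succ_eq_det_submatrix]
  exact Ideal.mul_mem_left _ _ (det_mem_pow fun a b => hM _ _)

/-- The column of a product with an integral matrix. -/
theorem transpose_mul_map (w : Matrix (Fin r) (Fin n) ℂ)
    (L : Matrix (Fin n) (Fin n) (𝓞 (imQuadField m))) (j : Fin n) :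
    (w * L.map (algebraMap (𝓞 (imQuadField m)) ℂ))ᵀ j = ∑ i, L i j • wᵀ i := by
  ext k
  simp only [Matrix.transpose_apply, Matrix.mul_apply, Matrix.map_apply, Finset.sum_apply,
    Pi.smul_apply, Algebra.smul_def]
  exact Finset.sum_congr rfl fun i _ => mul_comm _ _

/-- Cramer's rule for `w L = x`: the adjugate has entries in `I^(n-1)`, so the columns of `x adj(L)`
lie in `Iⁿ Λ = det(L) Λ` and can be divided by `det L`. -/
theorem exists_mul_eq_of_mem_smul {L : Matrix (Fin n) (Fin n) (𝓞 (imQuadField m))} (hn : 1 ≤ n)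
    (hL : entryIdeal _ L ^ n = Ideal.span {L.det}) (hdet : L.det ≠ 0)
    {x : Matrix (Fin r) (Fin n) ℂ} (hx : ∀ j, xᵀ j ∈ entryIdeal _ L • Λ) :
    ∃ w ∈ tupleLattice Λ n, w * L.map (algebraMap (𝓞 (imQuadField m)) ℂ) = x := by
  obtain ⟨k, rfl⟩ : ∃ k, n = k + 1 := ⟨n - 1, by omega⟩
  set f := algebraMap (𝓞 (imQuadField m)) ℂ with hf
  have h1 : ∀ j, ∃ v ∈ Λ, L.det • v = (x * L.adjugate.map f)ᵀ j := by
    intro j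
    have h2 : (x * L.adjugate.map f)ᵀ j ∈ entryIdeal _ L ^ (k + 1) • Λ := by
      rw [transpose_mul_map, pow_succ, ← smul_eq_mul, smul_assoc]
      exact Submodule.sum_mem _ fun i _ =>
        Submodule.smul_mem_smul (adjugate_mem_pow (apply_mem_entryIdeal L) i j) (hx i)
    rw [hL, Submodule.ideal_span_singleton_smul] at h2
    obtain ⟨v, hv, h⟩ := h2
    exact ⟨v, hv, h⟩
  choose v hv hvx using h1
  refine ⟨Matrix.of fun i j => v j i, hv, ?_⟩
  have hd : f L.det ≠ 0 := by
    rw [hf, Ne, map_eq_zero_iff _ (FaithfulSMul.algebraMap_injective _ _)]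
    exact hdet
  have h3 : f L.det • (Matrix.of fun i j => v j i) = x * L.adjugate.map f := by
    ext i j
    have := congrFun (hvx j) i
    rw [← algebraMap_smul_eq] at this
    exact this
  have h4 : L.adjugate.map f * L.map f = f L.det • 1 := by
    rw [← Matrix.map_mul, Matrix.adjugate_mul]
    ext i j
    simp [Matrix.one_apply, apply_ite f]
  have h5 : f L.det • ((Matrix.of fun i j => v j i) * L.map f) = f L.det • x := by
    rw [← Matrix.smul_mul, h3, Matrix.mul_assoc, h4, Matrix.mul_smul, Matrix.mul_one]
  exact smul_right_injective _ hd h5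

/-- Taking norms in `Iⁿ = (det L)` with `det L = uⁿ` gives `N(I)ⁿ = |u|^(2n)`, and positive `n`-th
roots are unique. -/
theorem norm_sq_eq_absNorm (hm : Squarefree m) (hn : 1 ≤ n) {u : ℂ}
    {L : Matrix (Fin n) (Fin n) (𝓞 (imQuadField m))}
    (hL : entryIdeal _ L ^ n = Ideal.span {L.det})
    (hu : algebraMap (𝓞 (imQuadField m)) ℂ L.det = u ^ n) :
    (Ideal.absNorm (entryIdeal _ L) : ℝ) = ‖u‖ ^ 2 := by
  have h1 := absNorm_span_singleton hm.ne_zero L.det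
  rw [← hL, map_pow, hu, Nat.cast_pow, norm_pow, ← pow_mul, mul_comm n, pow_mul] at h1
  exact (pow_left_inj₀ (Nat.cast_nonneg _) (by positivity) (by omega)).1 h1

theorem theta_conj_of_equiv {L : AddSubgroup (Matrix (Fin r) (Fin n) ℂ)}
    {A : Matrix (Fin n) (Fin n) ℂ} (e : L ≃ L)
    (he : ∀ w : L, ((w : Matrix (Fin r) (Fin n) ℂ) * A)ᴴ * ((w : Matrix (Fin r) (Fin n) ℂ) * A) =
      (e w : Matrix (Fin r) (Fin n) ℂ)ᴴ * (e w : Matrix (Fin r) (Fin n) ℂ))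
    (Z : Matrix (Fin n) (Fin n) ℂ) : theta L (A * Z * Aᴴ) = theta L Z := by
  refine Eq.trans ?_ (e.tsum_eq fun w : L => thetaExp Z (w : Matrix (Fin r) (Fin n) ℂ))
  refine tsum_congr fun w => ?_
  rw [← thetaExp_mul, thetaExp, thetaExp, quad, quad, he]

/-- Multiplication by the integral matrix maps `Λⁿ` bijectively onto `(IΛ)ⁿ`. The scalars `u⁻¹` and
`N(I)^{-1/2}` differ by a phase, which Gram matrices do not see, and the isometry given by strong
modularity leads back to `Λⁿ` column by column. -/
theorem exists_equiv_of_mem_extensionMatrices (hm : Squarefree m) (hmod : IsStronglyModular Λ)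
    (hn : 1 ≤ n) {A : Matrix (Fin n) (Fin n) ℂ} (hA : A ∈ extensionMatrices (imQuadField m) n) :
    ∃ e : tupleLattice Λ n ≃ tupleLattice Λ n, ∀ w : tupleLattice Λ n,
      ((w : Matrix (Fin r) (Fin n) ℂ) * A)ᴴ * ((w : Matrix (Fin r) (Fin n) ℂ) * A) =
        (e w : Matrix (Fin r) (Fin n) ℂ)ᴴ * (e w : Matrix (Fin r) (Fin n) ℂ) := by
  obtain ⟨hdetA, u, L, rfl, hL⟩ := hA
  set f := algebraMap (𝓞 (imQuadField m)) ℂ with hf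
  set I := entryIdeal (imQuadField m) L with hI
  have hu0 : u ≠ 0 := by
    rintro rfl
    have : Nonempty (Fin n) := ⟨⟨0, hn⟩⟩
    rw [inv_zero, zero_smul, Matrix.det_zero] at hdetA
    exact zero_ne_one hdetA
  have hu : f L.det = u ^ n := by
    rw [Matrix.det_smul, Fintype.card_fin, inv_pow, ← RingHom.mapMatrix_apply, ← RingHom.map_det,
      inv_mul_eq_one₀ (pow_ne_zero _ hu0)] at hdetA
    exact hdetA.symm
  have hdet : L.det ≠ 0 := by
    intro h
    rw [h, map_zero] at hu
    exact pow_ne_zero _ hu0 hu.symm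
  have hI0 : I ≠ ⊥ := by
    intro h
    rw [h, ← Ideal.zero_eq_bot, zero_pow (by omega), eq_comm, Ideal.zero_eq_bot,
      Ideal.span_singleton_eq_bot] at hL
    exact hdet hL
  have hnorm := norm_sq_eq_absNorm hm hn hL hu
  set s : ℂ := (((Real.sqrt (Ideal.absNorm I))⁻¹ : ℝ) : ℂ) with hs
  have hsqrt : Real.sqrt (Ideal.absNorm I) = ‖u‖ := by
    rw [hnorm, Real.sqrt_sq (norm_nonneg _)]
  have hs0 : s ≠ 0 := by
    rw [hs, hsqrt]
    exact Complex.ofReal_ne_zero.2 (inv_ne_zero (norm_ne_zero_iff.2 hu0))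
  have hss : star u⁻¹ * u⁻¹ = star s * s := by
    rw [hs, hsqrt, Complex.star_def, ← Complex.normSq_eq_conj_mul_self,
      ← Complex.normSq_eq_conj_mul_self, Complex.normSq_eq_norm_sq, Complex.normSq_eq_norm_sq]
    simp
  obtain ⟨φ, hφ⟩ := hmod I hI0
  have hmem : ∀ (w : tupleLattice Λ n) (j : Fin n),
      (s • ((w : Matrix (Fin r) (Fin n) ℂ) * L.map f))ᵀ j ∈ scaledLattice I Λ := by
    intro w j
    refine Submodule.smul_mem_pointwise_smul (((w : Matrix (Fin r) (Fin n) ℂ) * L.map f)ᵀ j) s _ ?_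
    rw [transpose_mul_map]
    exact Submodule.sum_mem _ fun i _ =>
      Submodule.smul_mem_smul (apply_mem_entryIdeal L i j) (w.2 i)
  let g : tupleLattice Λ n → tupleLattice Λ n := fun w =>
    ⟨Matrix.of fun i j => (φ.symm ⟨_, hmem w j⟩ : Fin r → ℂ) i, fun j => (φ.symm ⟨_, hmem w j⟩).2⟩
  have hg : ∀ w j, φ ⟨(g w : Matrix (Fin r) (Fin n) ℂ)ᵀ j, (g w).2 j⟩ = ⟨_, hmem w j⟩ :=
    fun w j => φ.apply_symm_apply _
  have hLu : IsUnit (L.map f).det := by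
    rw [← RingHom.mapMatrix_apply, ← RingHom.map_det, hu]
    exact (pow_ne_zero _ hu0).isUnit
  have hginj : Function.Injective g := by
    intro v w h
    apply Subtype.ext
    have h1 : s • ((v : Matrix (Fin r) (Fin n) ℂ) * L.map f) =
        s • ((w : Matrix (Fin r) (Fin n) ℂ) * L.map f) := by
      apply Matrix.transpose_injective
      funext j
      have h2 := hg v j
      simp only [h] at h2
      exact congrArg Subtype.val (h2.symm.trans (hg w j))
    have h3 := smul_right_injective _ hs0 h1
    rw [← Matrix.mul_nonsing_inv_cancel_right (L.map f) v.1 hLu, h3,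
      Matrix.mul_nonsing_inv_cancel_right (L.map f) w.1 hLu]
  have hgsurj : Function.Surjective g := by
    intro v
    have h1 : ∀ j, ∃ x ∈ I • Λ, s • x = (φ ⟨(v : Matrix (Fin r) (Fin n) ℂ)ᵀ j, v.2 j⟩ : Fin r → ℂ) :=
      fun j => (φ ⟨(v : Matrix (Fin r) (Fin n) ℂ)ᵀ j, v.2 j⟩).2
    choose x hx hxv using h1
    obtain ⟨w, hw, hwx⟩ := exists_mul_eq_of_mem_smul (x := Matrix.of fun i j => x j i) hn hL hdet hx
    refine ⟨⟨w, hw⟩, ?_⟩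
    apply Subtype.ext
    apply Matrix.transpose_injective
    funext j
    have h2 := hg ⟨w, hw⟩ j
    have h3 : (⟨_, hmem ⟨w, hw⟩ j⟩ : scaledLattice I Λ) =
        φ ⟨(v : Matrix (Fin r) (Fin n) ℂ)ᵀ j, v.2 j⟩ := by
      apply Subtype.ext
      rw [← hxv j]
      change (s • (w * L.map f))ᵀ j = _
      rw [hwx]
      rfl
    exact congrArg Subtype.val (φ.injective (h2.trans h3))
  refine ⟨Equiv.ofBijective g ⟨hginj, hgsurj⟩, fun w => ?_⟩
  have hscale : ∀ (c : ℂ) (x : Matrix (Fin r) (Fin n) ℂ), (c • x)ᴴ * (c • x) =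
      (star c * c) • (xᴴ * x) := by
    intro c x
    rw [Matrix.conjTranspose_smul, Matrix.smul_mul, Matrix.mul_smul, smul_smul]
  rw [Matrix.mul_smul, hscale, hss, ← hscale]
  ext i j
  have h1 := hφ ⟨(g w : Matrix (Fin r) (Fin n) ℂ)ᵀ i, (g w).2 i⟩
    ⟨(g w : Matrix (Fin r) (Fin n) ℂ)ᵀ j, (g w).2 j⟩
  rw [hg, hg] at h1
  exact h1

end Extension

/-! ## The extended modular group -/

section ExtendedModularGroup

variable {m r n : ℕ} {Λ : Submodule (𝓞 (imQuadField m)) (Fin r → ℂ)}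

/-- The block factor acts by `Z ↦ A Z Aᴴ`, which leaves `theta` unchanged. Since `det A = 1` it also
leaves the determinant of the automorphy factor unchanged, so the formula reduces to the one for the
Hermitian modular group. -/
theorem thetaSeries_transform (hm : Squarefree m) (hΛ : IsThetaLattice Λ)
    (hmod : IsStronglyModular Λ) (hn : 1 ≤ n) {M : Matrix (Fin n ⊕ Fin n) (Fin n ⊕ Fin n) ℂ}
    (hM : M ∈ extendedModularGroup (imQuadField m) n) {Z : Matrix (Fin n) (Fin n) ℂ}
    (hZ : Z ∈ halfSpace n) :
    thetaSeries n Λ (moebius M Z) = (denom M Z).det ^ (r : ℤ) * thetaSeries n Λ Z := by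
  obtain ⟨A, hA, γ, hγ, rfl⟩ := hM
  have hAu : IsUnit A.det := by
    rw [hA.1]
    exact isUnit_one
  obtain ⟨h1, h2⟩ := theta_modularGroup hm hΛ hγ hZ
  obtain ⟨e, he⟩ := exists_equiv_of_mem_extensionMatrices hm hmod hn hA
  rw [moebius_blockMatrix_mul hAu, thetaSeries_eq hΛ (conj_mem_halfSpace h1 hAu),
    thetaSeries_eq hΛ hZ, theta_conj_of_equiv e he, h2, denom_blockMatrix_mul, Matrix.det_mul,
    Matrix.det_nonsing_inv, Matrix.det_conjTranspose, hA.1, star_one, Ring.inverse_one, one_mul,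
    zpow_natCast]

theorem isModularForm_thetaSeries (hm : Squarefree m) (hΛ : IsThetaLattice Λ)
    (hmod : IsStronglyModular Λ) (hn : 1 ≤ n) :
    IsModularForm (extendedModularGroup (imQuadField m) n) (r : ℤ) (thetaSeries n Λ) where
  holomorphic := (differentiableOn_theta (hΛ.isUnimodularLattice n)).congr fun _ hZ =>
    thetaSeries_eq hΛ hZ
  transform _ hM _ hZ := thetaSeries_transform hm hΛ hmod hn hM hZ
  bounded := by
    rintro rfl
    exact ⟨_, fun Z hZ hZ1 => (thetaSeries_eq hΛ hZ ▸
      norm_theta_le (hΛ.isUnimodularLattice 1) hZ1 :)⟩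

end ExtendedModularGroup

end HermitianTheta

end

theorem theorem2 (m : ℕ) (hm : Squarefree m) (r : ℕ)
    (Λ : Submodule (𝓞 (HermitianTheta.imQuadField m)) (Fin r → ℂ))
    (hΛ : HermitianTheta.IsThetaLattice Λ) (hmod : HermitianTheta.IsStronglyModular Λ)
    (n : ℕ) (hn : 1 ≤ n) :
    (∀ T : Matrix (Fin n) (Fin n) ℂ, (HermitianTheta.representations Λ T).Finite) ∧
    (∀ Z ∈ HermitianTheta.halfSpace n,
      Summable fun T : {T : Matrix (Fin n) (Fin n) ℂ // T.PosSemidef} =>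
        HermitianTheta.thetaTerm Λ Z T) ∧
    HermitianTheta.IsModularForm
      (HermitianTheta.extendedModularGroup (HermitianTheta.imQuadField m) n) (r : ℤ)
      (HermitianTheta.thetaSeries n Λ) :=
  ⟨HermitianTheta.finite_representations hΛ,
    fun _ hZ => (HermitianTheta.hasSum_thetaTerm hΛ hZ).summable,
    HermitianTheta.isModularForm_thetaSeries hm hΛ hmod hn⟩
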